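/- Let $(M,d)$ be a locally compact separable metric space, $m$ a positive Radon measure on $M$ with full support, and $(\mathcal E,\mathcal F)$ a regular Dirichlet form on $L^2(M;m)$ of pure jump type, i.e. there is a symmetric positive Radon measure $J$ on $M\times M\setminus\mathrm{diag}$ with $$\mathcal E(u,v)=\iint_{M\times M\setminus \mathrm{diag}}(u(x)-u(y))(v(x)-v(y))\,J(dx\,dy)\qquad (u,v\in\mathcal F\cap C_0(M)),$$ where $C_0(M)$ denotes the continuous functions with compact support. Let $(X_t)_{t\ge0}$, $(P_x)_{x}$ be an $m$-symmetric Hunt process on $M$ generated by $(\mathcal E,\mathcal F)$, with values in the one-point compactification $M\cup\{\Delta\}$. A statement holds for q.e. $x\in M$ if it holds outside a set of zero $1$-capacity with respect to $(\mathcal E,\mathcal F)$. Write $B(x,r)=\{y: d(y,x)<r\}$ and $V(x,r)=m(B(x,r))$. Assume the following. (1) $V(x,r)<\infty$ for all $x\in M$, $r>0$, and there are constants $c_1\in(0,1]$, $c_2\in[1,\infty)$, $d_2\ge d_1>0$ with $$c_1\Big(\frac Rr\Big)^{d_1}\le\frac{V(x,R)}{V(x,r)}\le c_2\Big(\frac Rr\Big)^{d_2}\qquad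 (x\in M,\ 0<r<R).$$ (2) There are a properly exceptional Borel set $N\subset M$ (that is, $m(N)=0$ and, for every $x\in M\setminus N$, $P_x$-a.s. $X_t\notin N$ and $X_{t-}\notin N$ for all $t>0$) and a nonnegative symmetric kernel $p(t,x,y)$ on $(0,\infty)\times(M\setminus N)\times(M\setminus N)$ such that $P_x(X_t\in A)=\int_A p(t,x,y)\,m(dy)$ for all $t>0$, $x\in M\setminus N$ and Borel $A\subset M$, and $p(t+s,x,y)=\int_M p(t,x,z)p(s,z,y)\,m(dz)$ for all $t,s>0$ and $x,y\in M\setminus N$. (3) There are positive constants $L_1,L_2$ and an increasing function $\phi$ on $[0,\infty)$ with $\phi(0)=0$, $\phi(r)>0$ for $r>0$, and $$c_3\Big(\frac Rr\Big)^{d_3}\le\frac{\phi(R)}{\phi(r)}\le c_4\Big(\frac Rr\Big)^{d_4}\qquad(0<r<R)$$ for some $c_3\in(0,1]$, $c_4\in[1,\infty)$, $d_4\ge d_3>0$, such that for all $t>0$ and $x,y\in M\setminus N$ $$L_1\min\Big\{\frac1{V(x,\phi^{-1}(t))},\frac{t}{V(x,d(x,y))\phi(d(x,y))}\Big\}\le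 p(t,x,y)\le L_2\min\Big\{\frac1{V(x,\phi^{-1}(t))},\frac{t}{V(x,d(x,y))\phi(d(x,y))}\Big\},$$ the second term being $\infty$ if $x=y$. Here $\phi^{-1}(t)=\inf\{s\ge0:\phi(s)>t\}$, which is the inverse function of $\phi$ if $\phi$ is a bijection of $[0,\infty)$. (4) (Critical case.) There are constants $c_{v,1},c_{v,2}>0$ with $c_{v,1}\phi(r)\le V(x,r)\le c_{v,2}\phi(r)$ for all $x\in M$ and $r>0$. Let $g$ be a positive decreasing function on $(0,\infty)$ with $g(t)\to0$ as $t\to\infty$, and put $\varphi(t)=\phi^{-1}(t)g(t)$ and $$q_\varphi(t,x)=P_x\big(d(X_u,x)\le\varphi(u)\text{ for some }u>t\big),\qquad R_{c,t}=\sup\Big\{\frac{|\log g(u)|}{|\log g(v)|}:\ 1\le\frac uv\le c,\ v\ge t\Big\}\quad(c>1,\ t>0).$$ Suppose that $$\int_1^\infty\frac{dt}{t|\log g(t)|}<\infty\qquad\text{and}\qquad\lim_{c\to1+0}\Big(\lim_{t\to\infty}R_{c,t}\Big)=1.$$ Then, for q.e. $x\in M$, $$q_\varphi(t,x)\asymp\int_t^\infty\frac{ds}{s|\log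 g(s)|}\qquad(t\to\infty),$$ that is, there are positive constants $T,C_1,C_2$ such that $C_1\int_t^\infty\frac{ds}{s|\log g(s)|}\le q_\varphi(t,x)\le C_2\int_t^\infty\frac{ds}{s|\log g(s)|}$ for all $t\ge T$. -/

import Mathlib

open MeasureTheory ProbabilityTheory Filter Topology Set
open scoped NNReal ENNReal

noncomputable section

/-- The one-point compactification `M ∪ {Δ}` (the cemetery `Δ` is the point `∞`) carries its Borel
σ-algebra. -/
instance OnePoint.borelMeasurableSpace (M : Type*) [TopologicalSpace M] :
    MeasurableSpace (OnePoint M) := borel (OnePoint M)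

instance OnePoint.borelSpace_onePoint (M : Type*) [TopologicalSpace M] :
    BorelSpace (OnePoint M) := ⟨rfl⟩

/-! ### Dirichlet forms and capacity -/

/-- A Dirichlet form on `L²(M; m)`: a densely defined, symmetric, nonnegative definite bilinear form
which is closed (its domain is complete for `E₁(u, u) = E(u, u) + ‖u‖²`) and Markovian (the unit
contraction `(0 ∨ u) ∧ 1` operates on it). -/
structure DirichletForm {M : Type*} [MeasurableSpace M] (m : Measure M) where
  domain : Submodule ℝ (Lp ℝ 2 m)
  form : LinearMap.BilinForm ℝ domain
  dense_domain : Dense (domain : Set (Lp ℝ 2 m))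
  symm : ∀ u v : domain, form u v = form v u
  nonneg : ∀ u : domain, 0 ≤ form u u
  closed : ∀ u : ℕ → domain,
    (∀ ε : ℝ, 0 < ε → ∃ n₀ : ℕ, ∀ i ≥ n₀, ∀ j ≥ n₀,
      form (u i - u j) (u i - u j) + ‖((u i - u j : domain) : Lp ℝ 2 m)‖ ^ 2 < ε) →
    ∃ v : domain, Tendsto
      (fun n => form (u n - v) (u n - v) + ‖((u n - v : domain) : Lp ℝ 2 m)‖ ^ 2) atTop (𝓝 0)
  markov : ∀ u : domain, ∃ v : domain,
    ((v : Lp ℝ 2 m) : M → ℝ) =ᵐ[m] (fun x => min (max ((u : Lp ℝ 2 m) x) 0) 1) ∧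
      form v v ≤ form u u

namespace DirichletForm

section

variable {M : Type*} [MeasurableSpace M] {m : Measure M} (E : DirichletForm m)

/-- `E₁(u, u) = E(u, u) + ‖u‖²`. -/
def energyOne (u : E.domain) : ℝ := E.form u u + ‖(u : Lp ℝ 2 m)‖ ^ 2

variable [TopologicalSpace M]

/-- `u ∈ F` is (the class of) the continuous compactly supported function `f`. -/
def IsCore (u : E.domain) (f : M → ℝ) : Prop :=
  Continuous f ∧ HasCompactSupport f ∧ ((u : Lp ℝ 2 m) : M → ℝ) =ᵐ[m] f

/-- Regularity: `F ∩ C₀(M)` is dense in `F` for the `E₁`-norm and in `C₀(M)` for the uniform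
norm. -/
structure IsRegular : Prop where
  dense_domain : ∀ u : E.domain, ∀ ε : ℝ, 0 < ε →
    ∃ (v : E.domain) (f : M → ℝ), E.IsCore v f ∧ E.energyOne (u - v) < ε
  dense_continuous : ∀ f : M → ℝ, Continuous f → HasCompactSupport f → ∀ ε : ℝ, 0 < ε →
    ∃ (v : E.domain) (h : M → ℝ), E.IsCore v h ∧ ∀ x, |f x - h x| < ε

/-- The Beurling-Deny expression of `E` has only a jump part:
`E(u, v) = ∬_{x ≠ y} (u(x) - u(y)) (v(x) - v(y)) J(dx dy)` for `u, v ∈ F ∩ C₀(M)`, where `J` is a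
symmetric positive Radon measure on `M × M` minus the diagonal (as a measure on `M × M` it does not
charge the diagonal, and it is finite on the compact sets that avoid the diagonal). -/
def IsPureJump : Prop :=
  ∃ J : Measure (M × M),
    J {z | z.1 = z.2} = 0 ∧
    (∀ K : Set (M × M), IsCompact K → (∀ z ∈ K, z.1 ≠ z.2) → J K < ∞) ∧
    J.map Prod.swap = J ∧
    ∀ (u v : E.domain) (f h : M → ℝ), E.IsCore u f → E.IsCore v h →
      Integrable (fun z : M × M => (f z.1 - f z.2) * (h z.1 - h z.2)) J ∧
      E.form u v = ∫ z, (f z.1 - f z.2) * (h z.1 - h z.2) ∂J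

/-- The capacity of an open set `A`: the infimum of `E₁(u, u)` over the `u ∈ F` with `u ≥ 1`
`m`-a.e. on `A` (it is `∞` if there is no such `u`). -/
def openCapacity (A : Set M) : ℝ≥0∞ :=
  ⨅ (u : E.domain) (_ : ∀ᵐ x ∂m, x ∈ A → 1 ≤ (u : Lp ℝ 2 m) x), ENNReal.ofReal (E.energyOne u)

/-- The (1-)capacity of an arbitrary set. -/
def capacity (A : Set M) : ℝ≥0∞ :=
  ⨅ (B : Set M) (_ : IsOpen B) (_ : A ⊆ B), E.openCapacity B

/-- A property holds quasi everywhere if it holds outside a set of zero capacity. -/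
def QuasiEverywhere (Q : M → Prop) : Prop :=
  ∃ A : Set M, E.capacity A = 0 ∧ ∀ x, x ∉ A → Q x

end

end DirichletForm

/-! ### Hunt processes -/

/-- A Hunt process on `M` (with values in `M ∪ {Δ}`, sample space `Ω` and laws `P x`). -/
structure HuntProcess (M : Type*) [TopologicalSpace M] (Ω : Type*) [mΩ : MeasurableSpace Ω] where
  /-- the process -/
  X : ℝ≥0 → Ω → OnePoint M
  /-- the law of the process started at a point of `M ∪ {Δ}` -/
  P : Kernel (OnePoint M) Ω
  isMarkovKernel : IsMarkovKernel P
  /-- an admissible right-continuous filtration -/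
  filtration : Filtration ℝ≥0 mΩ
  rightContinuous_filtration : filtration.IsRightContinuous
  adapted : ∀ t, Measurable[filtration t] (X t)
  start : ∀ x : OnePoint M, ∀ᵐ ω ∂(P x), X 0 ω = x
  /-- the cemetery is absorbing -/
  absorbing : ∀ (ω : Ω) (s t : ℝ≥0), s ≤ t → X s ω = OnePoint.infty → X t ω = OnePoint.infty
  /-- existence of the shift operators -/
  shift : ∀ t : ℝ≥0, ∃ θ : Ω → Ω, ∀ (s : ℝ≥0) (ω : Ω), X s (θ ω) = X (t + s) ω
  right_continuous : ∀ (ω : Ω) (t : ℝ≥0), ContinuousWithinAt (fun s => X s ω) (Ici t) t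
  left_limits : ∀ (ω : Ω) (t : ℝ≥0), 0 < t →
    ∃ y : OnePoint M, Tendsto (fun s => X s ω) (𝓝[<] t) (𝓝 y)
  /-- the strong Markov property:
  `P_x(Λ, τ < ∞, X_{τ+s} ∈ B) = E_x[P_{X_τ}(X_s ∈ B); Λ ∩ {τ < ∞}]` for `Λ ∈ 𝓕_τ` -/
  strong_markov : ∀ (τ : Ω → WithTop ℝ≥0) (hτ : IsStoppingTime filtration τ) (L : Set Ω),
    MeasurableSet[hτ.measurableSpace] L →
    ∀ (x : OnePoint M) (s : ℝ≥0) (B : Set (OnePoint M)), MeasurableSet B →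
      P x {ω | ω ∈ L ∧ τ ω ≠ ⊤ ∧ X ((τ ω).untopD 0 + s) ω ∈ B} =
        ∫⁻ ω in {ω | ω ∈ L ∧ τ ω ≠ ⊤}, P (X ((τ ω).untopD 0) ω) {ω' | X s ω' ∈ B} ∂(P x)
  /-- quasi-left-continuity -/
  quasi_left_continuous : ∀ (τ : ℕ → Ω → WithTop ℝ≥0) (σ : Ω → WithTop ℝ≥0),
    (∀ n, IsStoppingTime filtration (τ n)) → IsStoppingTime filtration σ →
    (∀ ω, Monotone fun n => τ n ω) → (∀ ω, IsLUB (range fun n => τ n ω) (σ ω)) →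
    ∀ x : OnePoint M, ∀ᵐ ω ∂(P x), σ ω ≠ ⊤ →
      Tendsto (fun n => X ((τ n ω).untopD 0) ω) atTop (𝓝 (X ((σ ω).untopD 0) ω))

namespace HuntProcess

section

variable {M : Type*} {Ω : Type*} [MeasurableSpace Ω]

/-- The transition operator `p_t u(x) = E_x[u(X_t)]`, with the convention `u(Δ) = 0`. -/
def transition [TopologicalSpace M] (H : HuntProcess M Ω) (t : ℝ≥0) (u : M → ℝ) (x : M) : ℝ :=
  ∫ ω, (H.X t ω).elim 0 u ∂(H.P (x : OnePoint M))

/-- `H` is an `m`-symmetric Hunt process generated by the Dirichlet form `(E, F)`: its transition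
function is `m`-symmetric, `F` consists of the `u ∈ L²(M; m)` for which
`lim_{t → 0} (1/t) (u - p_t u, u)` exists and is finite, and
`E(u, v) = lim_{t → 0} (1/t) (u - p_t u, v)` for `u, v ∈ F`. -/
structure IsGeneratedBy [TopologicalSpace M] [MeasurableSpace M] {m : Measure M}
    (H : HuntProcess M Ω) (E : DirichletForm m) : Prop where
  symmetric : ∀ (t : ℝ≥0) (A B : Set M), MeasurableSet A → MeasurableSet B →
    ∫⁻ x in A, H.P (x : OnePoint M) {ω | ∃ y ∈ B, H.X t ω = (y : OnePoint M)} ∂m =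
      ∫⁻ x in B, H.P (x : OnePoint M) {ω | ∃ y ∈ A, H.X t ω = (y : OnePoint M)} ∂m
  mem_domain_iff : ∀ u : Lp ℝ 2 m, u ∈ E.domain ↔
    ∃ l : ℝ, Tendsto
      (fun t : ℝ≥0 => (t : ℝ)⁻¹ * ∫ x, (u x - H.transition t (fun y => u y) x) * u x ∂m)
      (𝓝[>] 0) (𝓝 l)
  form_eq : ∀ u v : E.domain, Tendsto
    (fun t : ℝ≥0 => (t : ℝ)⁻¹ * ∫ x, ((u : Lp ℝ 2 m) x -
      H.transition t (fun y => (u : Lp ℝ 2 m) y) x) * (v : Lp ℝ 2 m) x ∂m)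
    (𝓝[>] 0) (𝓝 (E.form u v))

/-- The Borel set `N` is properly exceptional: `m(N) = 0`, and, started outside `N`, almost surely
neither `X_t` nor the left limit `X_{t-}` is in `N` for any `t > 0`. -/
structure IsProperlyExceptional [TopologicalSpace M] [MeasurableSpace M] (H : HuntProcess M Ω)
    (m : Measure M) (N : Set M) : Prop where
  measurableSet : MeasurableSet N
  null : m N = 0
  invariant : ∀ x : M, x ∉ N → ∀ᵐ ω ∂(H.P (x : OnePoint M)), ∀ t : ℝ≥0, 0 < t → ∀ y ∈ N,
    H.X t ω ≠ (y : OnePoint M) ∧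
      ¬ Tendsto (fun s => H.X s ω) (𝓝[<] t) (𝓝 (y : OnePoint M))

/-- `p` is a heat kernel of `H` off the set `N`: a nonnegative symmetric kernel on
`(0, ∞) × (M \ N) × (M \ N)` which is the transition density of `H` with respect to `m` and
satisfies the Chapman-Kolmogorov equation. -/
structure IsHeatKernel [TopologicalSpace M] [MeasurableSpace M] (H : HuntProcess M Ω)
    (m : Measure M) (N : Set M) (p : ℝ≥0 → M → M → ℝ≥0) : Prop where
  aemeasurable : ∀ t : ℝ≥0, 0 < t → ∀ x, x ∉ N → AEMeasurable (p t x) m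
  symm : ∀ t : ℝ≥0, 0 < t → ∀ x y, x ∉ N → y ∉ N → p t x y = p t y x
  density : ∀ t : ℝ≥0, 0 < t → ∀ x, x ∉ N → ∀ A : Set M, MeasurableSet A →
    H.P (x : OnePoint M) {ω | ∃ y ∈ A, H.X t ω = (y : OnePoint M)} = ∫⁻ y in A, p t x y ∂m
  chapman_kolmogorov : ∀ t s : ℝ≥0, 0 < t → 0 < s → ∀ x y, x ∉ N → y ∉ N →
    (p (t + s) x y : ℝ≥0∞) = ∫⁻ z, (p t x z : ℝ≥0∞) * p s z y ∂m

/-- The bottom crossing probability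
`q_r(t, x) = P_x(d(X_u, x) ≤ r(u) for some u > t)` (only times `u` with `X_u ∈ M` count). -/
def crossingProb [MetricSpace M] (H : HuntProcess M Ω) (r : ℝ → ℝ) (t : ℝ≥0) (x : M) : ℝ≥0∞ :=
  H.P (x : OnePoint M)
    {ω | ∃ u : ℝ≥0, t < u ∧ ∃ y : M, H.X u ω = (y : OnePoint M) ∧ dist y x ≤ r u}

end

end HuntProcess

/-! ### Volume growth, scale functions and heat kernel estimates -/

/-- All balls have finite volume, and
`c₁ (R/r)^{d₁} ≤ V(x, R) / V(x, r) ≤ c₂ (R/r)^{d₂}` for all `x` and `0 < r < R`. -/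
def VolumeGrowth {M : Type*} [MetricSpace M] [MeasurableSpace M] (m : Measure M) : Prop :=
  (∀ (x : M) (r : ℝ), 0 < r → m (Metric.ball x r) < ∞) ∧
  ∃ c₁ c₂ d₁ d₂ : ℝ, 0 < c₁ ∧ c₁ ≤ 1 ∧ 1 ≤ c₂ ∧ 0 < d₁ ∧ d₁ ≤ d₂ ∧
    ∀ (x : M) (r R : ℝ), 0 < r → r < R →
      c₁ * (R / r) ^ d₁ ≤ m.real (Metric.ball x R) / m.real (Metric.ball x r) ∧
      m.real (Metric.ball x R) / m.real (Metric.ball x r) ≤ c₂ * (R / r) ^ d₂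

/-- `φ` is an increasing function on `[0, ∞)`, positive on `(0, ∞)`, with `φ(0) = 0` and
`c₃ (R/r)^{d₃} ≤ φ(R) / φ(r) ≤ c₄ (R/r)^{d₄}` for `0 < r < R`. -/
structure IsScaleFunction (φ : ℝ → ℝ) : Prop where
  monotoneOn : MonotoneOn φ (Ici 0)
  pos : ∀ r, 0 < r → 0 < φ r
  zero : φ 0 = 0
  growth : ∃ c₃ c₄ d₃ d₄ : ℝ, 0 < c₃ ∧ c₃ ≤ 1 ∧ 1 ≤ c₄ ∧ 0 < d₃ ∧ d₃ ≤ d₄ ∧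
    ∀ r R : ℝ, 0 < r → r < R →
      c₃ * (R / r) ^ d₃ ≤ φ R / φ r ∧ φ R / φ r ≤ c₄ * (R / r) ^ d₄

/-- The right-continuous inverse `φ⁻¹(t) = inf {s ≥ 0 | φ(s) > t}`; it is the inverse function of
`φ` whenever `φ` is an increasing bijection of `[0, ∞)`. -/
def scaleInv (φ : ℝ → ℝ) (t : ℝ) : ℝ := sInf {s : ℝ | 0 ≤ s ∧ t < φ s}

/-- `min {1 / V(x, φ⁻¹(t)), t / (V(x, d(x, y)) φ(d(x, y)))}` with values in `[0, ∞]`; on the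
diagonal the second term is `∞`. -/
def heatBound {M : Type*} [MetricSpace M] [MeasurableSpace M] (m : Measure M) (φ : ℝ → ℝ)
    (t : ℝ≥0) (x y : M) : ℝ≥0∞ :=
  min (1 / m (Metric.ball x (scaleInv φ t)))
    ((t : ℝ≥0∞) / (m (Metric.ball x (dist x y)) * ENNReal.ofReal (φ (dist x y))))

/-- The two-sided heat kernel estimate off the set `N`. -/
def HeatKernelEstimate {M : Type*} [MetricSpace M] [MeasurableSpace M] (m : Measure M) (N : Set M)
    (φ : ℝ → ℝ) (p : ℝ≥0 → M → M → ℝ≥0) : Prop :=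
  ∃ L₁ L₂ : ℝ≥0, 0 < L₁ ∧ 0 < L₂ ∧
    ∀ t : ℝ≥0, 0 < t → ∀ x y : M, x ∉ N → y ∉ N →
      L₁ * heatBound m φ t x y ≤ p t x y ∧ p t x y ≤ L₂ * heatBound m φ t x y

/-- `V(x, r) ≍ φ(r)` uniformly in `x ∈ M` and `r > 0`. -/
def CriticalVolume {M : Type*} [MetricSpace M] [MeasurableSpace M] (m : Measure M)
    (φ : ℝ → ℝ) : Prop :=
  ∃ cv₁ cv₂ : ℝ, 0 < cv₁ ∧ 0 < cv₂ ∧ ∀ (x : M) (r : ℝ), 0 < r →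
    cv₁ * φ r ≤ m.real (Metric.ball x r) ∧ m.real (Metric.ball x r) ≤ cv₂ * φ r

/-- `∫_t^∞ ds / (s |log g(s)|)` with values in `[0, ∞]` (the integrand is `∞` where
`g(s) = 1`). -/
def logTail (g : ℝ → ℝ) (t : ℝ) : ℝ≥0∞ :=
  ∫⁻ s in Ioi t, (ENNReal.ofReal (s * |Real.log (g s)|))⁻¹

/-- `R_{c,t} = sup {|log g(u)| / |log g(v)| : 1 ≤ u/v ≤ c, v ≥ t}` with values in `[0, ∞]`. -/
def logRatio (g : ℝ → ℝ) (c t : ℝ) : ℝ≥0∞ :=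
  ⨆ (u : ℝ) (v : ℝ) (_ : 1 ≤ u / v ∧ u / v ≤ c ∧ t ≤ v),
    ENNReal.ofReal |Real.log (g u)| / ENNReal.ofReal |Real.log (g v)|

/-- `lim_{c → 1+} (lim_{t → ∞} R_{c,t}) = 1`. -/
def LogRegular (g : ℝ → ℝ) : Prop :=
  ∃ R : ℝ → ℝ≥0∞, (∀ c : ℝ, 1 < c → Tendsto (fun t => logRatio g c t) atTop (𝓝 (R c))) ∧
    Tendsto R (𝓝[>] 1) (𝓝 1)

end

namespace HuntProcess

attribute [instance] HuntProcess.isMarkovKernel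

section Markov

variable {M : Type*} [TopologicalSpace M] {Ω : Type*} [MeasurableSpace Ω] (H : HuntProcess M Ω)

theorem measurable_X (t : ℝ≥0) : Measurable (H.X t) :=
  (H.adapted t).mono (H.filtration.le t) le_rfl

theorem measurable_X_filtration {s t : ℝ≥0} (h : s ≤ t) : Measurable[H.filtration t] (H.X s) :=
  (H.adapted s).mono (H.filtration.mono h) le_rfl

/-- The Markov property at a constant time. -/
theorem markov_inter (T s : ℝ≥0) {L : Set Ω} (hL : MeasurableSet[H.filtration T] L)
    (z : OnePoint M) {B : Set (OnePoint M)} (hB : MeasurableSet B) :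
    H.P z (L ∩ {ω | H.X (T + s) ω ∈ B}) =
      ∫⁻ ω in L, H.P (H.X T ω) {ω' | H.X s ω' ∈ B} ∂(H.P z) := by
  have hτ : IsStoppingTime H.filtration (fun _ : Ω => (T : WithTop ℝ≥0)) :=
    isStoppingTime_const H.filtration T
  have hL' : MeasurableSet[hτ.measurableSpace] L := by
    rwa [IsStoppingTime.measurableSpace_const]
  have h := H.strong_markov _ hτ L hL' z s B hB
  have e₁ : {ω | ω ∈ L ∧ (T : WithTop ℝ≥0) ≠ ⊤} = L :=
    ext fun ω => ⟨fun h => h.1, fun h => ⟨h, WithTop.coe_ne_top⟩⟩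
  have e₂ : {ω | ω ∈ L ∧ (T : WithTop ℝ≥0) ≠ ⊤ ∧
      H.X ((T : WithTop ℝ≥0).untopD 0 + s) ω ∈ B} = L ∩ {ω | H.X (T + s) ω ∈ B} :=
    ext fun ω => ⟨fun h => ⟨h.1, h.2.2⟩, fun h => ⟨h.1, WithTop.coe_ne_top, h.2⟩⟩
  rwa [e₁, e₂] at h

theorem map_restrict_eq_bind (T s : ℝ≥0) {L : Set Ω} (hL : MeasurableSet[H.filtration T] L)
    (z : OnePoint M) :
    ((H.P z).restrict L).map (H.X (T + s)) =
      (((H.P z).restrict L).map (H.X T)).bind (H.P.map (H.X s)) := by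
  ext B hB
  rw [Measure.map_apply (H.measurable_X _) hB,
    Measure.restrict_apply (H.measurable_X _ hB), Measure.bind_apply hB (Kernel.aemeasurable _),
    lintegral_map (Kernel.measurable_coe _ hB) (H.measurable_X T), inter_comm]
  refine (H.markov_inter T s hL z hB).trans (lintegral_congr fun ω => ?_)
  rw [Kernel.map_apply' _ (H.measurable_X s) _ hB]
  rfl

theorem markov_lintegral (T s : ℝ≥0) {L : Set Ω} (hL : MeasurableSet[H.filtration T] L)
    (z : OnePoint M) {f : OnePoint M → ℝ≥0∞} (hf : Measurable f) :
    ∫⁻ ω in L, f (H.X (T + s) ω) ∂(H.P z) =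
      ∫⁻ ω in L, ∫⁻ ω', f (H.X s ω') ∂(H.P (H.X T ω)) ∂(H.P z) := by
  have h := congrArg (fun μ => ∫⁻ y, f y ∂μ) (H.map_restrict_eq_bind T s hL z)
  rw [lintegral_map hf (H.measurable_X _), Measure.lintegral_bind (Kernel.aemeasurable _)
    hf.aemeasurable, lintegral_map hf.lintegral_kernel (H.measurable_X T)] at h
  rw [h]
  refine lintegral_congr fun ω => ?_
  rw [Kernel.map_apply _ (H.measurable_X s), lintegral_map hf (H.measurable_X s)]

/-- The Markov property for finite-dimensional events of the future. -/
theorem markov_box (B : ℝ≥0 → Set (OnePoint M)) (hB : ∀ t, MeasurableSet (B t))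
    (I : Finset ℝ≥0) : ∀ c : ℝ≥0, (∀ i ∈ I, c ≤ i) → ∀ (T : ℝ≥0) (L : Set Ω),
      MeasurableSet[H.filtration T] L → ∀ z : OnePoint M,
      H.P z (L ∩ {ω | ∀ i ∈ I, H.X (T + (i - c)) ω ∈ B i}) =
        ∫⁻ ω in L, H.P (H.X T ω) {ω' | ∀ i ∈ I, H.X (i - c) ω' ∈ B i} ∂(H.P z) := by
  classical
  induction I using Finset.induction_on_min with
  | empty => intro c _ T L hL z; simp
  | insert a I ha ih =>
    intro c hc T L hL z
    have hca : c ≤ a := hc a (Finset.mem_insert_self _ _)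
    have hsub : ∀ i ∈ I, i - c = (a - c) + (i - a) := fun i hi => by
      rw [add_comm]; exact (tsub_add_tsub_cancel (ha i hi).le hca).symm
    set h : OnePoint M → ℝ≥0∞ := fun w => H.P w {ω' | ∀ i ∈ I, H.X (i - a) ω' ∈ B i} with hh
    have hmeas : Measurable h := by
      refine Kernel.measurable_coe _ ?_
      have : {ω' | ∀ i ∈ I, H.X (i - a) ω' ∈ B i} = ⋂ i ∈ I, H.X (i - a) ⁻¹' B i := by
        ext; simp
      rw [this]
      exact Finset.measurableSet_biInter _ fun i _ => H.measurable_X _ (hB i)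
    have key : ∀ (T : ℝ≥0) (L : Set Ω), MeasurableSet[H.filtration T] L → ∀ z : OnePoint M,
        H.P z (L ∩ {ω | ∀ i ∈ insert a I, H.X (T + (i - c)) ω ∈ B i}) =
          ∫⁻ ω in L, (B a).indicator h (H.X (T + (a - c)) ω) ∂(H.P z) := by
      intro T L hL z
      have hL' : MeasurableSet[H.filtration (T + (a - c))] (L ∩ H.X (T + (a - c)) ⁻¹' B a) :=
        (H.filtration.mono (by simp) _ hL).inter (H.measurable_X_filtration le_rfl (hB a))
      have e : L ∩ {ω | ∀ i ∈ insert a I, H.X (T + (i - c)) ω ∈ B i} =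
          (L ∩ H.X (T + (a - c)) ⁻¹' B a) ∩
            {ω | ∀ i ∈ I, H.X (T + (a - c) + (i - a)) ω ∈ B i} := by
        ext ω
        simp only [Finset.forall_mem_insert, mem_inter_iff, mem_ofPred_eq, mem_preimage, and_assoc]
        refine and_congr_right fun _ => and_congr_right fun _ => forall₂_congr fun i hi => ?_
        rw [hsub i hi, add_assoc]
      rw [e, ih a (fun i hi => (ha i hi).le) _ _ hL' z, inter_comm,
        ← Measure.restrict_restrict (H.measurable_X _ (hB a)),
        ← lintegral_indicator (H.measurable_X _ (hB a))]
      rfl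
    rw [key T L hL z, H.markov_lintegral T (a - c) hL z (hmeas.indicator (hB a))]
    refine lintegral_congr fun ω => ?_
    have h0 := key 0 univ MeasurableSet.univ (H.X T ω)
    simp only [zero_add, univ_inter, Measure.restrict_univ] at h0
    exact h0.symm

/-- The path of the process. -/
def path (ω : Ω) (s : ℝ≥0) : OnePoint M := H.X s ω

theorem measurable_path : Measurable H.path :=
  measurable_pi_lambda _ fun s => H.measurable_X s

theorem measurable_shifted_path (T : ℝ≥0) : Measurable fun (ω : Ω) (s : ℝ≥0) => H.X (T + s) ω :=
  measurable_pi_lambda _ fun s => H.measurable_X (T + s)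

theorem map_shifted_path (T : ℝ≥0) (z : OnePoint M) :
    (H.P z).map (fun (ω : Ω) (s : ℝ≥0) => H.X (T + s) ω) =
      ((H.P z).map (H.X T)).bind (H.P.map H.path) := by
  have := Measure.isProbabilityMeasure_map (μ := H.P z) (H.measurable_X T).aemeasurable
  have := Measure.isProbabilityMeasure_map (μ := H.P z)
    (H.measurable_shifted_path T).aemeasurable
  refine ext_of_generate_finite _ generateFrom_squareCylinders.symm
    (isPiSystem_squareCylinders (fun _ => MeasurableSpace.isPiSystem_measurableSet)
      (fun _ => MeasurableSet.univ (α := OnePoint M))) ?_ ?_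
  · rintro S ⟨I, B, hB, rfl⟩
    have hB' : ∀ i, MeasurableSet (B i) := fun i => hB i (mem_univ i)
    have hS : MeasurableSet ((I : Set ℝ≥0).pi B) :=
      MeasurableSet.pi I.countable_toSet fun i _ => hB' i
    rw [Measure.map_apply (H.measurable_shifted_path T) hS,
      Measure.bind_apply hS (Kernel.aemeasurable _),
      lintegral_map (Kernel.measurable_coe _ hS) (H.measurable_X T)]
    have := H.markov_box B hB' I 0 (fun _ _ => zero_le) T univ MeasurableSet.univ z
    simp only [tsub_zero, univ_inter, Measure.restrict_univ] at this
    refine Eq.trans ?_ (this.trans (lintegral_congr fun ω => ?_))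
    · rfl
    · rw [Kernel.map_apply' _ H.measurable_path _ hS]
      rfl
  · rw [Measure.map_apply (H.measurable_shifted_path T) MeasurableSet.univ,
      Measure.bind_apply MeasurableSet.univ (Kernel.aemeasurable _),
      lintegral_map (Kernel.measurable_coe _ MeasurableSet.univ) (H.measurable_X T)]
    simp [Kernel.map_apply' _ H.measurable_path _ MeasurableSet.univ]

/-- The Markov property for functionals of the path. -/
theorem markov_path (T : ℝ≥0) (z : OnePoint M) {F : (ℝ≥0 → OnePoint M) → ℝ≥0∞}
    (hF : Measurable F) :
    ∫⁻ ω, F (fun s => H.X (T + s) ω) ∂(H.P z) =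
      ∫⁻ ω, ∫⁻ ω', F (H.path ω') ∂(H.P (H.X T ω)) ∂(H.P z) := by
  have h := congrArg (fun μ => ∫⁻ y, F y ∂μ) (H.map_shifted_path T z)
  rw [lintegral_map hF (H.measurable_shifted_path T), Measure.lintegral_bind
    (Kernel.aemeasurable _) hF.aemeasurable,
    lintegral_map hF.lintegral_kernel (H.measurable_X T)] at h
  rw [h]
  refine lintegral_congr fun ω => ?_
  rw [Kernel.map_apply _ H.measurable_path, lintegral_map hF H.measurable_path]

end Markov

end HuntProcess

namespace HuntProcess

section Hitting

variable {M : Type*} [TopologicalSpace M] {Ω : Type*} [MeasurableSpace Ω] (H : HuntProcess M Ω)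

/-- The event that the process is in `D` at time `s`. -/
def inSet (s : ℝ≥0) (D : Set M) : Set Ω := {ω | ∃ y ∈ D, H.X s ω = (y : OnePoint M)}

theorem inSet_eq_preimage (s : ℝ≥0) (D : Set M) :
    H.inSet s D = H.X s ⁻¹' ((fun y : M => (y : OnePoint M)) '' D) := by
  ext ω
  exact ⟨fun ⟨y, hy, h⟩ => ⟨y, hy, h.symm⟩, fun ⟨y, hy, h⟩ => ⟨y, hy, h.symm⟩⟩

theorem inSet_mono (s : ℝ≥0) {D D' : Set M} (h : D ⊆ D') : H.inSet s D ⊆ H.inSet s D' :=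
  fun _ ⟨y, hy, e⟩ => ⟨y, h hy, e⟩

/-- The event that the first visit to `U` among the times in `F` is at time `t`. -/
def firstHit (F : Finset ℝ≥0) (U : Set M) (t : ℝ≥0) : Set Ω :=
  H.inSet t U ∩ {ω | ∀ r ∈ F, r < t → ω ∉ H.inSet r U}

/-- The event that `U` is visited at a time in `F`. -/
def hitOn (F : Set ℝ≥0) (U : Set M) : Set Ω := ⋃ t ∈ F, H.inSet t U

theorem mem_hitOn {F : Set ℝ≥0} {U : Set M} {ω : Ω} :
    ω ∈ H.hitOn F U ↔ ∃ t ∈ F, ω ∈ H.inSet t U := by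
  simp [hitOn]

theorem hitOn_mono {F F' : Set ℝ≥0} (h : F ⊆ F') (U : Set M) : H.hitOn F U ⊆ H.hitOn F' U :=
  biUnion_subset_biUnion_left h

theorem hitOn_eq_iUnion_firstHit (F : Finset ℝ≥0) (U : Set M) :
    H.hitOn F U = ⋃ t ∈ F, H.firstHit F U t := by
  classical
  ext ω
  simp only [mem_hitOn, mem_iUnion, exists_prop, Finset.mem_coe]
  refine ⟨fun ⟨t, ht, h⟩ => ?_, fun ⟨t, ht, h⟩ => ⟨t, ht, h.1⟩⟩
  have hne : (F.filter fun t => ω ∈ H.inSet t U).Nonempty :=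
    ⟨t, Finset.mem_filter.2 ⟨ht, h⟩⟩
  have hmin := Finset.min'_mem _ hne
  rw [Finset.mem_filter] at hmin
  refine ⟨_, hmin.1, hmin.2, fun r hr hlt hU => ?_⟩
  exact absurd (Finset.min'_le _ r (Finset.mem_filter.2 ⟨hr, hU⟩)) (not_le.2 hlt)

theorem pairwiseDisjoint_firstHit (F : Finset ℝ≥0) (U : Set M) :
    (F : Set ℝ≥0).PairwiseDisjoint (H.firstHit F U) := by
  intro s hs t ht hst
  refine Set.disjoint_left.2 fun ω h₁ h₂ => ?_
  rcases lt_or_gt_of_ne hst with h | h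
  · exact h₂.2 s hs h h₁.1
  · exact h₁.2 t ht h h₂.1

theorem measure_infty_inSet (s : ℝ≥0) (D : Set M) :
    H.P OnePoint.infty (H.inSet s D) = 0 := by
  refine measure_mono_null (t := {ω | ¬ H.X 0 ω = OnePoint.infty}) (fun ω ⟨y, _, h⟩ h0 => ?_)
    (H.start OnePoint.infty)
  exact OnePoint.coe_ne_infty y (h.symm.trans (H.absorbing ω 0 s zero_le h0))

/-- Started from `x`, the process does not visit `N` at any fixed time. -/
def Avoids (N : Set M) (x : OnePoint M) : Prop :=
  ∀ t : ℝ≥0, ∀ᵐ ω ∂(H.P x), ∀ y ∈ N, H.X t ω ≠ (y : OnePoint M)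

theorem IsProperlyExceptional.avoids [MeasurableSpace M] {m : Measure M} {N : Set M}
    (hN : H.IsProperlyExceptional m N) {x : M} (hx : x ∉ N) : H.Avoids N x := by
  intro t
  rcases eq_zero_or_pos t with rfl | ht
  · filter_upwards [H.start x] with ω hω y hy h
    exact hx (OnePoint.coe_injective (hω.symm.trans h) ▸ hy)
  · filter_upwards [hN.invariant x hx] with ω hω y hy
    exact (hω t ht y hy).1

variable [MeasurableSpace M] [BorelSpace M]

theorem measurableEmbedding_coe : MeasurableEmbedding (fun y : M => (y : OnePoint M)) :=
  OnePoint.isOpenEmbedding_coe.measurableEmbedding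

theorem measurableSet_filtration_inSet {s t : ℝ≥0} (h : s ≤ t) {D : Set M}
    (hD : MeasurableSet D) : MeasurableSet[H.filtration t] (H.inSet s D) := by
  rw [inSet_eq_preimage]
  exact H.measurable_X_filtration h (measurableEmbedding_coe.measurableSet_image.2 hD)

theorem measurableSet_inSet (s : ℝ≥0) {D : Set M} (hD : MeasurableSet D) :
    MeasurableSet (H.inSet s D) :=
  H.filtration.le s _ (H.measurableSet_filtration_inSet le_rfl hD)

theorem measurableSet_filtration_firstHit (F : Finset ℝ≥0) {U : Set M} (hU : MeasurableSet U)
    (t : ℝ≥0) : MeasurableSet[H.filtration t] (H.firstHit F U t) := by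
  refine (H.measurableSet_filtration_inSet le_rfl hU).inter ?_
  have : {ω | ∀ r ∈ F, r < t → ω ∉ H.inSet r U} = ⋂ r ∈ F, ⋂ (_ : r < t), (H.inSet r U)ᶜ := by
    ext; simp
  rw [this]
  exact Finset.measurableSet_biInter _ fun r _ => MeasurableSet.iInter fun h =>
    (H.measurableSet_filtration_inSet h.le hU).compl

theorem measurableSet_hitOn {F : Set ℝ≥0} (hF : F.Countable) {U : Set M} (hU : MeasurableSet U) :
    MeasurableSet (H.hitOn F U) :=
  MeasurableSet.biUnion hF fun t _ => H.measurableSet_inSet t hU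

theorem measurableSet_filtration_hitOn {F : Set ℝ≥0} (hF : F.Countable) {U : Set M}
    (hU : MeasurableSet U) {T : ℝ≥0} (hT : ∀ t ∈ F, t ≤ T) :
    MeasurableSet[H.filtration T] (H.hitOn F U) :=
  MeasurableSet.biUnion hF fun t ht => H.measurableSet_filtration_inSet (hT t ht) hU

theorem markov_inSet (T s : ℝ≥0) {L : Set Ω} (hL : MeasurableSet[H.filtration T] L)
    (z : OnePoint M) {D : Set M} (hD : MeasurableSet D) :
    H.P z (L ∩ H.inSet (T + s) D) =
      ∫⁻ ω in L, H.P (H.X T ω) (H.inSet s D) ∂(H.P z) := by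
  rw [inSet_eq_preimage, inSet_eq_preimage]
  exact H.markov_inter T s hL z (measurableEmbedding_coe.measurableSet_image.2 hD)

theorem le_measure_inter_inSet (T s : ℝ≥0) {L : Set Ω} (hL : MeasurableSet[H.filtration T] L)
    {N : Set M} {x : OnePoint M} (hx : H.Avoids N x) {U D : Set M} (hD : MeasurableSet D)
    (hLU : L ⊆ H.inSet T U) {β : ℝ≥0∞}
    (hβ : ∀ z ∈ U, z ∉ N → β ≤ H.P (z : OnePoint M) (H.inSet s D)) :
    H.P x L * β ≤ H.P x (L ∩ H.inSet (T + s) D) := by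
  rw [H.markov_inSet T s hL x hD, mul_comm, ← setLIntegral_const]
  refine lintegral_mono_ae ?_
  filter_upwards [ae_restrict_mem (H.filtration.le T _ hL), ae_restrict_of_ae (hx T)] with ω h₁ h₂
  obtain ⟨y, hy, e⟩ := hLU h₁
  rw [e]
  exact hβ y hy fun hyN => h₂ y hyN e

theorem measure_inter_inSet_le (T s : ℝ≥0) {L : Set Ω} (hL : MeasurableSet[H.filtration T] L)
    {N : Set M} {x : OnePoint M} (hx : H.Avoids N x) {D : Set M} (hD : MeasurableSet D)
    {γ : ℝ≥0∞} (hγ : ∀ z, z ∉ N → H.P ((z : M) : OnePoint M) (H.inSet s D) ≤ γ) :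
    H.P x (L ∩ H.inSet (T + s) D) ≤ H.P x L * γ := by
  rw [H.markov_inSet T s hL x hD, mul_comm, ← setLIntegral_const]
  refine lintegral_mono_ae ?_
  filter_upwards [ae_restrict_of_ae (hx T)] with ω h₂
  induction h : H.X T ω using OnePoint.rec with
  | infty => simp [measure_infty_inSet]
  | coe y => exact hγ y fun hyN => h₂ y hyN h

theorem measure_inter_hitOn (x : OnePoint M) {L : Set Ω} (hL : MeasurableSet L)
    (F : Finset ℝ≥0) {U : Set M} (hU : MeasurableSet U) :
    H.P x (L ∩ H.hitOn F U) = ∑ t ∈ F, H.P x (L ∩ H.firstHit F U t) := by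
  rw [hitOn_eq_iUnion_firstHit, inter_iUnion₂, measure_biUnion_finset]
  · exact (H.pairwiseDisjoint_firstHit F U).mono fun t => inter_subset_right
  · exact fun t _ => hL.inter (H.filtration.le t _ (H.measurableSet_filtration_firstHit F hU t))

/-- First-visit decomposition, lower bound for the probability of being in `D` at time `s`. -/
theorem sum_firstHit_mul_le {T : ℝ≥0} {L : Set Ω} (hL : MeasurableSet[H.filtration T] L)
    {N : Set M} {x : OnePoint M} (hx : H.Avoids N x) {U D : Set M} (hU : MeasurableSet U)
    (hD : MeasurableSet D) (F : Finset ℝ≥0) (hF : ∀ t ∈ F, T ≤ t) (β : ℝ → ℝ≥0∞)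
    (hβ0 : ∀ v < 0, β v = 0)
    (hβ : ∀ v : ℝ≥0, ∀ z ∈ U, z ∉ N → β v ≤ H.P (z : OnePoint M) (H.inSet v D)) (s : ℝ≥0) :
    ∑ t ∈ F, H.P x (L ∩ H.firstHit F U t) * β (s - t) ≤ H.P x (L ∩ H.inSet s D) := by
  have hm : ∀ t ∈ F, MeasurableSet[H.filtration t] (L ∩ H.firstHit F U t) := fun t ht =>
    (H.filtration.mono (hF t ht) _ hL).inter (H.measurableSet_filtration_firstHit F hU t)
  calc ∑ t ∈ F, H.P x (L ∩ H.firstHit F U t) * β (s - t)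
      ≤ ∑ t ∈ F, H.P x ((L ∩ H.firstHit F U t) ∩ H.inSet s D) := by
        refine Finset.sum_le_sum fun t ht => ?_
        rcases lt_or_ge s t with h | h
        · rw [hβ0 _ (by simpa using h)]; simp
        · have := H.le_measure_inter_inSet t (s - t) (hm t ht) hx hD
            (fun ω hω => hω.2.1) (hβ (s - t))
          rwa [add_tsub_cancel_of_le h, NNReal.coe_sub h] at this
    _ = H.P x (⋃ t ∈ F, (L ∩ H.firstHit F U t) ∩ H.inSet s D) := by
        refine (measure_biUnion_finset ?_ ?_).symm
        · exact (H.pairwiseDisjoint_firstHit F U).mono fun t ω hω => hω.1.2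
        · exact fun t ht => (H.filtration.le t _ (hm t ht)).inter (H.measurableSet_inSet s hD)
    _ ≤ H.P x (L ∩ H.inSet s D) := by
        refine measure_mono (iUnion₂_subset fun t _ ω hω => ⟨hω.1.1, hω.2⟩)

/-- First-visit decomposition, upper bound for the expected number of visits. -/
theorem sum_measure_inSet_le {N : Set M} {x : OnePoint M} (hx : H.Avoids N x) {U : Set M}
    (hU : MeasurableSet U) (F : Finset ℝ≥0) (γ : ℝ≥0 → ℝ≥0∞)
    (hγ : ∀ v : ℝ≥0, ∀ z : M, z ∉ N → H.P (z : OnePoint M) (H.inSet v U) ≤ γ v) (Γ : ℝ≥0∞)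
    (hΓ : ∀ t ∈ F, ∑ s ∈ F with t ≤ s, γ (s - t) ≤ Γ) :
    ∑ s ∈ F, H.P x (H.inSet s U) ≤ H.P x (H.hitOn F U) * Γ := by
  have hs : ∀ s ∈ F, H.P x (H.inSet s U) ≤
      ∑ t ∈ F with t ≤ s, H.P x (H.firstHit F U t) * γ (s - t) := by
    intro s hs
    have hsub : H.inSet s U ⊆ ⋃ t ∈ F.filter (· ≤ s), H.firstHit F U t ∩ H.inSet s U := by
      intro ω hω
      have h₁ : ω ∈ H.hitOn F U := H.mem_hitOn.2 ⟨s, hs, hω⟩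
      rw [hitOn_eq_iUnion_firstHit] at h₁
      obtain ⟨t, ht, h⟩ := mem_iUnion₂.1 h₁
      have hts : t ≤ s := not_lt.1 fun hlt => h.2 s hs hlt hω
      exact mem_iUnion₂.2 ⟨t, Finset.mem_filter.2 ⟨ht, hts⟩, h, hω⟩
    refine (measure_mono hsub).trans ((measure_biUnion_finset_le _ _).trans
      (Finset.sum_le_sum fun t ht => ?_))
    have hts : t ≤ s := (Finset.mem_filter.1 ht).2
    have := H.measure_inter_inSet_le t (s - t) (H.measurableSet_filtration_firstHit F hU t) hx hU
      (hγ (s - t))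
    rwa [add_tsub_cancel_of_le hts] at this
  have hm := H.measure_inter_hitOn x MeasurableSet.univ F hU
  simp only [univ_inter] at hm
  calc ∑ s ∈ F, H.P x (H.inSet s U)
      ≤ ∑ s ∈ F, ∑ t ∈ F with t ≤ s, H.P x (H.firstHit F U t) * γ (s - t) :=
        Finset.sum_le_sum hs
    _ = ∑ t ∈ F, ∑ s ∈ F with t ≤ s, H.P x (H.firstHit F U t) * γ (s - t) := by
        simp_rw [Finset.sum_filter]
        exact Finset.sum_comm
    _ ≤ ∑ t ∈ F, H.P x (H.firstHit F U t) * Γ := by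
        refine Finset.sum_le_sum fun t ht => ?_
        rw [← Finset.mul_sum]
        gcongr
        exact hΓ t ht
    _ = H.P x (H.hitOn F U) * Γ := by rw [← Finset.sum_mul, hm]

end Hitting

end HuntProcess

namespace IsScaleFunction

variable {φ : ℝ → ℝ}

theorem mono (hφ : IsScaleFunction φ) {r s : ℝ} (hr : 0 ≤ r) (h : r ≤ s) : φ r ≤ φ s :=
  hφ.monotoneOn hr (hr.trans h) h

theorem exists_doubling (hφ : IsScaleFunction φ) :
    ∃ C : ℝ, 1 ≤ C ∧ ∀ r, 0 < r → φ (2 * r) ≤ C * φ r := by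
  obtain ⟨c₃, c₄, d₃, d₄, h3, h3', h4, hd3, hd34, h⟩ := hφ.growth
  refine ⟨c₄ * 2 ^ d₄, ?_, fun r hr => ?_⟩
  · exact one_le_mul_of_one_le_of_one_le h4 (Real.one_le_rpow one_le_two (hd3.le.trans hd34))
  · have := (h r (2 * r) hr (by linarith)).2
    rwa [mul_div_cancel_right₀ _ hr.ne', div_le_iff₀ (hφ.pos r hr)] at this

theorem exists_contraction (hφ : IsScaleFunction φ) :
    ∃ c₃ c₄ d₃ d₄ : ℝ, 0 < c₃ ∧ 0 < c₄ ∧ 0 < d₃ ∧ 0 < d₄ ∧ ∀ r l : ℝ, 0 < r → 0 < l → l < 1 →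
      φ (r * l) ≤ c₃ * l ^ d₃ * φ r ∧ c₄ * l ^ d₄ * φ r ≤ φ (r * l) := by
  obtain ⟨c₃, c₄, d₃, d₄, h3, h3', h4, hd3, hd34, h⟩ := hφ.growth
  have h4p : 0 < c₄ := by linarith
  refine ⟨c₃⁻¹, c₄⁻¹, d₃, d₄, inv_pos.2 h3, inv_pos.2 h4p, hd3, hd3.trans_le hd34,
    fun r l hr hl hl1 => ?_⟩
  have hrl : 0 < r * l := mul_pos hr hl
  obtain ⟨h₁, h₂⟩ := h (r * l) r hrl (by nlinarith)
  have e : r / (r * l) = l⁻¹ := by field_simp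
  have hp := hφ.pos _ hrl
  rw [e, Real.inv_rpow hl.le, le_div_iff₀ hp] at h₁
  rw [e, Real.inv_rpow hl.le, div_le_iff₀ hp] at h₂
  have l3 : 0 < l ^ d₃ := Real.rpow_pos_of_pos hl _
  have l4 : 0 < l ^ d₄ := Real.rpow_pos_of_pos hl _
  constructor
  · have : c₃⁻¹ * l ^ d₃ * (c₃ * (l ^ d₃)⁻¹ * φ (r * l)) = φ (r * l) := by field_simp
    rw [← this]; gcongr
  · have : c₄⁻¹ * l ^ d₄ * (c₄ * (l ^ d₄)⁻¹ * φ (r * l)) = φ (r * l) := by field_simp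
    rw [← this]; gcongr

theorem exists_lt (hφ : IsScaleFunction φ) (t : ℝ) : ∃ s, 0 < s ∧ t < φ s := by
  obtain ⟨c₃, c₄, d₃, d₄, h3, h4, hd3, hd4, h⟩ := hφ.exists_contraction
  have h1 := hφ.pos 1 one_pos
  have ht : Tendsto (fun s : ℝ => s ^ d₃ * (c₃⁻¹ * φ 1)) atTop atTop :=
    (tendsto_rpow_atTop hd3).atTop_mul_const (by positivity)
  obtain ⟨s, hs, hs1⟩ := ((ht.eventually_gt_atTop t).and (eventually_gt_atTop 1)).exists
  have hs0 : 0 < s := by linarith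
  refine ⟨s, hs0, hs.trans_le ?_⟩
  have := (h s s⁻¹ hs0 (inv_pos.2 hs0) (inv_lt_one_of_one_lt₀ hs1)).1
  rw [mul_inv_cancel₀ hs0.ne', Real.inv_rpow hs0.le] at this
  have hp : 0 < s ^ d₃ := Real.rpow_pos_of_pos hs0 _
  calc s ^ d₃ * (c₃⁻¹ * φ 1) ≤ s ^ d₃ * (c₃⁻¹ * (c₃ * (s ^ d₃)⁻¹ * φ s)) := by gcongr
    _ = φ s := by field_simp

theorem exists_le (hφ : IsScaleFunction φ) {t : ℝ} (ht : 0 < t) : ∃ s, 0 < s ∧ φ s ≤ t := by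
  obtain ⟨c₃, c₄, d₃, d₄, h3, h4, hd3, hd4, h⟩ := hφ.exists_contraction
  have hlim : Tendsto (fun s : ℝ => c₃ * s ^ d₃ * φ 1) (𝓝[>] 0) (𝓝 0) := by
    have : Tendsto (fun s : ℝ => s ^ d₃) (𝓝[>] 0) (𝓝 0) := by
      have := (Real.continuousAt_rpow_const 0 d₃ (Or.inr hd3.le)).tendsto
      rw [Real.zero_rpow hd3.ne'] at this
      exact this.mono_left nhdsWithin_le_nhds
    simpa using (this.const_mul c₃).mul_const (φ 1)
  obtain ⟨s, ⟨hs, hs1⟩, hs0⟩ := (((hlim.eventually_lt_const ht).and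
    (mem_nhdsWithin_of_mem_nhds (Iio_mem_nhds one_pos))).and self_mem_nhdsWithin).exists
  refine ⟨s, hs0, ?_⟩
  have := (h 1 s one_pos hs0 hs1).1
  rw [one_mul] at this
  exact this.trans hs.le

theorem scaleInv_pos (hφ : IsScaleFunction φ) {t : ℝ} (ht : 0 < t) : 0 < scaleInv φ t := by
  obtain ⟨s, hs, hst⟩ := hφ.exists_le ht
  obtain ⟨s', hs', hst'⟩ := hφ.exists_lt t
  refine hs.trans_le (le_csInf ⟨s', hs'.le, hst'⟩ fun r hr => ?_)
  by_contra! h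
  exact absurd (hφ.mono hr.1 h.le) (not_le.2 (hst.trans_lt hr.2))

theorem le_of_lt_scaleInv {t r : ℝ} (hr : 0 ≤ r) (h : r < scaleInv φ t) : φ r ≤ t := by
  by_contra! h'
  have hmem : r ∈ {s : ℝ | 0 ≤ s ∧ t < φ s} := ⟨hr, h'⟩
  exact absurd (csInf_le ⟨0, fun s hs => hs.1⟩ hmem) (not_le.2 h)

theorem lt_of_scaleInv_lt (hφ : IsScaleFunction φ) {t r : ℝ} (h : scaleInv φ t < r) : t < φ r := by
  obtain ⟨s', hs', hst'⟩ := hφ.exists_lt t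
  have hne : {s : ℝ | 0 ≤ s ∧ t < φ s}.Nonempty := ⟨s', hs'.le, hst'⟩
  obtain ⟨s, hs, hsr⟩ := exists_lt_of_csInf_lt hne h
  exact hs.2.trans_le (hφ.mono hs.1 hsr.le)

theorem scaleInv_mono (hφ : IsScaleFunction φ) {s t : ℝ} (h : s ≤ t) :
    scaleInv φ s ≤ scaleInv φ t := by
  obtain ⟨s', hs', hst'⟩ := hφ.exists_lt t
  exact csInf_le_csInf ⟨0, fun s hs => hs.1⟩ ⟨s', hs'.le, hst'⟩ fun r hr => ⟨hr.1, h.trans_lt hr.2⟩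

/-- `φ (φ⁻¹ (t)) ≍ t`. -/
theorem exists_apply_scaleInv (hφ : IsScaleFunction φ) :
    ∃ C : ℝ, 1 ≤ C ∧ (∀ r, 0 < r → φ (2 * r) ≤ C * φ r) ∧
      ∀ t, 0 < t → φ (scaleInv φ t) ≤ C * t ∧ t ≤ C * φ (scaleInv φ t) := by
  obtain ⟨C, hC, h⟩ := hφ.exists_doubling
  refine ⟨C, hC, h, fun t ht => ?_⟩
  have hρ := hφ.scaleInv_pos ht
  constructor
  · have h₁ := h (scaleInv φ t / 2) (by positivity)
    rw [mul_div_cancel₀ _ two_ne_zero] at h₁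
    refine h₁.trans ?_
    gcongr
    exact le_of_lt_scaleInv (by positivity) (by linarith)
  · exact (hφ.lt_of_scaleInv_lt (r := 2 * scaleInv φ t) (by linarith)).le.trans (h _ hρ)

end IsScaleFunction

namespace HuntProcess

section HeatKernel

variable {M : Type*} [MetricSpace M] [MeasurableSpace M] [BorelSpace M] {Ω : Type*}
  [MeasurableSpace Ω]

/-- `P_z(X_s ∈ B(w, R)) ≤ C φ(R) / s` for all `z, w`, and `P_z(X_s ∈ B(w, R)) ≥ c φ(R) / s` for
`z ∈ B(w, R)`, `s ≥ φ(R)`. -/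
structure BallEstimate (H : HuntProcess M Ω) (N : Set M) (φ : ℝ → ℝ) (c C : ℝ) : Prop where
  c_pos : 0 < c
  C_pos : 0 < C
  upper : ∀ z : M, z ∉ N → ∀ s : ℝ≥0, 0 < s → ∀ (w : M) (R : ℝ), 0 < R →
    H.P (z : OnePoint M) (H.inSet s (Metric.ball w R)) ≤ ENNReal.ofReal (C * φ R / s)
  lower : ∀ z : M, z ∉ N → ∀ s : ℝ≥0, 0 < s → ∀ (w : M) (R : ℝ), 0 < R → dist z w < R → φ R ≤ s →
    ENNReal.ofReal (c * φ R / s) ≤ H.P (z : OnePoint M) (H.inSet s (Metric.ball w R))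

theorem exists_ballEstimate (H : HuntProcess M Ω) {m : Measure M} (hV : VolumeGrowth m)
    {N : Set M} (hN : m N = 0)
    {p : ℝ≥0 → M → M → ℝ≥0} (hp : H.IsHeatKernel m N p) {φ : ℝ → ℝ} (hφ : IsScaleFunction φ)
    (hest : HeatKernelEstimate m N φ p) (hcrit : CriticalVolume m φ) :
    ∃ c C : ℝ, H.BallEstimate N φ c C := by
  obtain ⟨D, hD, hdoub, hinv⟩ := hφ.exists_apply_scaleInv
  obtain ⟨L₁, L₂, hL₁, hL₂, hL⟩ := hest
  obtain ⟨v₁, v₂, hv₁, hv₂, hv⟩ := hcrit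
  have hD0 : 0 < D := by linarith
  have hballeq : ∀ (x : M) (r : ℝ), 0 < r →
      m (Metric.ball x r) = ENNReal.ofReal (m.real (Metric.ball x r)) := fun x r hr =>
    (ofReal_measureReal (hV.1 x r hr).ne).symm
  have hvl : ∀ (x : M) (r : ℝ), 0 < r → ENNReal.ofReal (v₁ * φ r) ≤ m (Metric.ball x r) :=
    fun x r hr => by rw [hballeq x r hr]; exact ENNReal.ofReal_le_ofReal (hv x r hr).1
  have hvu : ∀ (x : M) (r : ℝ), 0 < r → m (Metric.ball x r) ≤ ENNReal.ofReal (v₂ * φ r) :=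
    fun x r hr => by rw [hballeq x r hr]; exact ENNReal.ofReal_le_ofReal (hv x r hr).2
  have hNae : ∀ᵐ y ∂m, y ∉ N := measure_eq_zero_iff_ae_notMem.1 hN
  refine ⟨L₁ / (v₂ * D ^ 2) * v₁, L₂ * D / v₁ * v₂, by positivity, by positivity, ?_, ?_⟩
  · intro z hz s hs w R hR
    have hs' : (0 : ℝ) < s := hs
    rw [inSet, hp.density s hs z hz _ Metric.isOpen_ball.measurableSet]
    have hbound : ∀ᵐ y ∂(m.restrict (Metric.ball w R)),
        (p s z y : ℝ≥0∞) ≤ ENNReal.ofReal (L₂ * D / (v₁ * s)) := by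
      filter_upwards [ae_restrict_of_ae hNae] with y hy
      refine (hL s hs z y hz hy).2.trans ?_
      have hρ := hφ.scaleInv_pos hs'
      calc (L₂ : ℝ≥0∞) * heatBound m φ s z y
          ≤ L₂ * (1 / m (Metric.ball z (scaleInv φ s))) := by
            gcongr; exact min_le_left _ _
        _ ≤ L₂ * (1 / ENNReal.ofReal (v₁ * (s / D))) := by
            gcongr
            refine le_trans (ENNReal.ofReal_le_ofReal ?_) (hvl z _ hρ)
            gcongr
            rw [div_le_iff₀ hD0, mul_comm]
            exact (hinv s hs').2
        _ = ENNReal.ofReal (L₂ * D / (v₁ * s)) := by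
            rw [← ENNReal.ofReal_one, ← ENNReal.ofReal_div_of_pos (by positivity),
              ← ENNReal.ofReal_coe_nnreal, ← ENNReal.ofReal_mul (by positivity)]
            congr 1; field_simp
    calc ∫⁻ y in Metric.ball w R, p s z y ∂m
        ≤ ∫⁻ _ in Metric.ball w R, ENNReal.ofReal (L₂ * D / (v₁ * s)) ∂m := lintegral_mono_ae hbound
      _ ≤ ENNReal.ofReal (L₂ * D / (v₁ * s)) * ENNReal.ofReal (v₂ * φ R) := by
          rw [setLIntegral_const]; gcongr; exact hvu w R hR
      _ = ENNReal.ofReal (L₂ * D / v₁ * v₂ * φ R / s) := by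
          rw [← ENNReal.ofReal_mul (by positivity)]
          congr 1; field_simp
  · intro z hz s hs w R hR hzw hRs
    have hs' : (0 : ℝ) < s := hs
    have hφR := hφ.pos R hR
    rw [inSet, hp.density s hs z hz _ Metric.isOpen_ball.measurableSet]
    have hbound : ∀ᵐ y ∂(m.restrict (Metric.ball w R)),
        ENNReal.ofReal (L₁ / (v₂ * D ^ 2 * s)) ≤ (p s z y : ℝ≥0∞) := by
      filter_upwards [ae_restrict_of_ae hNae, ae_restrict_mem Metric.isOpen_ball.measurableSet]
        with y hy hyB
      refine le_trans ?_ (hL s hs z y hz hy).1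
      have hρ := hφ.scaleInv_pos hs'
      have e : ENNReal.ofReal (L₁ / (v₂ * D ^ 2 * s)) =
          L₁ * ENNReal.ofReal (1 / (v₂ * D ^ 2 * s)) := by
        rw [← ENNReal.ofReal_coe_nnreal, ← ENNReal.ofReal_mul (by positivity)]
        congr 1; field_simp
      rw [e]
      gcongr
      refine le_min ?_ ?_
      · calc ENNReal.ofReal (1 / (v₂ * D ^ 2 * s)) ≤ ENNReal.ofReal (1 / (v₂ * (D * s))) := by
              refine ENNReal.ofReal_le_ofReal (one_div_le_one_div_of_le (by positivity) ?_)
              have : D * s ≤ D ^ 2 * s := by gcongr; nlinarith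
              nlinarith
          _ = 1 / ENNReal.ofReal (v₂ * (D * s)) := by
              rw [ENNReal.ofReal_div_of_pos (by positivity), ENNReal.ofReal_one]
          _ ≤ 1 / m (Metric.ball z (scaleInv φ s)) := by
              gcongr
              refine (hvu z _ hρ).trans (ENNReal.ofReal_le_ofReal ?_)
              gcongr
              exact (hinv s hs').1
      · rcases eq_or_lt_of_le (dist_nonneg (x := z) (y := y)) with h0 | hd
        · rw [← h0, Metric.ball_zero, measure_empty, zero_mul,
            ENNReal.div_zero (by exact_mod_cast hs.ne')]
          exact le_top
        · have hd2 : dist z y ≤ 2 * R := by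
            have := dist_triangle_right z y w
            have := Metric.mem_ball.1 hyB
            linarith
          have h2 : φ (dist z y) ≤ D * φ R := (hφ.mono hd.le hd2).trans (hdoub R hR)
          calc ENNReal.ofReal (1 / (v₂ * D ^ 2 * s))
              ≤ ENNReal.ofReal (s / (v₂ * (D * φ R) * (D * φ R))) := by
                refine ENNReal.ofReal_le_ofReal ?_
                rw [div_le_div_iff₀ (by positivity) (by positivity)]
                have : φ R * φ R ≤ s * s := mul_self_le_mul_self hφR.le hRs
                have h3 : 0 < v₂ * D ^ 2 := by positivity
                nlinarith [mul_le_mul_of_nonneg_left this h3.le]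
            _ = s / (ENNReal.ofReal (v₂ * (D * φ R)) * ENNReal.ofReal (D * φ R)) := by
                rw [ENNReal.ofReal_div_of_pos (by positivity), ENNReal.ofReal_coe_nnreal,
                  ENNReal.ofReal_mul (by positivity)]
            _ ≤ s / (m (Metric.ball z (dist z y)) * ENNReal.ofReal (φ (dist z y))) := by
                gcongr
                refine (hvu z _ hd).trans (ENNReal.ofReal_le_ofReal ?_)
                gcongr
    calc ENNReal.ofReal (L₁ / (v₂ * D ^ 2) * v₁ * φ R / s)
        = ENNReal.ofReal (L₁ / (v₂ * D ^ 2 * s)) * ENNReal.ofReal (v₁ * φ R) := by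
          rw [← ENNReal.ofReal_mul (by positivity)]
          congr 1; field_simp
      _ ≤ ∫⁻ _ in Metric.ball w R, ENNReal.ofReal (L₁ / (v₂ * D ^ 2 * s)) ∂m := by
          rw [setLIntegral_const]; gcongr; exact hvl w R hR
      _ ≤ ∫⁻ y in Metric.ball w R, p s z y ∂m := lintegral_mono_ae hbound

end HeatKernel

end HuntProcess

theorem lintegral_Ioc_ofReal_div_sub {k t u v : ℝ} (hk : 0 ≤ k) (hu : 0 < u) (huv : u ≤ v) :
    ∫⁻ s in Ioc (t + u) (t + v), ENNReal.ofReal (k / (s - t)) = 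
      ENNReal.ofReal (k * Real.log (v / u)) := by
  have hle : t + u ≤ t + v := by linarith
  have hcont : ContinuousOn (fun s : ℝ => k / (s - t)) (Icc (t + u) (t + v)) := by
    refine ContinuousOn.div continuousOn_const (by fun_prop) fun s hs => ?_
    have := hs.1
    linarith
  have hint : IntegrableOn (fun s : ℝ => k / (s - t)) (Ioc (t + u) (t + v)) :=
    (hcont.integrableOn_Icc).mono_set Ioc_subset_Icc_self
  rw [← ofReal_integral_eq_lintegral_ofReal hint, ← intervalIntegral.integral_of_le hle]
  · congr 1
    have := intervalIntegral.integral_comp_sub_right (fun s : ℝ => k / s) (a := t + u) (b := t + v) t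
    rw [this]
    simp only [add_sub_cancel_left, div_eq_mul_inv, intervalIntegral.integral_const_mul]
    rw [integral_inv_of_pos hu (hu.trans_le huv), div_eq_mul_inv]
  · filter_upwards [ae_restrict_mem measurableSet_Ioc] with s hs
    have := hs.1
    exact div_nonneg hk (by linarith)

namespace HuntProcess

section HittingEstimates

variable {M : Type*} [MetricSpace M] [MeasurableSpace M] [BorelSpace M] {Ω : Type*}
  [MeasurableSpace Ω] {H : HuntProcess M Ω} {N : Set M} {φ : ℝ → ℝ} {c C : ℝ}

/-- Upper bound for the probability of visiting a ball, given the past. -/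
theorem BallEstimate.measure_hitOn_le (hB : H.BallEstimate N φ c C) (hφ : IsScaleFunction φ)
    {x : OnePoint M} (hx : H.Avoids N x) {T : ℝ≥0} {L : Set Ω}
    (hL : MeasurableSet[H.filtration T] L) (w : M) {R a b l : ℝ} (hR : 0 < R) (ha : 0 < a)
    (hab : a ≤ b) (hl : φ R ≤ l) (F : Finset ℝ≥0) (hF : ∀ t ∈ F, T + a ≤ t ∧ t ≤ T + b) :
    H.P x (L ∩ H.hitOn F (Metric.ball w R)) * ENNReal.ofReal (c * Real.log (l / φ R)) ≤
      H.P x L * ENNReal.ofReal (C * Real.log ((b + l) / a)) := by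
  have hφR := hφ.pos R hR
  have hc := hB.c_pos
  have hC := hB.C_pos
  have hl0 : 0 < l := hφR.trans_le hl
  have hU : MeasurableSet (Metric.ball w R) := Metric.isOpen_ball.measurableSet
  set β : ℝ → ℝ≥0∞ := (Ioc (φ R) l).indicator fun v => ENNReal.ofReal (c * φ R / v) with hβdef
  have hβm : Measurable β := by
    refine Measurable.indicator ?_ measurableSet_Ioc
    fun_prop
  have hTa : ∀ t ∈ F, T ≤ t := fun t ht => by
    have := (hF t ht).1
    exact_mod_cast (by linarith : (T : ℝ) ≤ t)
  have hpt : ∀ s ∈ Ioc (T + a : ℝ) (T + (b + l)),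
      ∑ t ∈ F, H.P x (L ∩ H.firstHit F (Metric.ball w R) t) * β (s - t) ≤
        H.P x L * ENNReal.ofReal (C * φ R / (s - T)) := by
    intro s hs
    have hsT : (T : ℝ) < s := by have := hs.1; linarith
    lift s to ℝ≥0 using T.2.trans hsT.le
    have hsT' : T < s := by exact_mod_cast hsT
    refine (H.sum_firstHit_mul_le hL hx hU hU F hTa β ?_ ?_ s).trans ?_
    · intro v hv
      exact indicator_of_notMem (fun h => by have := h.1; linarith) _
    · intro v z hz hzN
      by_cases h : (v : ℝ) ∈ Ioc (φ R) l
      · rw [hβdef, indicator_of_mem h]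
        exact hB.lower z hzN v (by exact_mod_cast hφR.trans h.1) w R hR (Metric.mem_ball.1 hz) h.1.le
      · rw [hβdef, indicator_of_notMem h]; exact zero_le
    · have := H.measure_inter_inSet_le T (s - T) hL hx hU
        (fun z hz => hB.upper z hz (s - T) (tsub_pos_of_lt hsT') w R hR)
      rwa [add_tsub_cancel_of_le hsT'.le, NNReal.coe_sub hsT'.le] at this
  have hint := setLIntegral_mono' (μ := volume) measurableSet_Ioc hpt
  have hβt : ∀ t : ℝ≥0, Measurable fun s : ℝ => β (s - t) := fun t =>
    hβm.comp (measurable_id.sub_const _)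
  rw [lintegral_finsetSum' _ fun t _ => ((hβt t).const_mul _).aemeasurable,
    lintegral_const_mul _ (by fun_prop),
    lintegral_Ioc_ofReal_div_sub (by positivity) ha (by linarith)] at hint
  have hlow : ∀ t ∈ F, H.P x (L ∩ H.firstHit F (Metric.ball w R) t) *
      ENNReal.ofReal (c * φ R * Real.log (l / φ R)) ≤
      ∫⁻ s in Ioc (T + a : ℝ) (T + (b + l)),
        H.P x (L ∩ H.firstHit F (Metric.ball w R) t) * β (s - t) := by
    intro t ht
    rw [lintegral_const_mul _ (hβt t)]
    gcongr
    rw [← lintegral_Ioc_ofReal_div_sub (t := t) (by positivity) hφR hl]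
    refine le_trans (setLIntegral_mono' measurableSet_Ioc fun s hs => ?_)
      (lintegral_mono_set (μ := volume) (f := fun s : ℝ => β (s - t)) ?_)
    · rw [hβdef, indicator_of_mem]
      exact ⟨by linarith [hs.1], by linarith [hs.2]⟩
    · have := hF t ht
      exact Ioc_subset_Ioc (by linarith) (by linarith)
  have hfin := (Finset.sum_le_sum hlow).trans hint
  rw [← Finset.sum_mul, ← H.measure_inter_hitOn x (H.filtration.le T L hL) F hU] at hfin
  have e₁ : c * φ R * Real.log (l / φ R) = φ R * (c * Real.log (l / φ R)) := by ring
  have e₂ : C * φ R * Real.log ((b + l) / a) = φ R * (C * Real.log ((b + l) / a)) := by ring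
  rw [e₁, e₂, ENNReal.ofReal_mul hφR.le, ENNReal.ofReal_mul hφR.le, mul_left_comm,
    mul_left_comm (H.P x L)] at hfin
  exact (ENNReal.mul_le_mul_iff_right (by simpa using hφR) ENNReal.ofReal_ne_top).1 hfin

theorem sum_range_inv_le_one_add_log (n : ℕ) :
    ∑ l ∈ Finset.range n, (l : ℝ)⁻¹ ≤ 1 + Real.log n := by
  have h : ∑ l ∈ Finset.range (n + 1), (l : ℝ)⁻¹ = (harmonic n : ℝ) := by
    rw [Finset.sum_range_succ', harmonic]
    push_cast
    simp
  refine le_trans ?_ (harmonic_le_one_add_log n)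
  rw [← h]
  exact Finset.sum_le_sum_of_subset_of_nonneg (Finset.range_mono n.le_succ)
    fun _ _ _ => by positivity

/-- Lower bound for the probability of visiting a ball around the starting point at one of the
times `a + h, …, a + n h`, where `h = φ(r)`. -/
theorem BallEstimate.le_measure_hitOn (hB : H.BallEstimate N φ c C) (hφ : IsScaleFunction φ)
    {x : M} (hx : x ∉ N) (hxN : H.Avoids N x) {r : ℝ} (hr : 0 < r) (a h : ℝ≥0)
    (hh : (h : ℝ) = φ r) (n : ℕ) :
    ENNReal.ofReal (c * (n * h / (a + n * h))) ≤
      H.P (x : OnePoint M) (H.hitOn ((Finset.range n).image fun i : ℕ => a + (i + 1) * h)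
        (Metric.ball x r)) * ENNReal.ofReal (1 + C * (1 + Real.log n)) := by
  classical
  have hφr := hφ.pos r hr
  have hc := hB.c_pos
  have hC := hB.C_pos
  have hh0 : 0 < h := by exact_mod_cast hh ▸ hφr
  set f : ℕ → ℝ≥0 := fun i => a + (i + 1) * h with hf
  have hmono : StrictMono f := fun i j hij => by
    have : (i : ℝ≥0) < j := by exact_mod_cast hij
    simp only [hf]; gcongr
  have hU : MeasurableSet (Metric.ball x r) := Metric.isOpen_ball.measurableSet
  set γ : ℝ≥0 → ℝ≥0∞ := fun v => if v = 0 then 1 else ENNReal.ofReal (C * φ r / v) with hγ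
  have hdiff : ∀ l j : ℕ, f (j + l) - f j = l * h := fun l j => by
    rw [tsub_eq_iff_eq_add_of_le (hmono.monotone (by omega))]
    simp only [hf]; push_cast; ring
  have hγl : ∀ l : ℕ, γ (l * h) ≤ ENNReal.ofReal ((if l = 0 then 1 else 0) + C * (l : ℝ)⁻¹) := by
    intro l
    rcases Nat.eq_zero_or_pos l with rfl | hl
    · simp [hγ]
    · have hl' : (0 : ℝ≥0) < l := by exact_mod_cast hl
      have : (l : ℝ≥0) * h ≠ 0 := (mul_pos hl' hh0).ne'
      simp only [hγ, this, if_false, hl.ne']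
      refine ENNReal.ofReal_le_ofReal (le_of_eq ?_)
      push_cast
      rw [hh]; field_simp; ring
  have key := H.sum_measure_inSet_le hxN hU ((Finset.range n).image f) γ ?_
    (ENNReal.ofReal (1 + C * (1 + Real.log n))) ?_
  · refine le_trans ?_ key
    rw [Finset.sum_image hmono.injective.injOn]
    calc ENNReal.ofReal (c * (n * h / (a + n * h)))
        = ∑ i ∈ Finset.range n, ENNReal.ofReal (c * φ r / (a + n * h)) := by
          rw [Finset.sum_const, Finset.card_range, nsmul_eq_mul, ← ENNReal.ofReal_natCast,
            ← ENNReal.ofReal_mul (by positivity), hh]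
          congr 1; ring
      _ ≤ _ := by
          refine Finset.sum_le_sum fun i hi => ?_
          have hi' : ((i : ℝ) + 1) ≤ n := by exact_mod_cast Finset.mem_range.1 hi
          have hfi : (f i : ℝ) = a + (i + 1) * h := by simp [hf]
          have hfh : (h : ℝ) ≤ f i := by
            rw [hfi]; nlinarith [a.2, h.2, (Nat.cast_nonneg i : (0 : ℝ) ≤ i),
              mul_nonneg (Nat.cast_nonneg i : (0 : ℝ) ≤ i) h.2]
          have hfpos : (0 : ℝ) < f i := lt_of_lt_of_le (by exact_mod_cast hh0) hfh
          refine le_trans (ENNReal.ofReal_le_ofReal ?_) (hB.lower x hx (f i)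
            (by exact_mod_cast hfpos) x r hr (by simpa using hr) (hh ▸ hfh))
          gcongr
          rw [hfi]; gcongr
  · intro v z hz
    by_cases hv : v = 0
    · simpa [hγ, hv] using prob_le_one
    · simp only [hγ, hv, if_false]
      exact hB.upper z hz v (pos_iff_ne_zero.2 hv) x r hr
  · intro t ht
    obtain ⟨j, hj, rfl⟩ := Finset.mem_image.1 ht
    rw [Finset.filter_image, Finset.sum_image hmono.injective.injOn]
    have e : (Finset.range n).filter (fun i => f j ≤ f i) = Finset.Ico j n := by
      ext i; simp [hmono.le_iff_le, and_comm]
    rw [e, Finset.sum_Ico_eq_sum_range]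
    simp_rw [hdiff]
    calc ∑ l ∈ Finset.range (n - j), γ (l * h)
        ≤ ∑ l ∈ Finset.range n, γ (l * h) :=
          Finset.sum_le_sum_of_subset (Finset.range_mono (Nat.sub_le _ _))
      _ ≤ ∑ l ∈ Finset.range n, ENNReal.ofReal ((if l = 0 then 1 else 0) + C * (l : ℝ)⁻¹) :=
          Finset.sum_le_sum fun l _ => hγl l
      _ = ENNReal.ofReal (∑ l ∈ Finset.range n, ((if l = 0 then 1 else 0) + C * (l : ℝ)⁻¹)) := by
          refine (ENNReal.ofReal_sum_of_nonneg fun l _ => ?_).symm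
          split_ifs <;> positivity
      _ ≤ _ := by
          refine ENNReal.ofReal_le_ofReal ?_
          rw [Finset.sum_add_distrib, ← Finset.mul_sum, Finset.sum_ite_eq' ]
          refine add_le_add ?_ (mul_le_mul_of_nonneg_left (sum_range_inv_le_one_add_log n) hC.le)
          split_ifs <;> norm_num

end HittingEstimates

end HuntProcess

section LogTail

variable {g : ℝ → ℝ}

/-- From `T₀` on, `|log g|` is at least `1`, and it increases at most by the factor `2` on the
intervals `[v, κ v]`. -/
def LogDoubling (g : ℝ → ℝ) (κ T₀ : ℝ) : Prop :=
  ∀ v, T₀ ≤ v → g v < 1 ∧ 1 ≤ |Real.log (g v)| ∧ ∀ u, v ≤ u → u ≤ κ * v →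
    |Real.log (g v)| ≤ |Real.log (g u)| ∧ |Real.log (g u)| ≤ 2 * |Real.log (g v)|

theorem LogRegular.exists_logDoubling (hgreg : LogRegular g) (hgpos : ∀ t, 0 < t → 0 < g t)
    (hganti : AntitoneOn g (Ioi 0)) (hglim : Tendsto g atTop (𝓝 0)) :
    ∃ κ T₀ : ℝ, 1 < κ ∧ 1 ≤ T₀ ∧ LogDoubling g κ T₀ := by
  obtain ⟨R, hR, hR1⟩ := hgreg
  obtain ⟨κ, hκR, hκ⟩ := ((hR1.eventually_lt_const (by norm_num : (1 : ℝ≥0∞) < 2)).and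
    self_mem_nhdsWithin).exists
  have hκ1 : 1 < κ := hκ
  obtain ⟨T₁, hT₁⟩ := ((hR κ hκ1).eventually_lt_const hκR).exists_forall_of_atTop
  obtain ⟨T₂, hT₂⟩ := (hglim.eventually_lt_const (Real.exp_pos (-1))).exists_forall_of_atTop
  refine ⟨κ, max 1 (max T₁ T₂), hκ1, le_max_left _ _, fun v hv => ?_⟩
  have hv1 : 1 ≤ v := (le_max_left _ _).trans hv
  have hvT₁ : T₁ ≤ v := ((le_max_left _ _).trans (le_max_right _ _)).trans hv
  have hvT₂ : T₂ ≤ v := ((le_max_right _ _).trans (le_max_right _ _)).trans hv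
  have hv0 : 0 < v := by linarith
  have hlog : Real.log (g v) < -1 := by
    rw [← Real.log_exp (-1)]
    exact Real.log_lt_log (hgpos v hv0) (hT₂ v hvT₂)
  have hg1 : g v < 1 := (hT₂ v hvT₂).trans_le (Real.exp_le_one_iff.2 (by norm_num))
  have habs : 1 ≤ |Real.log (g v)| := by rw [abs_of_neg (by linarith)]; linarith
  refine ⟨hg1, habs, fun u hvu huv => ⟨?_, ?_⟩⟩
  · have hle : Real.log (g u) ≤ Real.log (g v) :=
      Real.log_le_log (hgpos u (hv0.trans_le hvu)) (hganti hv0 (hv0.trans_le hvu) hvu)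
    rw [abs_of_neg (by linarith), abs_of_neg (by linarith)]
    linarith
  · have h : ENNReal.ofReal |Real.log (g u)| / ENNReal.ofReal |Real.log (g v)| ≤ 2 := by
      refine le_trans ?_ (hT₁ v hvT₁).le
      exact le_iSup₂_of_le u v (le_iSup_of_le
        ⟨(one_le_div hv0).2 hvu, (div_le_iff₀ hv0).2 huv, le_rfl⟩ le_rfl)
    rw [ENNReal.div_le_iff (by
      rw [ne_eq, ENNReal.ofReal_eq_zero, not_le]; linarith) ENNReal.ofReal_ne_top] at h
    have e : (2 : ℝ≥0∞) * ENNReal.ofReal |Real.log (g v)| =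
        ENNReal.ofReal (2 * |Real.log (g v)|) := by
      rw [ENNReal.ofReal_mul zero_le_two]; simp
    rw [e] at h
    exact (ENNReal.ofReal_le_ofReal_iff (by positivity)).1 h

theorem exists_nat_mem_Ioc_mul_pow {κ t s : ℝ} (hκ : 1 < κ) (ht : 0 < t) (hs : t < s) :
    ∃ k : ℕ, s ∈ Ioc (t * κ ^ k) (t * κ ^ (k + 1)) := by
  classical
  have h : ∃ n : ℕ, s ≤ t * κ ^ n := by
    obtain ⟨n, hn⟩ := pow_unbounded_of_one_lt (s / t) hκ
    exact ⟨n, by rw [mul_comm]; exact ((div_lt_iff₀ ht).1 hn).le⟩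
  obtain ⟨k, hk⟩ : ∃ k, Nat.find h = k + 1 := Nat.exists_eq_succ_of_ne_zero fun h0 => by
    have := Nat.find_spec h
    rw [h0, pow_zero, mul_one] at this
    linarith
  refine ⟨k, ?_, hk ▸ Nat.find_spec h⟩
  exact not_le.1 (Nat.find_min h (by omega))

/-- The discretization `∑_k 1 / |log g (t κ^k)|` of `∫_t^∞ ds / (s |log g(s)|)`. -/
noncomputable def logSum (g : ℝ → ℝ) (κ t : ℝ) : ℝ≥0∞ :=
  ∑' k : ℕ, ENNReal.ofReal (|Real.log (g (t * κ ^ k))|⁻¹)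

theorem logTail_eq_tsum {κ t : ℝ} (hκ : 1 < κ) (ht : 0 < t) :
    logTail g t = ∑' k : ℕ, ∫⁻ s in Ioc (t * κ ^ k) (t * κ ^ (k + 1)),
      (ENNReal.ofReal (s * |Real.log (g s)|))⁻¹ := by
  have hm : Monotone fun k : ℕ => t * κ ^ k := fun i j h => by
    have := pow_le_pow_right₀ hκ.le h
    simp only; gcongr
  have hU : Ioi t = ⋃ k : ℕ, Ioc (t * κ ^ k) (t * κ ^ (k + 1)) := by
    ext s
    simp only [mem_Ioi, mem_iUnion]
    refine ⟨fun hs => ?_, fun ⟨k, hk⟩ => ?_⟩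
    · exact exists_nat_mem_Ioc_mul_pow hκ ht hs
    · refine lt_of_le_of_lt ?_ hk.1
      have := one_le_pow₀ hκ.le (n := k)
      nlinarith
  rw [logTail, hU, lintegral_iUnion (fun _ => measurableSet_Ioc)]
  exact hm.pairwise_disjoint_on_Ioc_succ

theorem tendsto_abs_log (hglim : Tendsto g atTop (𝓝 0))
    (hgpos : ∀ t, 0 < t → 0 < g t) : Tendsto (fun t => |Real.log (g t)|) atTop atTop := by
  refine tendsto_abs_atBot_atTop.comp (Real.tendsto_log_nhdsGT_zero.comp ?_)
  refine tendsto_nhdsWithin_iff.2 ⟨hglim, ?_⟩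
  filter_upwards [eventually_gt_atTop 0] with t ht using hgpos t ht

variable {κ T₀ : ℝ}

theorem logTail_piece_bounds (hT₀ : 1 ≤ T₀) (hκ : 1 < κ) (hg : LogDoubling g κ T₀) {v : ℝ}
    (hv : T₀ ≤ v) :
    ENNReal.ofReal (Real.log κ / 2) * ENNReal.ofReal |Real.log (g v)|⁻¹ ≤
      ∫⁻ s in Ioc v (v * κ), (ENNReal.ofReal (s * |Real.log (g s)|))⁻¹ ∧
    ∫⁻ s in Ioc v (v * κ), (ENNReal.ofReal (s * |Real.log (g s)|))⁻¹ ≤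
      ENNReal.ofReal (Real.log κ) * ENNReal.ofReal |Real.log (g v)|⁻¹ := by
  have hv0 : 0 < v := by linarith
  obtain ⟨-, h1, hu⟩ := hg v hv
  have hκ' := Real.log_pos hκ
  set ℓ := |Real.log (g v)| with hℓ
  have hℓ0 : 0 < ℓ := by linarith
  have hcalc : ∀ k : ℝ, 0 ≤ k → ∫⁻ s in Ioc v (v * κ), ENNReal.ofReal (k / s) =
      ENNReal.ofReal (k * Real.log κ) := fun k hk => by
    have := lintegral_Ioc_ofReal_div_sub (t := 0) hk hv0 (by nlinarith : v ≤ v * κ)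
    simp only [zero_add, sub_zero] at this
    rw [this, mul_div_cancel_left₀ _ hv0.ne']
  have hs : ∀ s ∈ Ioc v (v * κ), 0 < s ∧ ℓ ≤ |Real.log (g s)| ∧ |Real.log (g s)| ≤ 2 * ℓ :=
    fun s hs => ⟨hv0.trans hs.1, hu s hs.1.le (by linarith [hs.2])⟩
  constructor
  · have e : ENNReal.ofReal (Real.log κ / 2) * ENNReal.ofReal ℓ⁻¹ =
        ENNReal.ofReal ((2 * ℓ)⁻¹ * Real.log κ) := by
      rw [← ENNReal.ofReal_mul (by positivity)]; congr 1; field_simp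
    rw [e, ← hcalc _ (by positivity)]
    refine setLIntegral_mono' measurableSet_Ioc fun s h => ?_
    obtain ⟨h0, h2, h3⟩ := hs s h
    rw [← ENNReal.ofReal_inv_of_pos (mul_pos h0 (by linarith))]
    refine ENNReal.ofReal_le_ofReal ?_
    rw [inv_eq_one_div, div_div, inv_eq_one_div]
    exact one_div_le_one_div_of_le (mul_pos h0 (by linarith)) (by nlinarith)
  · rw [← ENNReal.ofReal_mul hκ'.le, mul_comm (Real.log κ), ← hcalc _ (by positivity)]
    refine setLIntegral_mono' measurableSet_Ioc fun s h => ?_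
    obtain ⟨h0, h2, h3⟩ := hs s h
    rw [← ENNReal.ofReal_inv_of_pos (mul_pos h0 (by linarith))]
    refine ENNReal.ofReal_le_ofReal ?_
    rw [inv_eq_one_div, inv_eq_one_div ℓ, div_div]
    exact one_div_le_one_div_of_le (mul_pos hℓ0 h0) (by nlinarith)

theorem le_mul_pow_of_one_lt (hκ : 1 < κ) {t : ℝ} (ht : 0 < t) (k : ℕ) : t ≤ t * κ ^ k :=
  le_mul_of_one_le_right ht.le (one_le_pow₀ hκ.le)

theorem logTail_bounds (hT₀ : 1 ≤ T₀) (hκ : 1 < κ) (hg : LogDoubling g κ T₀) {t : ℝ}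
    (ht : T₀ ≤ t) :
    ENNReal.ofReal (Real.log κ / 2) * logSum g κ t ≤ logTail g t ∧
      logTail g t ≤ ENNReal.ofReal (Real.log κ) * logSum g κ t := by
  have ht0 : 0 < t := by linarith
  have hk : ∀ k : ℕ, T₀ ≤ t * κ ^ k := fun k => ht.trans (le_mul_pow_of_one_lt hκ ht0 k)
  rw [logTail_eq_tsum hκ ht0, logSum, ← ENNReal.tsum_mul_left, ← ENNReal.tsum_mul_left]
  simp_rw [pow_succ, ← mul_assoc]
  exact ⟨ENNReal.tsum_le_tsum fun k => (logTail_piece_bounds hT₀ hκ hg (hk k)).1,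
    ENNReal.tsum_le_tsum fun k => (logTail_piece_bounds hT₀ hκ hg (hk k)).2⟩

theorem tendsto_logTail (h : logTail g 1 < ∞) : Tendsto (logTail g) atTop (𝓝 0) := by
  set f : ℝ → ℝ≥0∞ := fun s => (ENNReal.ofReal (s * |Real.log (g s)|))⁻¹
  set ν := (volume.restrict (Ioi (1 : ℝ))).withDensity f
  have hν : ∀ t : ℝ, 1 ≤ t → ν (Ioi t) = logTail g t := fun t ht => by
    rw [withDensity_apply _ measurableSet_Ioi, Measure.restrict_restrict measurableSet_Ioi,
      inter_eq_self_of_subset_left (Ioi_subset_Ioi ht)]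
    rfl
  have hlim := tendsto_measure_iInter_atTop (μ := ν) (s := fun t : ℝ => Ioi t)
    (fun t => measurableSet_Ioi.nullMeasurableSet) (fun a b hab => Ioi_subset_Ioi hab)
    ⟨1, by rw [hν 1 le_rfl]; exact h.ne⟩
  have he : ⋂ t : ℝ, Ioi t = ∅ := by
    ext x; simpa using ⟨x, le_rfl⟩
  rw [he, measure_empty] at hlim
  refine hlim.congr' ?_
  filter_upwards [eventually_ge_atTop 1] with t ht using hν t ht

end LogTail

namespace HuntProcess

section Dense

variable {M : Type*} [TopologicalSpace M] {Ω : Type*} [MeasurableSpace Ω] (H : HuntProcess M Ω)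

/-- A countable dense set of times. -/
def denseTimes : Set ℝ≥0 := range (TopologicalSpace.denseSeq ℝ≥0)

theorem countable_denseTimes : denseTimes.Countable := countable_range _

theorem dense_denseTimes : Dense denseTimes :=
  TopologicalSpace.denseRange_denseSeq ℝ≥0

/-- By right continuity, a visit to an open set persists for some time. -/
theorem exists_denseTimes_inSet {U : Set M} (hU : IsOpen U) {u v : ℝ≥0} (huv : u < v) {ω : Ω}
    (h : ω ∈ H.inSet u U) : ∃ q ∈ denseTimes, u < q ∧ q < v ∧ ω ∈ H.inSet q U := by
  have hU' : IsOpen ((fun y : M => (y : OnePoint M)) '' U) := OnePoint.isOpen_image_coe.2 hU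
  rw [inSet_eq_preimage] at h
  have h₁ : ∀ᶠ s in 𝓝[≥] u, H.X s ω ∈ (fun y : M => (y : OnePoint M)) '' U :=
    (H.right_continuous ω u).eventually (hU'.mem_nhds h)
  obtain ⟨w, hw, hsub⟩ := (mem_nhdsGE_iff_exists_Ico_subset' huv).1 h₁
  obtain ⟨q, hq, hq'⟩ := dense_denseTimes.exists_between (lt_min hw huv)
  refine ⟨q, hq, hq'.1, hq'.2.trans_le (min_le_right _ _), ?_⟩
  rw [inSet_eq_preimage]
  exact hsub ⟨hq'.1.le, hq'.2.trans_le (min_le_left _ _)⟩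

theorem measure_inter_hitOn_le_of_finset (x : OnePoint M) {L : Set Ω} {Q : Set ℝ≥0}
    (hQ : Q.Countable) {U : Set M} {b : ℝ≥0∞}
    (h : ∀ F : Finset ℝ≥0, (F : Set ℝ≥0) ⊆ Q → H.P x (L ∩ H.hitOn F U) ≤ b) :
    H.P x (L ∩ H.hitOn Q U) ≤ b := by
  classical
  have : Countable Q := hQ.to_subtype
  have e : L ∩ H.hitOn Q U =
      ⋃ F : Finset Q, L ∩ H.hitOn (F.image Subtype.val : Finset ℝ≥0) U := by
    ext ω
    simp only [mem_iUnion, mem_inter_iff, mem_hitOn]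
    constructor
    · rintro ⟨hL, t, ht, hω⟩
      exact ⟨{⟨t, ht⟩}, hL, t, by simp, hω⟩
    · rintro ⟨F, hL, t, ht, hω⟩
      rw [Finset.coe_image] at ht
      obtain ⟨q, -, rfl⟩ := ht
      exact ⟨hL, q, q.2, hω⟩
  rw [e, Directed.measure_iUnion]
  · refine iSup_le fun F => h _ ?_
    rw [Finset.coe_image]
    rintro _ ⟨q, -, rfl⟩
    exact q.2
  · refine directed_of_isDirected_le fun F F' hF => inter_subset_inter_right _ (H.hitOn_mono ?_ U)
    exact_mod_cast Finset.image_subset_image hF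

end Dense

end HuntProcess

theorem ENNReal.le_mul_ofReal_div {X Y : ℝ≥0∞} {u v : ℝ} (hu : 0 < u)
    (h : X * ENNReal.ofReal u ≤ Y * ENNReal.ofReal v) : X ≤ Y * ENNReal.ofReal (v / u) := by
  rw [ENNReal.ofReal_div_of_pos hu, ← mul_div_assoc]
  exact (ENNReal.le_div_iff_mul_le (Or.inl (by simpa using hu)) (Or.inl ENNReal.ofReal_ne_top)).2 h

theorem rpow_eq_exp_neg_abs_log {y : ℝ} (hy : 0 < y) (hy1 : y < 1) (d : ℝ) :
    y ^ d = Real.exp (-(d * |Real.log y|)) := by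
  rw [abs_of_neg (Real.log_neg hy hy1), Real.rpow_def_of_pos hy]
  congr 1; ring

namespace HuntProcess

section Windows

variable {M : Type*} [MetricSpace M] [MeasurableSpace M] [BorelSpace M] {Ω : Type*}
  [MeasurableSpace Ω] {H : HuntProcess M Ω} {N : Set M} {φ g : ℝ → ℝ} {c C κ T₀ : ℝ}

/-- Upper bound, given the past, for the probability of visiting a small ball in a time window
of length of order `t`. -/
theorem BallEstimate.exists_window_upper (hB : H.BallEstimate N φ c C) (hφ : IsScaleFunction φ)
    (hgpos : ∀ t, 0 < t → 0 < g t) (hglim : Tendsto g atTop (𝓝 0)) (hκ : 1 < κ) (hT₀ : 1 ≤ T₀)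
    (hg : LogDoubling g κ T₀) {K : ℝ} (hK : 1 < K) :
    ∃ C₁ T₁ : ℝ, 0 < C₁ ∧ T₀ ≤ T₁ ∧ ∀ t, T₁ ≤ t → ∀ R, 0 < R → R ≤ 2 * (scaleInv φ (κ * t) * g t) →
      ∀ x : OnePoint M, H.Avoids N x → ∀ (T : ℝ≥0) (L : Set Ω), MeasurableSet[H.filtration T] L →
      ∀ (w : M) (a b : ℝ), 0 < a → a ≤ b → (b + t) / a ≤ K →
      ∀ F : Finset ℝ≥0, (∀ s ∈ F, T + a ≤ s ∧ s ≤ T + b) →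
        H.P x (L ∩ H.hitOn F (Metric.ball w R)) ≤
          H.P x L * ENNReal.ofReal (C₁ * |Real.log (g t)|⁻¹) := by
  have hc := hB.c_pos
  have hC := hB.C_pos
  obtain ⟨D, hD, hdoub, hinv⟩ := hφ.exists_apply_scaleInv
  obtain ⟨c₃, c₄, d₃, d₄, h3, h4, hd3, hd4, hcon⟩ := hφ.exists_contraction
  have hlogK := Real.log_pos hK
  set A : ℝ := D * (c₃ * (D * κ)) with hA
  have hA0 : 0 < A := by positivity
  obtain ⟨T₂, hT₂⟩ := ((tendsto_abs_log hglim hgpos).eventually_ge_atTop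
    (2 * |Real.log A| / d₃)).exists_forall_of_atTop
  refine ⟨2 * (C * Real.log K) / (c * d₃), max T₀ T₂, by positivity, le_max_left _ _, ?_⟩
  intro t ht R hR hRle x hx T L hL w a b ha hab hbK F hF
  have htT₀ : T₀ ≤ t := (le_max_left _ _).trans ht
  have ht0 : 0 < t := by linarith
  obtain ⟨hg1, hℓ1, -⟩ := hg t htT₀
  have hgt := hgpos t ht0
  set ℓ := |Real.log (g t)| with hℓ
  have hℓ0 : 0 < ℓ := by linarith
  have hℓA : 2 * |Real.log A| ≤ ℓ * d₃ := (div_le_iff₀ hd3).1 (hT₂ t ((le_max_right _ _).trans ht))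
  have hρ := hφ.scaleInv_pos (by positivity : 0 < κ * t)
  have hφR := hφ.pos R hR
  have hφR_le : φ R ≤ A * t * Real.exp (-(d₃ * ℓ)) := by
    calc φ R ≤ φ (2 * (scaleInv φ (κ * t) * g t)) := hφ.mono hR.le hRle
      _ ≤ D * φ (scaleInv φ (κ * t) * g t) := hdoub _ (by positivity)
      _ ≤ D * (c₃ * g t ^ d₃ * φ (scaleInv φ (κ * t))) := by
          gcongr; exact (hcon _ _ hρ hgt hg1).1
      _ ≤ D * (c₃ * g t ^ d₃ * (D * (κ * t))) := by
          gcongr; exact (hinv _ (by positivity)).1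
      _ = A * t * Real.exp (-(d₃ * ℓ)) := by rw [rpow_eq_exp_neg_abs_log hgt hg1, hA]; ring
  have hlog : d₃ * ℓ / 2 ≤ Real.log (t / φ R) := by
    have h1 : A⁻¹ * Real.exp (d₃ * ℓ) ≤ t / φ R := by
      rw [le_div_iff₀ hφR]
      calc A⁻¹ * Real.exp (d₃ * ℓ) * φ R
          ≤ A⁻¹ * Real.exp (d₃ * ℓ) * (A * t * Real.exp (-(d₃ * ℓ))) := by gcongr
        _ = t := by rw [Real.exp_neg]; field_simp
    have h2 := Real.log_le_log (by positivity) h1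
    rw [Real.log_mul (by positivity) (by positivity), Real.log_inv, Real.log_exp] at h2
    linarith [le_abs_self (Real.log A)]
  have hl : φ R ≤ t := by
    have : 0 ≤ Real.log (t / φ R) := le_trans (by positivity) hlog
    rw [Real.log_nonneg_iff (by positivity), one_le_div hφR] at this
    exact this
  have hmain := hB.measure_hitOn_le hφ hx hL w hR ha hab hl F hF
  have e : 2 * (C * Real.log K) / (c * d₃) * ℓ⁻¹ = (C * Real.log K) / (c * (d₃ * ℓ / 2)) := by
    field_simp
  rw [e]
  refine ENNReal.le_mul_ofReal_div (by positivity) (le_trans ?_ (hmain.trans ?_))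
  · gcongr
  · gcongr
    exact div_pos (by linarith) ha

/-- Lower bound for the probability of visiting a small ball around the starting point in the time
window `[(1 + κ) t / 2, κ t]`. -/
theorem BallEstimate.exists_window_lower (hB : H.BallEstimate N φ c C) (hφ : IsScaleFunction φ)
    (hgpos : ∀ t, 0 < t → 0 < g t) (hglim : Tendsto g atTop (𝓝 0)) (hκ : 1 < κ) (hT₀ : 1 ≤ T₀)
    (hg : LogDoubling g κ T₀) :
    ∃ c₁ T₁ : ℝ, 0 < c₁ ∧ T₀ ≤ T₁ ∧ ∀ t, T₁ ≤ t → ∃ F : Finset ℝ≥0,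
      (∀ s ∈ F, (1 + κ) / 2 * t < s ∧ s ≤ κ * t) ∧
      ∀ x : M, x ∉ N → H.Avoids N x →
        ENNReal.ofReal (c₁ * |Real.log (g t)|⁻¹) ≤ H.P (x : OnePoint M)
          (H.hitOn F (Metric.ball x (scaleInv φ t * g (κ * t)))) := by
  classical
  have hc := hB.c_pos
  have hC := hB.C_pos
  obtain ⟨D, hD, hdoub, hinv⟩ := hφ.exists_apply_scaleInv
  obtain ⟨c₃, c₄, d₃, d₄, h3, h4, hd3, hd4, hcon⟩ := hφ.exists_contraction
  have hκ' : 0 < κ - 1 := by linarith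
  have hD0 : 0 < D := by linarith
  set B : ℝ := (κ - 1) * D / (2 * c₄) with hBdef
  have hB0 : 0 < B := by positivity
  set K : ℝ := 1 + C * (1 + |Real.log B| + 2 * d₄) with hK
  have hK0 : 0 < K := by positivity
  have hsmall : Tendsto (fun t => c₃ * D * Real.exp (-(d₃ * |Real.log (g t)|))) atTop (𝓝 0) := by
    have h1 : Tendsto (fun t => -(d₃ * |Real.log (g t)|)) atTop atBot :=
      tendsto_neg_atTop_atBot.comp ((tendsto_abs_log hglim hgpos).const_mul_atTop hd3)
    simpa using (Real.tendsto_exp_atBot.comp h1).const_mul (c₃ * D)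
  obtain ⟨T₂, hT₂⟩ := (hsmall.eventually_le_const
    (by positivity : 0 < (κ - 1) / 4)).exists_forall_of_atTop
  refine ⟨c * ((κ - 1) / (4 * κ)) / K, max T₀ T₂, by positivity, le_max_left _ _, fun t ht => ?_⟩
  have htT₀ : T₀ ≤ t := (le_max_left _ _).trans ht
  have ht0 : 0 < t := by linarith
  have hκt : t ≤ κ * t := by nlinarith
  obtain ⟨hg1, hℓ1, hℓu⟩ := hg t htT₀
  obtain ⟨hg1', -, -⟩ := hg (κ * t) (htT₀.trans hκt)
  obtain ⟨hℓℓ', hℓ'ℓ⟩ := hℓu (κ * t) hκt le_rfl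
  have hgt := hgpos (κ * t) (by positivity)
  have hsm := hT₂ t ((le_max_right _ _).trans ht)
  set ℓ := |Real.log (g t)| with hℓ
  set ℓ' := |Real.log (g (κ * t))| with hℓ'
  have hρ := hφ.scaleInv_pos ht0
  set r := scaleInv φ t * g (κ * t) with hr
  have hr0 : 0 < r := by positivity
  have hφr := hφ.pos r hr0
  obtain ⟨hcu, hcl⟩ := hcon _ _ hρ hgt hg1'
  obtain ⟨hiu, hil⟩ := hinv t ht0
  rw [rpow_eq_exp_neg_abs_log hgt hg1'] at hcu hcl
  have hφρ := hφ.pos _ hρ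
  have hu : φ r ≤ (κ - 1) / 4 * t := by
    calc φ r ≤ c₃ * Real.exp (-(d₃ * ℓ')) * φ (scaleInv φ t) := hcu
      _ ≤ c₃ * Real.exp (-(d₃ * ℓ)) * (D * t) := by gcongr
      _ = c₃ * D * Real.exp (-(d₃ * ℓ)) * t := by ring
      _ ≤ (κ - 1) / 4 * t := by gcongr
  have hlow : c₄ * Real.exp (-(d₄ * (2 * ℓ))) * (t / D) ≤ φ r := by
    refine le_trans ?_ hcl
    gcongr
    rwa [div_le_iff₀ hD0, mul_comm]
  set δ : ℝ := (κ - 1) / 2 * t with hδ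
  have hδ0 : 0 < δ := by positivity
  set n : ℕ := ⌊δ / φ r⌋₊ with hn
  have hn1 : (n : ℝ) * φ r ≤ δ := (le_div_iff₀ hφr).1 (Nat.floor_le (by positivity))
  have hn2 : δ < (n + 1) * φ r := (div_lt_iff₀ hφr).1 (Nat.lt_floor_add_one _)
  have hn3 : δ / 2 ≤ n * φ r := by rw [hδ] at hn2 ⊢; nlinarith
  have hnpos : (0 : ℝ) < n := by
    by_contra! h0
    nlinarith
  have hlogn : Real.log n ≤ |Real.log B| + 2 * d₄ * ℓ := by
    have h1 : (n : ℝ) ≤ B * Real.exp (d₄ * (2 * ℓ)) := by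
      refine (Nat.floor_le (by positivity)).trans ?_
      rw [div_le_iff₀ hφr]
      calc δ = B * Real.exp (d₄ * (2 * ℓ)) * (c₄ * Real.exp (-(d₄ * (2 * ℓ))) * (t / D)) := by
            rw [Real.exp_neg, hBdef, hδ]; field_simp
        _ ≤ _ := by gcongr
    have h2 := Real.log_le_log hnpos h1
    rw [Real.log_mul (by positivity) (by positivity), Real.log_exp] at h2
    linarith [le_abs_self (Real.log B)]
  set a : ℝ≥0 := ⟨(1 + κ) / 2 * t, by positivity⟩ with ha
  set h : ℝ≥0 := ⟨φ r, hφr.le⟩ with hh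
  have haR : (a : ℝ) = (1 + κ) / 2 * t := rfl
  have hhR : (h : ℝ) = φ r := rfl
  refine ⟨(Finset.range n).image fun i : ℕ => a + (i + 1) * h, fun s hs => ?_, fun x hx hxN => ?_⟩
  · obtain ⟨i, hi, rfl⟩ := Finset.mem_image.1 hs
    have hi' : ((i : ℝ) + 1) ≤ n := by exact_mod_cast Finset.mem_range.1 hi
    push_cast
    rw [haR, hhR]
    have h1 : ((i : ℝ) + 1) * φ r ≤ δ := (mul_le_mul_of_nonneg_right hi' hφr.le).trans hn1
    have h2 : 0 < ((i : ℝ) + 1) * φ r := by positivity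
    exact ⟨by linarith, by rw [hδ] at h1; linarith⟩
  · have key := hB.le_measure_hitOn hφ hx hxN hr0 a h hhR n
    have hpos : 0 < 1 + C * (1 + Real.log n) := by
      have : 0 ≤ Real.log n := Real.log_natCast_nonneg n
      positivity
    have hKℓ : 1 + C * (1 + Real.log n) ≤ K * ℓ := by
      rw [hK]
      have h0 := abs_nonneg (Real.log B)
      have h1 : 1 + Real.log n ≤ (1 + |Real.log B| + 2 * d₄) * ℓ := by
        linarith [mul_nonneg (by linarith : 0 ≤ 1 + |Real.log B|) (sub_nonneg.2 hℓ1)]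
      linarith [mul_le_mul_of_nonneg_left h1 hC.le]
    have hfrac : (κ - 1) / (4 * κ) ≤ n * h / (a + n * h) := by
      rw [haR, hhR]
      calc (κ - 1) / (4 * κ) = δ / 2 / (κ * t) := by rw [hδ]; field_simp; ring
        _ ≤ n * φ r / ((1 + κ) / 2 * t + n * φ r) :=
          div_le_div₀ (by positivity) hn3 (by positivity) (by rw [hδ] at hn1; linarith)
    have h1 : ENNReal.ofReal (c * ((κ - 1) / (4 * κ))) ≤
        H.P (x : OnePoint M) (H.hitOn ((Finset.range n).image fun i : ℕ => a + (i + 1) * h)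
          (Metric.ball x r)) * ENNReal.ofReal (K * ℓ) := by
      refine le_trans ?_ (key.trans ?_)
      · gcongr
      · gcongr
    have e : c * ((κ - 1) / (4 * κ)) / K * ℓ⁻¹ = c * ((κ - 1) / (4 * κ)) / (K * ℓ) := by
      field_simp
    rw [e, ENNReal.ofReal_div_of_pos (by positivity)]
    exact ENNReal.div_le_of_le_mul h1

end Windows

end HuntProcess

/-- A Borel-Cantelli type inequality: if the events `A k` are nearly independent and their
probabilities have a small sum, then the probability of their union is comparable to this sum. -/
theorem MeasureTheory.tsum_measure_le_two_mul_measure_iUnion {Ω : Type*} [MeasurableSpace Ω]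
    (P : Measure Ω) [IsFiniteMeasure P] (A : ℕ → Set Ω) (hA : ∀ k, MeasurableSet (A k))
    (η : ℕ → ℝ≥0∞) (hη : ∀ k j, k < j → P (A k ∩ A j) ≤ P (A k) * η j)
    (hsum : ∑' j, η j ≤ 1 / 2) : ∑' k, P (A k) ≤ 2 * P (⋃ k, A k) := by
  set D : ℕ → Set Ω := fun k => ⋃ j, ⋃ (_ : k < j), A j with hD
  have hDm : ∀ k, MeasurableSet (D k) := fun k =>
    MeasurableSet.iUnion fun j => MeasurableSet.iUnion fun _ => hA j
  have hhalf : ∀ k, P (A k) ≤ 2 * P (A k \ D k) := by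
    intro k
    have h1 : P (A k ∩ D k) ≤ P (A k) * (1 / 2) := by
      calc P (A k ∩ D k) = P (⋃ j, ⋃ (_ : k < j), A k ∩ A j) := by
            rw [hD, inter_iUnion₂]
        _ ≤ ∑' j, P (⋃ (_ : k < j), A k ∩ A j) := measure_iUnion_le _
        _ ≤ ∑' j, P (A k) * η j := ENNReal.tsum_le_tsum fun j => by
            by_cases h : k < j
            · simpa [h] using hη k j h
            · simp [h]
        _ ≤ P (A k) * (1 / 2) := by rw [ENNReal.tsum_mul_left]; gcongr
    have h2 : P (A k) ≤ P (A k) / 2 + P (A k \ D k) := by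
      calc P (A k) = P (A k ∩ D k) + P (A k \ D k) := (measure_inter_add_sdiff _ (hDm k)).symm
        _ ≤ _ := by gcongr; simpa [div_eq_mul_inv] using h1
    have h3 : P (A k) / 2 ≤ P (A k \ D k) := by
      have := tsub_le_iff_left.2 h2
      rwa [ENNReal.sub_half (measure_ne_top _ _)] at this
    rw [mul_comm]
    exact (ENNReal.div_le_iff (by simp) (by simp)).1 h3
  calc ∑' k, P (A k) ≤ ∑' k, 2 * P (A k \ D k) := ENNReal.tsum_le_tsum hhalf
    _ = 2 * P (⋃ k, A k \ D k) := by
        rw [ENNReal.tsum_mul_left, measure_iUnion]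
        · intro i j hij
          refine Set.disjoint_left.2 fun ω h₁ h₂ => ?_
          rcases lt_or_gt_of_ne hij with h | h
          · exact h₁.2 (mem_iUnion₂.2 ⟨j, h, h₂.1⟩)
          · exact h₂.2 (mem_iUnion₂.2 ⟨i, h, h₁.1⟩)
        · exact fun k => (hA k).diff (hDm k)
    _ ≤ 2 * P (⋃ k, A k) := by
        gcongr
        exact sdiff_subset

namespace HuntProcess

section Crossing

variable {M : Type*} [MetricSpace M] [MeasurableSpace M] [BorelSpace M] {Ω : Type*}
  [MeasurableSpace Ω] {H : HuntProcess M Ω} {N : Set M} {φ g : ℝ → ℝ} {c C κ T₀ : ℝ}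

theorem BallEstimate.exists_crossingProb_upper (hB : H.BallEstimate N φ c C)
    (hφ : IsScaleFunction φ) (hgpos : ∀ t, 0 < t → 0 < g t) (hganti : AntitoneOn g (Ioi 0))
    (hglim : Tendsto g atTop (𝓝 0)) (hκ : 1 < κ) (hT₀ : 1 ≤ T₀) (hg : LogDoubling g κ T₀) :
    ∃ C₁ T₁ : ℝ, 0 < C₁ ∧ T₀ ≤ T₁ ∧ ∀ t : ℝ≥0, T₁ ≤ t → ∀ x : M, H.Avoids N x →
      H.crossingProb (fun u => scaleInv φ u * g u) t x ≤
        ENNReal.ofReal C₁ * logSum g κ t := by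
  obtain ⟨C₁, T₁, hC₁, hT₁, hW⟩ := hB.exists_window_upper hφ hgpos hglim hκ hT₀ hg
    (K := κ ^ 2 + 1) (by nlinarith)
  refine ⟨C₁, T₁, hC₁, hT₁, fun t ht x hx => ?_⟩
  have ht0 : (0 : ℝ) < t := by linarith
  have htk : ∀ k : ℕ, (t : ℝ) ≤ t * κ ^ k := fun k => le_mul_pow_of_one_lt hκ ht0 k
  set τ : ℕ → ℝ := fun k => t * κ ^ k with hτ
  have hτ0 : ∀ k, 0 < τ k := fun k => ht0.trans_le (htk k)
  set Q : ℕ → Set ℝ≥0 := fun k => denseTimes ∩ {q | τ k < q ∧ (q : ℝ) < κ ^ 2 * τ k} with hQ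
  set R : ℕ → ℝ := fun k => 2 * (scaleInv φ (κ * τ k) * g (τ k)) with hR
  have hR0 : ∀ k, 0 < R k := fun k => by
    have := hφ.scaleInv_pos (mul_pos (by linarith : 0 < κ) (hτ0 k))
    have := hgpos _ (hτ0 k)
    positivity
  have hsub : {ω | ∃ u : ℝ≥0, t < u ∧ ∃ y : M, H.X u ω = (y : OnePoint M) ∧
      dist y x ≤ scaleInv φ u * g u} ⊆ ⋃ k, H.hitOn (Q k) (Metric.ball x (R k)) := by
    rintro ω ⟨u, htu, y, hy, hd⟩
    obtain ⟨k, hk1, hk2⟩ := exists_nat_mem_Ioc_mul_pow hκ ht0 (by exact_mod_cast htu : (t : ℝ) < u)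
    have hk1 : τ k < u := hk1
    have hk2 : (u : ℝ) ≤ κ * τ k := by rw [hτ]; rw [pow_succ] at hk2; linarith
    have hyR : y ∈ Metric.ball x (R k) := by
      have hg0 := hgpos _ (hτ0 k)
      have hρ := hφ.scaleInv_pos (mul_pos (by linarith : 0 < κ) (hτ0 k))
      have hgu : g u ≤ g (τ k) := hganti (hτ0 k) ((hτ0 k).trans hk1) hk1.le
      have h1 : scaleInv φ u * g u ≤ scaleInv φ (κ * τ k) * g (τ k) :=
        mul_le_mul (hφ.scaleInv_mono hk2) hgu (hgpos _ ((hτ0 k).trans hk1)).le hρ.le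
      rw [Metric.mem_ball, hR]
      have := mul_pos hρ hg0
      linarith
    obtain ⟨q, hq, huq, hqv, hω⟩ := H.exists_denseTimes_inSet Metric.isOpen_ball
      (u := u) (v := (κ ^ 2 * τ k).toNNReal) (Real.lt_toNNReal_iff_coe_lt.2 (by
        nlinarith [hτ0 k, mul_pos (mul_pos (by linarith : 0 < κ) (by linarith : 0 < κ - 1)) (hτ0 k)]))
      ⟨y, hyR, hy⟩
    refine mem_iUnion.2 ⟨k, H.mem_hitOn.2 ⟨q, ⟨hq, ?_, ?_⟩, hω⟩⟩
    · exact hk1.trans (by exact_mod_cast huq)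
    · exact Real.lt_toNNReal_iff_coe_lt.1 hqv
  have hpiece : ∀ k, H.P (x : OnePoint M) (H.hitOn (Q k) (Metric.ball x (R k))) ≤
      ENNReal.ofReal C₁ * ENNReal.ofReal |Real.log (g (τ k))|⁻¹ := by
    intro k
    have := H.measure_inter_hitOn_le_of_finset (x : OnePoint M) (L := univ) (Q := Q k)
      (countable_denseTimes.mono inter_subset_left) (U := Metric.ball x (R k))
      (b := ENNReal.ofReal C₁ * ENNReal.ofReal |Real.log (g (τ k))|⁻¹) (fun F hF => ?_)
    · simpa using this
    · have hτk := hτ0 k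
      have hab : τ k ≤ κ ^ 2 * τ k := by nlinarith [one_lt_pow₀ hκ two_ne_zero]
      refine (hW (τ k) (ht.trans (htk k)) (R k) (hR0 k) le_rfl x hx 0 univ MeasurableSet.univ x
        (τ k) (κ ^ 2 * τ k) hτk hab (le_of_eq (by field_simp)) F fun s hs => ?_).trans ?_
      · have := (hF hs).2
        simpa using ⟨this.1.le, this.2.le⟩
      · rw [ENNReal.ofReal_mul hC₁.le, measure_univ, one_mul]
  calc H.crossingProb (fun u => scaleInv φ u * g u) t x
      ≤ H.P (x : OnePoint M) (⋃ k, H.hitOn (Q k) (Metric.ball x (R k))) := measure_mono hsub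
    _ ≤ ∑' k, H.P (x : OnePoint M) (H.hitOn (Q k) (Metric.ball x (R k))) := measure_iUnion_le _
    _ ≤ ∑' k, ENNReal.ofReal C₁ * ENNReal.ofReal |Real.log (g (τ k))|⁻¹ :=
        ENNReal.tsum_le_tsum hpiece
    _ = ENNReal.ofReal C₁ * logSum g κ t := ENNReal.tsum_mul_left

theorem BallEstimate.exists_crossingProb_lower (hB : H.BallEstimate N φ c C)
    (hφ : IsScaleFunction φ) (hgpos : ∀ t, 0 < t → 0 < g t) (hganti : AntitoneOn g (Ioi 0))
    (hglim : Tendsto g atTop (𝓝 0)) (hgint : logTail g 1 < ∞) (hκ : 1 < κ) (hT₀ : 1 ≤ T₀)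
    (hg : LogDoubling g κ T₀) :
    ∃ c₁ T₁ : ℝ, 0 < c₁ ∧ T₀ ≤ T₁ ∧ ∀ t : ℝ≥0, T₁ ≤ t → ∀ x : M, x ∉ N → H.Avoids N x →
      ENNReal.ofReal c₁ * logSum g κ t ≤
        H.crossingProb (fun u => scaleInv φ u * g u) t x := by
  have hκ0 : 0 < κ := by linarith
  have hκ' : 0 < κ - 1 := by linarith
  have hlogκ := Real.log_pos hκ
  set K : ℝ := 2 * (κ + 1) / (κ - 1) with hK
  obtain ⟨C₁, T₁, hC₁, hT₁, hW⟩ := hB.exists_window_upper hφ hgpos hglim hκ hT₀ hg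
    (K := K) (by rw [hK, one_lt_div hκ']; linarith)
  obtain ⟨c₂, T₂, hc₂, hT₂, hlow⟩ := hB.exists_window_lower hφ hgpos hglim hκ hT₀ hg
  have hlim : Tendsto (fun t => ENNReal.ofReal (C₁ * (2 / Real.log κ)) * logTail g t) atTop
      (𝓝 0) := by
    simpa using ENNReal.Tendsto.const_mul (tendsto_logTail hgint)
      (Or.inr (ENNReal.ofReal_ne_top (r := C₁ * (2 / Real.log κ))))
  obtain ⟨T₃, hT₃⟩ := (hlim.eventually_le_const
    (by simp : (0 : ℝ≥0∞) < 1 / 2)).exists_forall_of_atTop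
  refine ⟨c₂ / 2, max T₁ (max T₂ T₃), by positivity, hT₁.trans (le_max_left _ _),
    fun t ht x hx hxN => ?_⟩
  have htT₁ : T₁ ≤ t := (le_max_left _ _).trans ht
  have htT₂ : T₂ ≤ t := ((le_max_left _ _).trans (le_max_right _ _)).trans ht
  have htT₃ : T₃ ≤ t := ((le_max_right _ _).trans (le_max_right _ _)).trans ht
  have ht0 : (0 : ℝ) < t := by linarith
  have htk : ∀ k : ℕ, (t : ℝ) ≤ t * κ ^ k := fun k => le_mul_pow_of_one_lt hκ ht0 k
  set τ : ℕ → ℝ := fun k => t * κ ^ k with hτ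
  have hτ0 : ∀ k, 0 < τ k := fun k => ht0.trans_le (htk k)
  have hτlt : ∀ k j, k < j → κ * τ k ≤ τ j := fun k j h => by
    have := pow_le_pow_right₀ hκ.le (Nat.succ_le_of_lt h)
    have e : κ * τ k = t * κ ^ (k + 1) := by rw [hτ, pow_succ]; ring
    rw [e]; simp only [hτ]; gcongr
  choose F hF hFlow using fun k => hlow (τ k) (htT₂.trans (htk k))
  set r : ℕ → ℝ := fun k => scaleInv φ (τ k) * g (κ * τ k) with hr
  have hκτ : ∀ k, τ k ≤ κ * τ k := fun k => by nlinarith [hτ0 k]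
  have hρ : ∀ k, 0 < scaleInv φ (τ k) := fun k => hφ.scaleInv_pos (hτ0 k)
  have hgκ : ∀ k, 0 < g (κ * τ k) := fun k => hgpos _ ((hτ0 k).trans_le (hκτ k))
  have hr0 : ∀ k, 0 < r k := fun k => mul_pos (hρ k) (hgκ k)
  set A : ℕ → Set Ω := fun k => H.hitOn (F k) (Metric.ball x (r k)) with hA
  have hAm : ∀ k, MeasurableSet (A k) := fun k =>
    H.measurableSet_hitOn (F k).countable_toSet Metric.isOpen_ball.measurableSet
  have hAF : ∀ k, MeasurableSet[H.filtration (κ * τ k).toNNReal] (A k) := fun k =>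
    H.measurableSet_filtration_hitOn (F k).countable_toSet Metric.isOpen_ball.measurableSet
      fun s hs => by
        have := (hF k s hs).2
        exact NNReal.le_toNNReal_of_coe_le this
  set η : ℕ → ℝ≥0∞ := fun j => ENNReal.ofReal (C₁ * |Real.log (g (τ j))|⁻¹) with hη
  have hηsum : ∑' j, η j ≤ 1 / 2 := by
    have e : ∑' j, η j = ENNReal.ofReal C₁ * logSum g κ t := by
      simp only [hη, ENNReal.ofReal_mul hC₁.le]
      exact ENNReal.tsum_mul_left
    refine le_trans ?_ (hT₃ t htT₃)
    rw [e, ENNReal.ofReal_mul hC₁.le, mul_assoc]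
    gcongr
    have := (logTail_bounds hT₀ hκ hg (hT₁.trans htT₁)).1
    calc logSum g κ t = ENNReal.ofReal (2 / Real.log κ) *
          (ENNReal.ofReal (Real.log κ / 2) * logSum g κ t) := by
          rw [← mul_assoc, ← ENNReal.ofReal_mul (by positivity)]
          have : 2 / Real.log κ * (Real.log κ / 2) = 1 := by field_simp
          rw [this]; simp
      _ ≤ _ := by gcongr
  have hpair : ∀ k j, k < j → H.P (x : OnePoint M) (A k ∩ A j) ≤
      H.P (x : OnePoint M) (A k) * η j := by
    intro k j hkj
    have h1 := hτlt k j hkj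
    have h2 := hτ0 j
    have h3 : 0 < κ * τ k := mul_pos hκ0 (hτ0 k)
    have hcoe : ((κ * τ k).toNNReal : ℝ) = κ * τ k := Real.coe_toNNReal _ h3.le
    have ha : (κ - 1) / 2 * τ j ≤ (1 + κ) / 2 * τ j - κ * τ k := by linarith
    have hpos : 0 < (κ - 1) / 2 * τ j := by positivity
    refine hW (τ j) (htT₁.trans (htk j)) (r j) (hr0 j) ?_ x hxN _ _ (hAF k) x
      ((1 + κ) / 2 * τ j - κ * τ k) (κ * τ j - κ * τ k) (hpos.trans_le ha) ?_ ?_ (F j) ?_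
    · have hm1 : scaleInv φ (τ j) ≤ scaleInv φ (κ * τ j) := hφ.scaleInv_mono (hκτ j)
      have hm2 : g (κ * τ j) ≤ g (τ j) := hganti h2 (h2.trans_le (hκτ j)) (hκτ j)
      have hm3 : r j ≤ scaleInv φ (κ * τ j) * g (τ j) :=
        mul_le_mul hm1 hm2 (hgκ j).le ((hρ j).le.trans hm1)
      have := hr0 j
      linarith
    · have : (1 + κ) / 2 * τ j ≤ κ * τ j := by gcongr; linarith
      linarith
    · calc (κ * τ j - κ * τ k + τ j) / ((1 + κ) / 2 * τ j - κ * τ k)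
          ≤ ((κ + 1) * τ j) / ((κ - 1) / 2 * τ j) :=
            div_le_div₀ (by positivity) (by linarith) hpos ha
        _ = K := by rw [hK]; field_simp
    · intro s hs
      rw [hcoe]
      have := hF j s hs
      exact ⟨by linarith [this.1], by linarith [this.2]⟩
  have hBC := tsum_measure_le_two_mul_measure_iUnion (H.P (x : OnePoint M)) A hAm η hpair hηsum
  have hsub : ⋃ k, A k ⊆ {ω | ∃ u : ℝ≥0, t < u ∧ ∃ y : M, H.X u ω = (y : OnePoint M) ∧
      dist y x ≤ scaleInv φ u * g u} := by
    refine iUnion_subset fun k ω hω => ?_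
    obtain ⟨s, hs, y, hy, hX⟩ := H.mem_hitOn.1 hω
    obtain ⟨h1, h2⟩ := hF k s hs
    have hτk := hτ0 k
    have hτs : τ k < s := by nlinarith
    refine ⟨s, NNReal.coe_lt_coe.1 ((htk k).trans_lt hτs), y, hX, ?_⟩
    refine (Metric.mem_ball.1 hy).le.trans ?_
    have hs0 : (0 : ℝ) < s := hτk.trans hτs
    exact mul_le_mul (hφ.scaleInv_mono hτs.le)
      (hganti hs0 (hτk.trans_le (hκτ k)) h2) (hgκ k).le (hφ.scaleInv_pos hs0).le
  have hsumlow : ENNReal.ofReal c₂ * logSum g κ t ≤ ∑' k, H.P (x : OnePoint M) (A k) := by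
    rw [logSum, ← ENNReal.tsum_mul_left]
    refine ENNReal.tsum_le_tsum fun k => ?_
    rw [← ENNReal.ofReal_mul hc₂.le]
    exact hFlow k x hx hxN
  rw [ENNReal.ofReal_div_of_pos two_pos, ENNReal.mul_div_right_comm.symm]
  refine ENNReal.div_le_of_le_mul ?_
  rw [mul_comm (H.crossingProb _ _ _)]
  simp only [ENNReal.ofReal_ofNat]
  refine hsumlow.trans (hBC.trans ?_)
  gcongr
  exact measure_mono hsub

/-- The two-sided estimate of the bottom crossing probability at the points outside `N`. -/
theorem BallEstimate.crossingProb_bounds (hB : H.BallEstimate N φ c C)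
    (hφ : IsScaleFunction φ) (hgpos : ∀ t, 0 < t → 0 < g t) (hganti : AntitoneOn g (Ioi 0))
    (hglim : Tendsto g atTop (𝓝 0)) (hgint : logTail g 1 < ∞) (hgreg : LogRegular g)
    {x : M} (hx : x ∉ N) (hxN : H.Avoids N x) :
    ∃ T c₁ c₂ : ℝ≥0, 0 < T ∧ 0 < c₁ ∧ 0 < c₂ ∧ ∀ t : ℝ≥0, T ≤ t →
      c₁ * logTail g t ≤ H.crossingProb (fun u => scaleInv φ u * g u) t x ∧
      H.crossingProb (fun u => scaleInv φ u * g u) t x ≤ c₂ * logTail g t := by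
  obtain ⟨κ, T₀, hκ, hT₀, hg⟩ := hgreg.exists_logDoubling hgpos hganti hglim
  have hlogκ := Real.log_pos hκ
  obtain ⟨C₁, T₁, hC₁, hT₁, hup⟩ :=
    hB.exists_crossingProb_upper hφ hgpos hganti hglim hκ hT₀ hg
  obtain ⟨c₂, T₂, hc₂, hT₂, hlow⟩ :=
    hB.exists_crossingProb_lower hφ hgpos hganti hglim hgint hκ hT₀ hg
  refine ⟨(max T₁ T₂).toNNReal, (c₂ / Real.log κ).toNNReal, (C₁ * (2 / Real.log κ)).toNNReal,
    ?_, ?_, ?_, fun t ht => ?_⟩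
  · rw [Real.toNNReal_pos]; exact lt_max_of_lt_left (by linarith)
  · rw [Real.toNNReal_pos]; positivity
  · rw [Real.toNNReal_pos]; positivity
  · rw [Real.toNNReal_le_iff_le_coe, max_le_iff] at ht
    obtain ⟨hb₁, hb₂⟩ := logTail_bounds hT₀ hκ hg (hT₁.trans ht.1)
    constructor
    · refine le_trans ?_ (hlow t ht.2 x hx hxN)
      change ENNReal.ofReal _ * _ ≤ _
      calc ENNReal.ofReal (c₂ / Real.log κ) * logTail g t
          ≤ ENNReal.ofReal (c₂ / Real.log κ) * (ENNReal.ofReal (Real.log κ) * logSum g κ t) := by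
            gcongr
        _ = ENNReal.ofReal c₂ * logSum g κ t := by
            rw [← mul_assoc, ← ENNReal.ofReal_mul (by positivity), div_mul_cancel₀ _ hlogκ.ne']
    · refine (hup t ht.1 x hxN).trans ?_
      change _ ≤ ENNReal.ofReal _ * _
      calc ENNReal.ofReal C₁ * logSum g κ t
          = ENNReal.ofReal (C₁ * (2 / Real.log κ)) *
            (ENNReal.ofReal (Real.log κ / 2) * logSum g κ t) := by
            rw [← mul_assoc, ← ENNReal.ofReal_mul (by positivity)]
            congr 2; field_simp
        _ ≤ _ := by gcongr

end Crossing

end HuntProcess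

namespace HuntProcess

section Semigroup

variable {M : Type*} [TopologicalSpace M] {Ω : Type*} [MeasurableSpace Ω] (H : HuntProcess M Ω)

/-- The transition semigroup on the nonnegative functions on `M ∪ {Δ}`. -/
noncomputable def semigroup (t : ℝ≥0) (f : OnePoint M → ℝ≥0∞) (z : OnePoint M) : ℝ≥0∞ :=
  ∫⁻ ω, f (H.X t ω) ∂(H.P z)

theorem measurable_semigroup (t : ℝ≥0) {f : OnePoint M → ℝ≥0∞} (hf : Measurable f) :
    Measurable (H.semigroup t f) :=
  (hf.comp (H.measurable_X t)).lintegral_kernel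

theorem semigroup_zero {f : OnePoint M → ℝ≥0∞} : H.semigroup 0 f = f := by
  ext z
  rw [semigroup, lintegral_congr_ae ((H.start z).mono fun ω hω => congrArg f hω)]
  simp

theorem semigroup_add (s t : ℝ≥0) {f : OnePoint M → ℝ≥0∞} (hf : Measurable f) :
    H.semigroup (s + t) f = H.semigroup s (H.semigroup t f) := by
  ext z
  have h := H.markov_lintegral s t MeasurableSet.univ z hf
  rw [Measure.restrict_univ] at h
  exact h

theorem semigroup_infty (t : ℝ≥0) {f : OnePoint M → ℝ≥0∞} (hf : f OnePoint.infty = 0) :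
    H.semigroup t f OnePoint.infty = 0 := by
  rw [semigroup, lintegral_congr_ae (g := fun _ => 0)]
  · simp
  · filter_upwards [H.start OnePoint.infty] with ω hω
    rw [H.absorbing ω 0 t zero_le hω, hf]

theorem semigroup_le_of_le (t : ℝ≥0) {f : OnePoint M → ℝ≥0∞} {b : ℝ≥0∞} (hf : ∀ z, f z ≤ b)
    (z : OnePoint M) : H.semigroup t f z ≤ b := by
  calc H.semigroup t f z ≤ ∫⁻ _, b ∂(H.P z) := lintegral_mono fun ω => hf _
    _ = b := by simp

variable [MeasurableSpace M] [BorelSpace M]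

theorem measurable_coe : Measurable fun x : M => (x : OnePoint M) :=
  measurableEmbedding_coe.measurable

theorem semigroup_indicator (t : ℝ≥0) {D : Set M} (hD : MeasurableSet D) (z : OnePoint M) :
    H.semigroup t (((fun x : M => (x : OnePoint M)) '' D).indicator 1) z =
      H.P z (H.inSet t D) := by
  have hD' := measurableEmbedding_coe.measurableSet_image.2 hD
  rw [inSet_eq_preimage, ← lintegral_indicator_one (H.measurable_X t hD')]
  rfl

/-- Symmetry of the semigroup with respect to `m`, as a measure on `M ∪ {Δ}`. -/
theorem IsGeneratedBy.lintegral_mul_semigroup {m : Measure M} {E : DirichletForm m}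
    (hH : H.IsGeneratedBy E) (t : ℝ≥0) {f g : OnePoint M → ℝ≥0∞} (hf : Measurable f)
    (hg : Measurable g) (hf0 : f OnePoint.infty = 0) (hg0 : g OnePoint.infty = 0) :
    ∫⁻ z, f z * H.semigroup t g z ∂(m.map fun x : M => (x : OnePoint M)) =
      ∫⁻ z, g z * H.semigroup t f z ∂(m.map fun x : M => (x : OnePoint M)) := by
  set ι : M → OnePoint M := fun x => (x : OnePoint M) with hι
  have hιm : Measurable ι := measurable_coe
  have hR : MeasurableSet (range ι) := measurableEmbedding_coe.measurableSet_range
  have hsub : ∀ B : Set (OnePoint M), B ∩ range ι = ι '' (ι ⁻¹' B) := fun B => by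
    rw [image_preimage_eq_inter_range]
  have hres : ∀ {h : OnePoint M → ℝ≥0∞} (ν : Measure (OnePoint M)), h OnePoint.infty = 0 →
      ∫⁻ z, h z ∂ν = ∫⁻ z, h z ∂(ν.restrict (range ι)) := by
    intro h ν h0
    rw [← lintegral_indicator hR]
    refine lintegral_congr fun z => ?_
    by_cases hz : z ∈ range ι
    · rw [indicator_of_mem hz]
    · rw [indicator_of_notMem hz, OnePoint.notMem_range_coe_iff.1 hz, h0]
  have hbase : ∀ A B : Set M, MeasurableSet A → MeasurableSet B →
      ∫⁻ z in ι '' A, H.P z (H.inSet t B) ∂(m.map ι) =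
        ∫⁻ z in ι '' B, H.P z (H.inSet t A) ∂(m.map ι) := by
    intro A B hA hB
    have h1 : ∀ A B : Set M, MeasurableSet A → MeasurableSet B →
        ∫⁻ z in ι '' A, H.P z (H.inSet t B) ∂(m.map ι) =
          ∫⁻ x in A, H.P (ι x) (H.inSet t B) ∂m := fun A B hA hB => by
      rw [setLIntegral_map (measurableEmbedding_coe.measurableSet_image.2 hA)
        (Kernel.measurable_coe _ (H.measurableSet_inSet t hB)) hιm,
        preimage_image_eq _ OnePoint.coe_injective]
    rw [h1 A B hA hB, h1 B A hB hA]
    exact hH.symmetric t A B hA hB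
  have hstep1 : ∀ B : Set M, MeasurableSet B → ∀ {f : OnePoint M → ℝ≥0∞}, Measurable f →
      f OnePoint.infty = 0 → ∫⁻ z, f z * H.P z (H.inSet t B) ∂(m.map ι) =
        ∫⁻ z in ι '' B, H.semigroup t f z ∂(m.map ι) := by
    intro B hB f hf hf0
    set ν₁ := (m.map ι).withDensity fun z => H.P z (H.inSet t B) with hν₁
    set ν₂ := ((m.map ι).restrict (ι '' B)).bind (H.P.map (H.X t)) with hν₂
    have hmP : Measurable fun z => H.P z (H.inSet t B) :=
      Kernel.measurable_coe _ (H.measurableSet_inSet t hB)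
    have hν : ν₁.restrict (range ι) = ν₂.restrict (range ι) := by
      ext A hA
      rw [Measure.restrict_apply hA, Measure.restrict_apply hA, hsub]
      have hA' : MeasurableSet (ι ⁻¹' A) := hιm hA
      have hA'' := measurableEmbedding_coe.measurableSet_image.2 hA'
      rw [hν₁, withDensity_apply _ hA'', hbase _ _ hA' hB, hν₂,
        Measure.bind_apply hA'' (Kernel.aemeasurable _)]
      refine lintegral_congr fun z => ?_
      rw [Kernel.map_apply' _ (H.measurable_X t) _ hA'', inSet_eq_preimage]
    have e₁ : ∫⁻ z, f z * H.P z (H.inSet t B) ∂(m.map ι) = ∫⁻ z, f z ∂ν₁ := by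
      rw [hν₁, lintegral_withDensity_eq_lintegral_mul _ hmP hf]
      exact lintegral_congr fun z => mul_comm _ _
    have e₂ : ∫⁻ z in ι '' B, H.semigroup t f z ∂(m.map ι) = ∫⁻ z, f z ∂ν₂ := by
      rw [hν₂, Measure.lintegral_bind (Kernel.aemeasurable _) hf.aemeasurable]
      refine lintegral_congr fun z => ?_
      rw [Kernel.map_apply _ (H.measurable_X t), lintegral_map hf (H.measurable_X t), semigroup]
    rw [e₁, e₂, hres ν₁ hf0, hν, ← hres ν₂ hf0]
  set ν₁ := (m.map ι).withDensity (H.semigroup t f) with hν₁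
  set ν₂ := ((m.map ι).withDensity f).bind (H.P.map (H.X t)) with hν₂
  have hmf := H.measurable_semigroup t hf
  have hν : ν₁.restrict (range ι) = ν₂.restrict (range ι) := by
    ext B hB
    rw [Measure.restrict_apply hB, Measure.restrict_apply hB, hsub]
    have hB' : MeasurableSet (ι ⁻¹' B) := hιm hB
    have hB'' := measurableEmbedding_coe.measurableSet_image.2 hB'
    rw [hν₁, withDensity_apply _ hB'', ← hstep1 _ hB' hf hf0, hν₂,
      Measure.bind_apply hB'' (Kernel.aemeasurable _),
      lintegral_withDensity_eq_lintegral_mul _ hf (Kernel.measurable_coe _ hB'')]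
    refine lintegral_congr fun z => ?_
    rw [Pi.mul_apply, Kernel.map_apply' _ (H.measurable_X t) _ hB'', inSet_eq_preimage]
  have e₁ : ∫⁻ z, g z * H.semigroup t f z ∂(m.map ι) = ∫⁻ z, g z ∂ν₁ := by
    rw [hν₁, lintegral_withDensity_eq_lintegral_mul _ hmf hg]
    exact lintegral_congr fun z => mul_comm _ _
  have e₂ : ∫⁻ z, f z * H.semigroup t g z ∂(m.map ι) = ∫⁻ z, g z ∂ν₂ := by
    rw [hν₂, Measure.lintegral_bind (Kernel.aemeasurable _) hg.aemeasurable,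
      lintegral_withDensity_eq_lintegral_mul _ hf hg.lintegral_kernel]
    refine lintegral_congr fun z => ?_
    rw [Pi.mul_apply, Kernel.map_apply _ (H.measurable_X t), lintegral_map hg (H.measurable_X t),
      semigroup]
  rw [e₁, e₂, hres ν₁ hg0, hν, ← hres ν₂ hg0]

end Semigroup

section DiscountedVisit

variable {M : Type*}

/-- `sup {e^{-q} | w(q) ∈ G}` for a path `w`, over a countable dense set of times. -/
noncomputable def discountedVisit (G : Set M) (w : ℝ≥0 → OnePoint M) : ℝ≥0∞ :=
  ⨆ q ∈ denseTimes, ((fun x : M => (x : OnePoint M)) '' G).indicator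
    (fun _ => ENNReal.ofReal (Real.exp (-(q : ℝ)))) (w q)

theorem discountedVisit_le_one (G : Set M) (w : ℝ≥0 → OnePoint M) : discountedVisit G w ≤ 1 := by
  refine iSup₂_le fun q _ => indicator_apply_le' (fun _ => ?_) fun _ => zero_le
  rw [← ENNReal.ofReal_one]
  exact ENNReal.ofReal_le_ofReal (Real.exp_le_one_iff.2 (by simp))

theorem discountedVisit_mono {G G' : Set M} (h : G ⊆ G') (w : ℝ≥0 → OnePoint M) :
    discountedVisit G w ≤ discountedVisit G' w :=
  iSup₂_mono fun _ _ => indicator_le_indicator_of_subset (image_mono h) (fun _ => zero_le) _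

end DiscountedVisit

section Excessive

variable {M : Type*} [TopologicalSpace M] {Ω : Type*} [MeasurableSpace Ω] (H : HuntProcess M Ω)

/-- `E_z[e^{-σ}]`, where `σ` is the hitting time of the open set `G`. -/
noncomputable def hittingPotential (G : Set M) (z : OnePoint M) : ℝ≥0∞ :=
  ∫⁻ ω, discountedVisit G (H.path ω) ∂(H.P z)

theorem hittingPotential_le_one (G : Set M) (z : OnePoint M) : H.hittingPotential G z ≤ 1 := by
  calc H.hittingPotential G z ≤ ∫⁻ _, 1 ∂(H.P z) :=
        lintegral_mono fun ω => discountedVisit_le_one _ _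
    _ = 1 := by simp

theorem hittingPotential_mono {G G' : Set M} (h : G ⊆ G') (z : OnePoint M) :
    H.hittingPotential G z ≤ H.hittingPotential G' z :=
  lintegral_mono fun _ => discountedVisit_mono h _

theorem exp_le_discountedVisit {G : Set M} (hG : IsOpen G) {u : ℝ≥0} {ω : Ω}
    (h : ω ∈ H.inSet u G) :
    ENNReal.ofReal (Real.exp (-(u : ℝ))) ≤ discountedVisit G (H.path ω) := by
  have hlim : Tendsto (fun v : ℝ≥0 => ENNReal.ofReal (Real.exp (-(v : ℝ)))) (𝓝[>] u)
      (𝓝 (ENNReal.ofReal (Real.exp (-(u : ℝ))))) := by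
    refine Tendsto.mono_left ?_ nhdsWithin_le_nhds
    exact (ENNReal.continuous_ofReal.comp (by fun_prop : Continuous fun v : ℝ≥0 =>
      Real.exp (-(v : ℝ)))).tendsto u
  refine le_of_tendsto hlim ?_
  filter_upwards [self_mem_nhdsWithin] with v hv
  obtain ⟨q, hq, -, hqv, hω⟩ := H.exists_denseTimes_inSet hG hv h
  refine le_iSup₂_of_le q hq ?_
  rw [inSet_eq_preimage] at hω
  rw [indicator_of_mem (show H.path ω q ∈ (fun x : M => (x : OnePoint M)) '' G from hω)]
  exact ENNReal.ofReal_le_ofReal (Real.exp_le_exp.2 (by simpa using hqv.le))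

theorem one_le_hittingPotential {G : Set M} (hG : IsOpen G) {x : M} (hx : x ∈ G) :
    1 ≤ H.hittingPotential G (x : OnePoint M) := by
  calc (1 : ℝ≥0∞) = ∫⁻ _, 1 ∂(H.P (x : OnePoint M)) := by simp
    _ ≤ _ := by
      refine lintegral_mono_ae ?_
      filter_upwards [H.start x] with ω hω
      simpa using H.exp_le_discountedVisit hG (u := 0) (ω := ω) ⟨x, hx, hω⟩

theorem exp_mul_discountedVisit_shift_le {G : Set M} (hG : IsOpen G) (s : ℝ≥0) (ω : Ω) :
    ENNReal.ofReal (Real.exp (-(s : ℝ))) * discountedVisit G (fun r => H.X (s + r) ω) ≤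
      discountedVisit G (H.path ω) := by
  rw [discountedVisit, ENNReal.mul_iSup]
  refine iSup_le fun q => ?_
  rw [ENNReal.mul_iSup]
  refine iSup_le fun _ => ?_
  by_cases h : H.X (s + q) ω ∈ (fun x : M => (x : OnePoint M)) '' G
  · rw [indicator_of_mem h, ← ENNReal.ofReal_mul (Real.exp_pos _).le, ← Real.exp_add]
    have h' : ω ∈ H.inSet (s + q) G := by rwa [inSet_eq_preimage]
    refine le_trans (le_of_eq ?_) (H.exp_le_discountedVisit hG h')
    congr 2; push_cast; ring
  · rw [indicator_of_notMem h, mul_zero]; exact zero_le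

theorem hittingPotential_infty (G : Set M) : H.hittingPotential G OnePoint.infty = 0 := by
  rw [hittingPotential, lintegral_congr_ae (g := fun _ => 0)]
  · simp
  · filter_upwards [H.start OnePoint.infty] with ω hω
    have : ∀ q, H.path ω q = OnePoint.infty := fun q => H.absorbing ω 0 q zero_le hω
    simp [discountedVisit, this]

variable [MeasurableSpace M] [BorelSpace M]

theorem measurable_discountedVisit {G : Set M} (hG : MeasurableSet G) :
    Measurable (discountedVisit G) :=
  Measurable.biSup _ countable_denseTimes fun q _ =>
    (measurable_const.indicator (measurableEmbedding_coe.measurableSet_image.2 hG)).comp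
      (measurable_pi_apply q)

theorem measurable_hittingPotential {G : Set M} (hG : MeasurableSet G) :
    Measurable (H.hittingPotential G) :=
  ((measurable_discountedVisit hG).comp H.measurable_path).lintegral_kernel

/-- The hitting potential is `1`-excessive. -/
theorem exp_mul_semigroup_hittingPotential_le {G : Set M} (hG : IsOpen G) (s : ℝ≥0)
    (z : OnePoint M) :
    ENNReal.ofReal (Real.exp (-(s : ℝ))) * H.semigroup s (H.hittingPotential G) z ≤
      H.hittingPotential G z := by
  have h := H.markov_path s z (measurable_discountedVisit hG.measurableSet)
  have e : H.semigroup s (H.hittingPotential G) z =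
      ∫⁻ ω, discountedVisit G (fun r => H.X (s + r) ω) ∂(H.P z) := h.symm
  have hm : Measurable fun ω => discountedVisit G (fun r => H.X (s + r) ω) :=
    (measurable_discountedVisit hG.measurableSet).comp (H.measurable_shifted_path s)
  rw [e, ← lintegral_const_mul _ hm]
  exact lintegral_mono fun ω => H.exp_mul_discountedVisit_shift_le hG s ω

end Excessive

end HuntProcess

theorem exp_neg_le_tsum_indicator {a : ℝ} (ha : 0 < a) (q : ℝ≥0) {t : ℝ≥0} (ht : 0 < t)
    (hta : (t : ℝ) ≤ a / 2) :
    ENNReal.ofReal (Real.exp (-(q : ℝ))) * ENNReal.ofReal (Real.exp (-(2 * a)) * (a / 2)) ≤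
      ∑' k : ℕ, ENNReal.ofReal (t * Real.exp (-((k + 1) * t))) *
        (Icc a (2 * a)).indicator 1 (((k + 1) * t - q : ℝ)) := by
  have ht' : (0 : ℝ) < t := ht
  set j : ℕ := ⌊(q + a) / t⌋₊ with hj
  set n : ℕ := ⌊a / t⌋₊ with hn
  have hj1 : (j : ℝ) * t ≤ q + a := (le_div_iff₀ ht').1 (Nat.floor_le (by positivity))
  have hj2 : (q : ℝ) + a < (j + 1) * t := (div_lt_iff₀ ht').1 (Nat.lt_floor_add_one _)
  have hn1 : (n : ℝ) * t ≤ a := (le_div_iff₀ ht').1 (Nat.floor_le (by positivity))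
  have hn2 : a < (n + 1) * t := (div_lt_iff₀ ht').1 (Nat.lt_floor_add_one _)
  refine le_trans ?_ (ENNReal.sum_le_tsum (Finset.Ico j (j + n)))
  calc ENNReal.ofReal (Real.exp (-(q : ℝ))) * ENNReal.ofReal (Real.exp (-(2 * a)) * (a / 2))
      ≤ ENNReal.ofReal (n * (t * Real.exp (-(q + 2 * a)))) := by
        rw [← ENNReal.ofReal_mul (Real.exp_pos _).le]
        refine ENNReal.ofReal_le_ofReal ?_
        have e : Real.exp (-(q : ℝ)) * (Real.exp (-(2 * a)) * (a / 2)) =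
            Real.exp (-(q + 2 * a)) * (a / 2) := by
          rw [← mul_assoc, ← Real.exp_add]; congr 2; ring
        rw [e]
        have : a / 2 ≤ n * t := by linarith
        nlinarith [Real.exp_pos (-((q : ℝ) + 2 * a))]
    _ = ∑ k ∈ Finset.Ico j (j + n), ENNReal.ofReal (t * Real.exp (-(q + 2 * a))) := by
        rw [Finset.sum_const, Nat.card_Ico, Nat.add_sub_cancel_left, nsmul_eq_mul,
          ← ENNReal.ofReal_natCast, ← ENNReal.ofReal_mul (by positivity)]
    _ ≤ _ := by
        refine Finset.sum_le_sum fun k hk => ?_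
        obtain ⟨hk1, hk2⟩ := Finset.mem_Ico.1 hk
        have hk1' : (j : ℝ) ≤ k := by exact_mod_cast hk1
        have hk2' : (k : ℝ) + 1 ≤ j + n := by exact_mod_cast hk2
        have h1 : ((j : ℝ) + 1) * t ≤ (k + 1) * t := by gcongr
        have h2 : ((k : ℝ) + 1) * t ≤ (j + n) * t := by gcongr
        have hmem : ((k : ℝ) + 1) * t - q ∈ Icc a (2 * a) := ⟨by linarith, by linarith⟩
        rw [indicator_of_mem hmem, Pi.one_apply, mul_one]
        refine ENNReal.ofReal_le_ofReal ?_
        gcongr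
        linarith [hmem.2]

theorem tsum_ofReal_exp_lt_top {t : ℝ≥0} (ht : 0 < t) :
    ∑' k : ℕ, ENNReal.ofReal (t * Real.exp (-((k + 1) * t))) < ∞ := by
  have h : Summable fun k : ℕ => (t : ℝ) * Real.exp (-((k + 1) * t)) := by
    have h1 : Real.exp (-(t : ℝ)) < 1 := by
      rw [← Real.exp_zero]; exact Real.exp_lt_exp.2 (by simpa using ht)
    have h2 := (summable_geometric_of_lt_one (Real.exp_pos _).le h1).mul_left
      ((t : ℝ) * Real.exp (-(t : ℝ)))
    refine h2.congr fun k => ?_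
    rw [← Real.exp_nat_mul, mul_assoc, ← Real.exp_add]
    congr 2; ring
  rw [← ENNReal.ofReal_tsum_of_nonneg (fun k => by positivity) h]
  exact ENNReal.ofReal_lt_top

namespace HuntProcess

section Domination

variable {M : Type*} [TopologicalSpace M] [MeasurableSpace M] [BorelSpace M]
  {Ω : Type*} [MeasurableSpace Ω] (H : HuntProcess M Ω)

theorem lintegral_biSup_le_sum_firstHit (F : Finset ℝ≥0) {G : Set M} (hG : MeasurableSet G)
    (x : OnePoint M) :
    ∫⁻ ω, ⨆ q ∈ F, ((fun x : M => (x : OnePoint M)) '' G).indicator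
        (fun _ => ENNReal.ofReal (Real.exp (-(q : ℝ)))) (H.path ω q) ∂(H.P x) ≤
      ∑ q ∈ F, H.P x (H.firstHit F G q) * ENNReal.ofReal (Real.exp (-(q : ℝ))) := by
  have hm : ∀ q, MeasurableSet (H.firstHit F G q) := fun q =>
    H.filtration.le q _ (H.measurableSet_filtration_firstHit F hG q)
  calc _ ≤ ∫⁻ ω, ∑ q ∈ F, (H.firstHit F G q).indicator
        (fun _ => ENNReal.ofReal (Real.exp (-(q : ℝ)))) ω ∂(H.P x) := by
        refine lintegral_mono fun ω => iSup₂_le fun q hq => ?_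
        by_cases h : H.path ω q ∈ (fun x : M => (x : OnePoint M)) '' G
        · rw [indicator_of_mem h]
          have h' : ω ∈ H.hitOn F G := H.mem_hitOn.2 ⟨q, hq, by rwa [inSet_eq_preimage]⟩
          rw [hitOn_eq_iUnion_firstHit] at h'
          obtain ⟨r, hr, hω⟩ := mem_iUnion₂.1 h'
          have hrq : r ≤ q := not_lt.1 fun hlt => hω.2 q hq hlt (by rwa [inSet_eq_preimage])
          refine le_trans ?_ (Finset.single_le_sum
            (f := fun q => (H.firstHit F G q).indicator
              (fun _ => ENNReal.ofReal (Real.exp (-(q : ℝ)))) ω) (fun _ _ => zero_le) hr)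
          simp only [indicator_of_mem hω]
          exact ENNReal.ofReal_le_ofReal (Real.exp_le_exp.2 (by simpa using hrq))
        · rw [indicator_of_notMem h]; exact zero_le
    _ = _ := by
        rw [lintegral_finsetSum _ fun q _ => measurable_const.indicator (hm q)]
        refine Finset.sum_congr rfl fun q _ => ?_
        rw [lintegral_indicator_const (hm q), mul_comm]

/-- The hitting potential of `G` is dominated by a discretized `1`-potential of `D` if `D` is
reached from `G` with a probability bounded from below. -/
theorem hittingPotential_mul_le {N : Set M} {x : OnePoint M} (hx : H.Avoids N x) {G D : Set M}
    (hG : MeasurableSet G) (hD : MeasurableSet D) {b a : ℝ} (ha : 0 < a)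
    (hβ : ∀ z ∈ G, z ∉ N → ∀ v : ℝ≥0, a ≤ v → v ≤ 2 * a →
      ENNReal.ofReal b ≤ H.P (z : OnePoint M) (H.inSet v D))
    {t : ℝ≥0} (ht : 0 < t) (hta : (t : ℝ) ≤ a / 2) :
    H.hittingPotential G x *
        (ENNReal.ofReal (Real.exp (-(2 * a)) * (a / 2)) * ENNReal.ofReal b) ≤
      ∑' k : ℕ, ENNReal.ofReal (t * Real.exp (-((k + 1) * t))) *
        H.P x (H.inSet ((k + 1) * t) D) := by
  set w : ℕ → ℝ≥0∞ := fun k => ENNReal.ofReal (t * Real.exp (-((k + 1) * t))) with hw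
  set A := ENNReal.ofReal (Real.exp (-(2 * a)) * (a / 2)) with hA
  set χ : ℝ → ℝ≥0∞ := (Icc a (2 * a)).indicator 1 with hχ
  have hfin : ∀ F : Finset ℝ≥0,
      (∑ q ∈ F, H.P x (H.firstHit F G q) * ENNReal.ofReal (Real.exp (-(q : ℝ)))) *
        (A * ENNReal.ofReal b) ≤ ∑' k : ℕ, w k * H.P x (H.inSet ((k + 1) * t) D) := by
    intro F
    have hk : ∀ k : ℕ, ∑ q ∈ F, H.P x (H.firstHit F G q) *
        (χ ((k + 1) * t - q) * ENNReal.ofReal b) ≤ H.P x (H.inSet ((k + 1) * t) D) := by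
      intro k
      have := H.sum_firstHit_mul_le (T := 0) (L := univ) MeasurableSet.univ hx hG hD F
        (fun _ _ => zero_le) (fun v => χ v * ENNReal.ofReal b) ?_ ?_ ((k + 1) * t)
      · simpa using this
      · intro v hv
        rw [hχ, indicator_of_notMem (fun h => by have := h.1; linarith), zero_mul]
      · intro v z hz hzN
        by_cases h : (v : ℝ) ∈ Icc a (2 * a)
        · rw [hχ, indicator_of_mem h, Pi.one_apply, one_mul]
          exact hβ z hz hzN v h.1 h.2
        · rw [hχ, indicator_of_notMem h, zero_mul]; exact zero_le
    calc _ = ∑ q ∈ F, H.P x (H.firstHit F G q) * ENNReal.ofReal b *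
          (ENNReal.ofReal (Real.exp (-(q : ℝ))) * A) := by
          rw [Finset.sum_mul]
          exact Finset.sum_congr rfl fun q _ => by ring
      _ ≤ ∑ q ∈ F, H.P x (H.firstHit F G q) * ENNReal.ofReal b *
          ∑' k : ℕ, w k * χ ((k + 1) * t - q) := by
          gcongr with q hq
          exact exp_neg_le_tsum_indicator ha q ht hta
      _ = ∑' k : ℕ, w k * ∑ q ∈ F, H.P x (H.firstHit F G q) *
          (χ ((k + 1) * t - q) * ENNReal.ofReal b) := by
          simp_rw [← ENNReal.tsum_mul_left, Finset.mul_sum]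
          rw [← Summable.tsum_finsetSum fun _ _ => ENNReal.summable]
          exact tsum_congr fun k => Finset.sum_congr rfl fun q _ => by ring
      _ ≤ _ := by
          gcongr with k
          exact hk k
  have hcount : Countable denseTimes := countable_denseTimes.to_subtype
  classical
  set f : ℝ≥0 → Ω → ℝ≥0∞ := fun q ω => ((fun x : M => (x : OnePoint M)) '' G).indicator
        (fun _ => ENNReal.ofReal (Real.exp (-(q : ℝ)))) (H.path ω q) with hf
  have hfm : ∀ q, Measurable (f q) := fun q =>
    (measurable_const.indicator (measurableEmbedding_coe.measurableSet_image.2 hG)).comp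
      (H.measurable_X q)
  have hsup : H.hittingPotential G x =
      ⨆ F : Finset denseTimes, ∫⁻ ω, ⨆ q ∈ F.image Subtype.val, f q ω ∂(H.P x) := by
    rw [← lintegral_iSup_directed]
    · refine lintegral_congr fun ω => ?_
      simp only [discountedVisit]
      rw [iSup_subtype', iSup_eq_iSup_finset]
      exact iSup_congr fun F => by rw [Finset.iSup_finset_image]
    · exact fun F => (Measurable.biSup _ (Finset.countable_toSet _) fun q _ => hfm q).aemeasurable
    · refine directed_of_isDirected_le fun F F' h ω => ?_
      exact biSup_mono fun q hq => Finset.image_subset_image h hq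
  rw [hsup, ENNReal.iSup_mul]
  refine iSup_le fun F => le_trans ?_ (hfin (F.image Subtype.val))
  gcongr
  exact H.lintegral_biSup_le_sum_firstHit _ hG x

end Domination

section Energy

variable {M : Type*} [TopologicalSpace M] [MeasurableSpace M] [BorelSpace M]
  {Ω : Type*} [MeasurableSpace Ω] (H : HuntProcess M Ω)

/-- The discretization with step `t` of the `1`-potential of the set `D`. -/
noncomputable def stepPotential (t : ℝ≥0) (D : Set M) (z : OnePoint M) : ℝ≥0∞ :=
  ∑' k : ℕ, ENNReal.ofReal (t * Real.exp (-((k + 1) * t))) * H.P z (H.inSet ((k + 1) * t) D)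

theorem lintegral_measure_inSet_le {m : Measure M} {E : DirichletForm m}
    (hH : H.IsGeneratedBy E) (s : ℝ≥0) {D : Set M} (hD : MeasurableSet D) :
    ∫⁻ z, H.P z (H.inSet s D) ∂(m.map fun x : M => (x : OnePoint M)) ≤ m D := by
  rw [lintegral_map (Kernel.measurable_coe _ (H.measurableSet_inSet s hD)) measurable_coe,
    ← setLIntegral_univ]
  refine (hH.symmetric s univ D MeasurableSet.univ hD).le.trans ?_
  calc _ ≤ ∫⁻ _ in D, 1 ∂m := lintegral_mono fun x => prob_le_one
    _ = m D := by simp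

theorem lintegral_stepPotential_lt_top {m : Measure M} {E : DirichletForm m}
    (hH : H.IsGeneratedBy E) {t : ℝ≥0} (ht : 0 < t) {D : Set M} (hD : MeasurableSet D)
    (hmD : m D < ∞) :
    ∫⁻ z, H.stepPotential t D z ∂(m.map fun x : M => (x : OnePoint M)) < ∞ := by
  simp only [stepPotential]
  have hm : ∀ s, Measurable fun z => H.P z (H.inSet s D) := fun s =>
    Kernel.measurable_coe _ (H.measurableSet_inSet s hD)
  rw [lintegral_tsum fun k => ((hm _).const_mul _).aemeasurable]
  simp_rw [fun k : ℕ => lintegral_const_mul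
    (μ := m.map fun x : M => (x : OnePoint M))
    (ENNReal.ofReal (t * Real.exp (-((k + 1) * t)))) (hm ((k + 1) * t))]
  calc _ ≤ ∑' k : ℕ, ENNReal.ofReal (t * Real.exp (-((k + 1) * t))) * m D := by
        gcongr; exact H.lintegral_measure_inSet_le hH _ hD
    _ < ∞ := by
        rw [ENNReal.tsum_mul_right]
        exact ENNReal.mul_lt_top (tsum_ofReal_exp_lt_top ht) hmD

/-- The approximating energy `∫ e (e - e^{-t} Q_t e) dm` of a `1`-excessive function `e` which is
dominated by a discretized potential. -/
theorem lintegral_mul_defect_le {m : Measure M} {E : DirichletForm m}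
    (hH : H.IsGeneratedBy E) {t : ℝ≥0} {D : Set M} (hD : MeasurableSet D)
    {e w : OnePoint M → ℝ≥0∞} (he : Measurable e) (hw : Measurable w)
    (he0 : e OnePoint.infty = 0)
    (hew : ∀ z, w z + ENNReal.ofReal (Real.exp (-(t : ℝ))) * H.semigroup t e z = e z)
    {b : ℝ≥0∞} (hb : ∀ᵐ z ∂(m.map fun x : M => (x : OnePoint M)),
      e z * b ≤ H.stepPotential t D z) :
    (∫⁻ z, e z * w z ∂(m.map fun x : M => (x : OnePoint M))) * b ≤
      ENNReal.ofReal t * ∫⁻ z, e z ∂(m.map fun x : M => (x : OnePoint M)) := by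
  set μ := m.map fun x : M => (x : OnePoint M) with hμ
  set h : OnePoint M → ℝ≥0∞ := ((fun x : M => (x : OnePoint M)) '' D).indicator 1 with hh
  have hhm : Measurable h :=
    measurable_one.indicator (measurableEmbedding_coe.measurableSet_image.2 hD)
  have hh0 : h OnePoint.infty = 0 := indicator_of_notMem OnePoint.infty_notMem_image_coe _
  set v : ℕ → OnePoint M → ℝ≥0∞ := fun k => H.semigroup ((k + 1) * t) h with hv
  have hvm : ∀ k, Measurable (v k) := fun k => H.measurable_semigroup _ hhm
  set p : ℕ → ℝ≥0∞ := fun k => ENNReal.ofReal (Real.exp (-((k + 1) * t))) with hp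
  set d : ℕ → ℝ≥0∞ := fun k => p k * ∫⁻ z, v k z * w z ∂μ with hd
  set B : ℕ → ℝ≥0∞ := fun k => p k * ∫⁻ z, v k z * e z ∂μ with hB
  have hQe := H.measurable_semigroup t he
  have hmul : ∀ {f g : OnePoint M → ℝ≥0∞}, Measurable f → Measurable g →
      Measurable fun z => f z * g z := fun hf hg => hf.mul hg
  have hstep : ∀ k, d k + B (k + 1) = B k := by
    intro k
    have h1 : ∫⁻ z, v (k + 1) z * e z ∂μ = ∫⁻ z, v k z * H.semigroup t e z ∂μ := by
      rw [hH.lintegral_mul_semigroup H t (hvm k) he (H.semigroup_infty _ hh0) he0]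
      refine lintegral_congr fun z => ?_
      simp only [hv]
      rw [← H.semigroup_add _ _ hhm, mul_comm]
      congr 2; push_cast; ring
    have h2 : p (k + 1) = p k * ENNReal.ofReal (Real.exp (-(t : ℝ))) := by
      simp only [hp]
      rw [← ENNReal.ofReal_mul (Real.exp_pos _).le, ← Real.exp_add]
      congr 2; push_cast; ring
    simp only [hd, hB]
    rw [h1, h2, mul_assoc, ← mul_add, ← lintegral_const_mul _ (hmul (hvm k) hQe),
      ← lintegral_add_left (hmul (hvm k) hw)]
    congr 1
    refine lintegral_congr fun z => ?_
    rw [← hew z]; ring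
  have hB0 : B 0 ≤ ∫⁻ z, e z ∂μ := by
    simp only [hB, hv, hp]
    have h1 := hH.lintegral_mul_semigroup H t he hhm he0 hh0
    simp only [Nat.cast_zero, zero_add, one_mul]
    simp_rw [fun z => mul_comm (H.semigroup t h z) (e z)]
    rw [h1, ← lintegral_const_mul _ (hmul hhm hQe)]
    refine lintegral_mono fun z => ?_
    calc _ = h z * (ENNReal.ofReal (Real.exp (-(t : ℝ))) * H.semigroup t e z) := by ring
      _ ≤ 1 * e z := by
          gcongr
          · exact indicator_apply_le' (fun _ => le_rfl) fun _ => zero_le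
          · rw [← hew z]; exact le_add_self
      _ = e z := one_mul _
  have hsum : ∀ n, ∑ k ∈ Finset.range n, d k + B n = B 0 := by
    intro n
    induction n with
    | zero => simp
    | succ n ih => rw [Finset.sum_range_succ, add_assoc, hstep, ih]
  have hdsum : ∑' k, d k ≤ ∫⁻ z, e z ∂μ := by
    rw [ENNReal.tsum_eq_iSup_nat]
    exact iSup_le fun n => (le_self_add.trans (hsum n).le).trans hB0
  calc (∫⁻ z, e z * w z ∂μ) * b = ∫⁻ z, e z * b * w z ∂μ := by
        rw [mul_comm, ← lintegral_const_mul _ (hmul he hw)]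
        exact lintegral_congr fun z => by ring
    _ ≤ ∫⁻ z, H.stepPotential t D z * w z ∂μ := by
        refine lintegral_mono_ae ?_
        filter_upwards [hb] with z hz
        gcongr
    _ = ∫⁻ z, ∑' k, ENNReal.ofReal t * (p k * (v k z * w z)) ∂μ := by
        refine lintegral_congr fun z => ?_
        rw [stepPotential, ← ENNReal.tsum_mul_right]
        refine tsum_congr fun k => ?_
        simp only [hp, hv, hh]
        rw [H.semigroup_indicator _ hD, ENNReal.ofReal_mul t.coe_nonneg]
        ring
    _ = ∑' k, ENNReal.ofReal t * d k := by
        rw [lintegral_tsum fun k =>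
          (((hmul (hvm k) hw).const_mul _).const_mul _).aemeasurable]
        refine tsum_congr fun k => ?_
        rw [lintegral_const_mul _ ((hmul (hvm k) hw).const_mul _),
          lintegral_const_mul _ (hmul (hvm k) hw)]
    _ ≤ _ := by rw [ENNReal.tsum_mul_left]; gcongr

end Energy

end HuntProcess

theorem le_of_two_mul_succ_le {a : ℕ → ℝ} (h : ∀ k, 2 * a (k + 1) ≤ a k + a (k + 2)) (n : ℕ) :
    a 0 + n * (a 1 - a 0) ≤ a n := by
  have hd : ∀ k, a 1 - a 0 ≤ a (k + 1) - a k := by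
    intro k
    induction k with
    | zero => simp
    | succ k ih => linarith [h k]
  induction n with
  | zero => simp
  | succ n ih => push_cast; linarith [hd n]

section MidpointConvex

variable {ψ : ℝ≥0 → ℝ}

theorem two_mul_succ_le_of_midpoint (hconv : ∀ x y, 2 * ψ (x + y) ≤ ψ (2 * x) + ψ (2 * y))
    (s δ : ℝ≥0) (k : ℕ) :
    2 * ψ (s + ((k + 1 : ℕ) : ℝ≥0) * δ) ≤ ψ (s + k * δ) + ψ (s + ((k + 2 : ℕ) : ℝ≥0) * δ) := by
  have h := hconv ((s + k * δ) / 2) ((s + ((k + 2 : ℕ) : ℝ≥0) * δ) / 2)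
  rw [mul_div_cancel₀ _ two_ne_zero, mul_div_cancel₀ _ two_ne_zero] at h
  have e : (s + k * δ) / 2 + (s + ((k + 2 : ℕ) : ℝ≥0) * δ) / 2 =
      s + ((k + 1 : ℕ) : ℝ≥0) * δ := by
    rw [← NNReal.coe_inj]; push_cast; ring
  rwa [e] at h

theorem antitone_of_midpoint (hconv : ∀ x y, 2 * ψ (x + y) ≤ ψ (2 * x) + ψ (2 * y))
    {B : ℝ} (hB : ∀ t, ψ t ≤ B) : Antitone ψ := by
  intro s t hst
  by_contra! h
  have hk := le_of_two_mul_succ_le (a := fun k : ℕ => ψ (s + (k : ℝ≥0) * (t - s)))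
    (two_mul_succ_le_of_midpoint hconv s (t - s))
  simp only [Nat.cast_zero, zero_mul, add_zero, Nat.cast_one, one_mul,
    add_tsub_cancel_of_le hst] at hk
  obtain ⟨n, hn⟩ := exists_nat_gt ((B - ψ s) / (ψ t - ψ s))
  rw [div_lt_iff₀ (by linarith)] at hn
  linarith [hk n, hB (s + n * (t - s))]

theorem exists_tendsto_div_of_midpoint (hconv : ∀ x y, 2 * ψ (x + y) ≤ ψ (2 * x) + ψ (2 * y))
    {B A : ℝ} (hB : ∀ t, ψ t ≤ B) {t₀ : ℝ≥0} (ht₀ : 0 < t₀)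
    (hA : ∀ t, 0 < t → t ≤ t₀ → ψ 0 - ψ t ≤ A * t) :
    ∃ l, Tendsto (fun t : ℝ≥0 => (t : ℝ)⁻¹ * (ψ 0 - ψ t)) (𝓝[>] 0) (𝓝 l) := by
  have hanti := antitone_of_midpoint hconv hB
  have hsub : ∀ (n : ℕ) (t : ℝ≥0), ψ 0 - ψ (n * t) ≤ n * (ψ 0 - ψ t) := fun n t => by
    have := le_of_two_mul_succ_le (a := fun k : ℕ => ψ (0 + (k : ℝ≥0) * t))
      (two_mul_succ_le_of_midpoint hconv 0 t) n
    simp only [zero_add, Nat.cast_zero, zero_mul, Nat.cast_one, one_mul] at this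
    linarith
  set f : ℝ≥0 → ℝ := fun t => (t : ℝ)⁻¹ * (ψ 0 - ψ t) with hf
  have hbdd : BddAbove (f '' Ioc 0 t₀) := by
    refine ⟨A, ?_⟩
    rintro _ ⟨t, ht, rfl⟩
    have ht0 : (0 : ℝ) < t := ht.1
    rw [hf]
    simp only
    rw [inv_mul_le_iff₀ ht0, mul_comm]
    exact hA t ht.1 ht.2
  have hne : (f '' Ioc 0 t₀).Nonempty := ⟨_, t₀, ⟨ht₀, le_rfl⟩, rfl⟩
  refine ⟨sSup (f '' Ioc 0 t₀), tendsto_order.2 ⟨fun c hc => ?_, fun c hc => ?_⟩⟩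
  · obtain ⟨_, ⟨s, hs, rfl⟩, hcs⟩ := exists_lt_of_lt_csSup hne hc
    have hs0 : (0 : ℝ) < s := hs.1
    have hlim : Tendsto (fun t : ℝ≥0 => ((s : ℝ) + t)⁻¹ * (ψ 0 - ψ s)) (𝓝[>] 0)
        (𝓝 (f s)) := by
      have h1 : Tendsto (fun t : ℝ≥0 => (s : ℝ) + t) (𝓝 0) (𝓝 ((s : ℝ) + (0 : ℝ≥0))) :=
        (continuous_const.add NNReal.continuous_coe).tendsto 0
      rw [NNReal.coe_zero, add_zero] at h1
      exact ((h1.inv₀ hs0.ne').mul_const _).mono_left nhdsWithin_le_nhds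
    filter_upwards [hlim.eventually_const_lt hcs, self_mem_nhdsWithin] with t ht ht0
    refine ht.trans_le ?_
    have ht0' : (0 : ℝ) < t := ht0
    obtain ⟨n, hn⟩ : ∃ n : ℕ, n = ⌈(s : ℝ) / t⌉₊ := ⟨_, rfl⟩
    have hn1 : (s : ℝ) ≤ n * t := by
      rw [← div_le_iff₀ ht0', hn]; exact Nat.le_ceil _
    have hn2 : (n : ℝ) * t ≤ s + t := by
      have := Nat.ceil_lt_add_one (div_pos hs0 ht0').le
      rw [← hn] at this
      have h2 : (n : ℝ) * t ≤ (s / t + 1) * t := by gcongr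
      rwa [add_mul, div_mul_cancel₀ _ ht0'.ne', one_mul] at h2
    have h1 : ψ 0 - ψ s ≤ n * (ψ 0 - ψ t) := by
      refine le_trans ?_ (hsub n t)
      have : ψ (n * t) ≤ ψ s := hanti (by rw [← NNReal.coe_le_coe]; exact_mod_cast hn1)
      linarith
    have h0 : 0 ≤ ψ 0 - ψ t := sub_nonneg.2 (hanti zero_le)
    rw [hf]
    simp only
    rw [inv_mul_le_iff₀ (by positivity)]
    calc ψ 0 - ψ s ≤ n * (ψ 0 - ψ t) := h1
      _ = (n * t) * ((t : ℝ)⁻¹ * (ψ 0 - ψ t)) := by field_simp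
      _ ≤ (s + t) * ((t : ℝ)⁻¹ * (ψ 0 - ψ t)) := by gcongr
  · filter_upwards [Ioc_mem_nhdsGT ht₀] with t ht
    exact (le_csSup hbdd ⟨t, ht, rfl⟩).trans_lt hc

end MidpointConvex

theorem ENNReal.two_mul_mul_le (a b : ℝ≥0∞) : 2 * (a * b) ≤ a * a + b * b := by
  rcases eq_or_ne a ⊤ with rfl | ha
  · simp
  rcases eq_or_ne b ⊤ with rfl | hb
  · simp
  lift a to ℝ≥0 using ha
  lift b to ℝ≥0 using hb
  norm_cast
  rw [← NNReal.coe_le_coe]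
  push_cast
  nlinarith [sq_nonneg ((a : ℝ) - b)]

namespace HuntProcess

section Transition

variable {M : Type*} [TopologicalSpace M] [MeasurableSpace M] {Ω : Type*} [MeasurableSpace Ω]
  (H : HuntProcess M Ω) {m : Measure M}

/-- The transition operator on (a version of) a bounded function. -/
theorem transition_ae_eq {N : Set M} {p : ℝ≥0 → M → M → ℝ≥0} (hp : H.IsHeatKernel m N p)
    (hN : m N = 0) {e : OnePoint M → ℝ≥0∞} (he : Measurable e) (he0 : e OnePoint.infty = 0)
    (he1 : ∀ z, e z ≤ 1) {u : M → ℝ} (hu : u =ᵐ[m] fun x => (e (x : OnePoint M)).toReal)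
    {t : ℝ≥0} (ht : 0 < t) :
    ∀ᵐ x ∂m, H.transition t u x = (H.semigroup t e (x : OnePoint M)).toReal := by
  filter_upwards [measure_eq_zero_iff_ae_notMem.1 hN] with x hx
  obtain ⟨S, hS, hSm, hS0⟩ := exists_measurable_superset_of_null (ae_iff.1 hu)
  have hnull : H.P (x : OnePoint M) (H.inSet t S) = 0 := by
    rw [inSet, hp.density t ht x hx S hSm]
    exact setLIntegral_measure_zero _ _ hS0
  have hae : ∀ᵐ ω ∂(H.P (x : OnePoint M)),
      (H.X t ω).elim 0 u = (e (H.X t ω)).toReal := by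
    filter_upwards [measure_eq_zero_iff_ae_notMem.1 hnull] with ω hω
    induction h : H.X t ω using OnePoint.rec with
    | infty => simp [he0]
    | coe y =>
      by_contra hne
      exact hω ⟨y, hS hne, h⟩
  have hm : Measurable fun ω => e (H.X t ω) := he.comp (H.measurable_X t)
  rw [transition, integral_congr_ae hae, integral_toReal hm.aemeasurable]
  · rfl
  · exact ae_of_all _ fun ω => (he1 _).trans_lt ENNReal.one_lt_top

end Transition

section Capacity

variable {M : Type*} [MetricSpace M] [MeasurableSpace M] [BorelSpace M]
  {Ω : Type*} [MeasurableSpace Ω] (H : HuntProcess M Ω) {m : Measure M} {E : DirichletForm m}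

theorem IsGeneratedBy.midpoint (hH : H.IsGeneratedBy E) {e : OnePoint M → ℝ≥0∞}
    (he : Measurable e) (he0 : e OnePoint.infty = 0) (s t : ℝ≥0) :
    2 * ∫⁻ z, e z * H.semigroup (s + t) e z ∂(m.map fun x : M => (x : OnePoint M)) ≤
      ∫⁻ z, e z * H.semigroup (2 * s) e z ∂(m.map fun x : M => (x : OnePoint M)) +
      ∫⁻ z, e z * H.semigroup (2 * t) e z ∂(m.map fun x : M => (x : OnePoint M)) := by
  have key : ∀ s t : ℝ≥0,
      ∫⁻ z, e z * H.semigroup (s + t) e z ∂(m.map fun x : M => (x : OnePoint M)) =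
      ∫⁻ z, H.semigroup t e z * H.semigroup s e z ∂(m.map fun x : M => (x : OnePoint M)) := by
    intro s t
    rw [H.semigroup_add s t he]
    exact hH.lintegral_mul_semigroup H s he (H.measurable_semigroup t he) he0
      (H.semigroup_infty t he0)
  have hm : ∀ t, Measurable fun z => H.semigroup t e z * H.semigroup t e z := fun t =>
    (H.measurable_semigroup t he).mul (H.measurable_semigroup t he)
  have hm' : Measurable fun z => H.semigroup t e z * H.semigroup s e z :=
    (H.measurable_semigroup t he).mul (H.measurable_semigroup s he)
  rw [two_mul s, two_mul t, key s t, key s s, key t t, ← lintegral_const_mul _ hm',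
    ← lintegral_add_left (hm s)]
  refine lintegral_mono fun z => ?_
  rw [add_comm]
  exact ENNReal.two_mul_mul_le _ _

theorem toReal_lintegral_map_mul {f g : OnePoint M → ℝ≥0∞} (hf : Measurable f) (hg : Measurable g)
    (hf1 : ∀ z, f z ≤ 1) (hg1 : ∀ z, g z ≤ 1) :
    (∫⁻ z, f z * g z ∂(m.map fun x : M => (x : OnePoint M))).toReal =
      ∫ x : M, (f x).toReal * (g x).toReal ∂m := by
  have hfm : Measurable fun x : M => f x := hf.comp measurable_coe
  have hgm : Measurable fun x : M => g x := hg.comp measurable_coe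
  have hfg : Measurable fun z => f z * g z := hf.mul hg
  have hfgm : Measurable fun x : M => f x * g x := hfm.mul hgm
  rw [lintegral_map hfg measurable_coe, ← integral_toReal hfgm.aemeasurable]
  · simp
  · exact ae_of_all _ fun x => ENNReal.mul_lt_top ((hf1 _).trans_lt ENNReal.one_lt_top)
      ((hg1 _).trans_lt ENNReal.one_lt_top)

/-- An upper bound for the capacity of an open set from a bound for the approximating energies of
a function which is at least `1` on the set. -/
theorem openCapacity_le_of_energy_bound (hH : H.IsGeneratedBy E) {N : Set M}
    {p : ℝ≥0 → M → M → ℝ≥0} (hp : H.IsHeatKernel m N p) (hN : m N = 0)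
    {e : OnePoint M → ℝ≥0∞} (he : Measurable e) (he0 : e OnePoint.infty = 0)
    (he1 : ∀ z, e z ≤ 1) (hI : ∫⁻ z, e z ∂(m.map fun x : M => (x : OnePoint M)) < ∞)
    {G : Set M} (hG : ∀ x ∈ G, 1 ≤ e (x : OnePoint M)) {K : ℝ} {t₀ : ℝ≥0} (ht₀ : 0 < t₀)
    (hK : ∀ t : ℝ≥0, 0 < t → t ≤ t₀ →
      (∫⁻ z, e z * e z ∂(m.map fun x : M => (x : OnePoint M))).toReal - Real.exp (-(t : ℝ)) *
        (∫⁻ z, e z * H.semigroup t e z ∂(m.map fun x : M => (x : OnePoint M))).toReal ≤ K * t) :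
    E.openCapacity G ≤ ENNReal.ofReal K := by
  set μ := m.map fun x : M => (x : OnePoint M) with hμ
  set I := ∫⁻ z, e z ∂μ with hIdef
  set ψ : ℝ≥0 → ℝ := fun t => (∫⁻ z, e z * H.semigroup t e z ∂μ).toReal with hψ
  have hQm : ∀ t, Measurable (H.semigroup t e) := fun t => H.measurable_semigroup t he
  have hQ1 : ∀ t z, H.semigroup t e z ≤ 1 := fun t z => H.semigroup_le_of_le t he1 z
  have hle : ∀ t, ∫⁻ z, e z * H.semigroup t e z ∂μ ≤ I := fun t =>
    lintegral_mono fun z => (mul_le_mul' le_rfl (hQ1 t z)).trans_eq (mul_one _)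
  have hfin : ∀ t, ∫⁻ z, e z * H.semigroup t e z ∂μ ≠ ∞ := fun t => ((hle t).trans_lt hI).ne
  have hψ0 : ψ 0 = (∫⁻ z, e z * e z ∂μ).toReal := by simp only [hψ, H.semigroup_zero]
  have hψB : ∀ t, ψ t ≤ I.toReal := fun t => ENNReal.toReal_mono hI.ne (hle t)
  have hψnn : ∀ t, 0 ≤ ψ t := fun t => ENNReal.toReal_nonneg
  have hconv : ∀ s t, 2 * ψ (s + t) ≤ ψ (2 * s) + ψ (2 * t) := by
    intro s t
    have h := ENNReal.toReal_mono (ENNReal.add_ne_top.2 ⟨hfin _, hfin _⟩) (hH.midpoint H he he0 s t)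
    rwa [ENNReal.toReal_mul, ENNReal.toReal_add (hfin _) (hfin _), ENNReal.toReal_ofNat] at h
  have hK' : ∀ t, 0 < t → t ≤ t₀ → ψ 0 - ψ t ≤ K * t := fun t ht ht' => by
    refine le_trans ?_ (hK t ht ht')
    rw [hψ0]
    have h1 : Real.exp (-(t : ℝ)) ≤ 1 := Real.exp_le_one_iff.2 (by simp)
    have h2 := mul_le_of_le_one_left (hψnn t) h1
    simp only [hψ] at h2 ⊢
    linarith
  obtain ⟨l, hl⟩ := exists_tendsto_div_of_midpoint hconv hψB ht₀ hK'
  set er : M → ℝ := fun x => (e (x : OnePoint M)).toReal with her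
  have herm : Measurable er := (he.comp measurable_coe).ennreal_toReal
  have hemm : Measurable fun x : M => e (x : OnePoint M) := he.comp measurable_coe
  have hint : ∀ t, Integrable (fun x : M =>
      (H.semigroup t e (x : OnePoint M)).toReal * er x) m := by
    intro t
    have h1 : Measurable fun x : M => e x * H.semigroup t e x :=
      hemm.mul ((hQm t).comp measurable_coe)
    have h2 : ∫⁻ x : M, e x * H.semigroup t e x ∂m ≠ ∞ := by
      have hm : Measurable fun z => e z * H.semigroup t e z := he.mul (hQm t)
      have := hfin t
      rwa [hμ, lintegral_map hm measurable_coe] at this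
    refine (integrable_toReal_of_lintegral_ne_top h1.aemeasurable h2).congr
      (ae_of_all _ fun x => ?_)
    simp only [her, ENNReal.toReal_mul]; ring
  have hint0 : Integrable (fun x => er x * er x) m := by
    have := hint 0
    simpa only [H.semigroup_zero] using this
  have hmem : MemLp er 2 m := by
    rw [memLp_two_iff_integrable_sq herm.aestronglyMeasurable]
    exact hint0.congr (ae_of_all _ fun x => (sq (er x)).symm)
  set u : Lp ℝ 2 m := hmem.toLp er with hu
  have hue : (u : M → ℝ) =ᵐ[m] er := hmem.coeFn_toLp
  have hform : ∀ t : ℝ≥0, 0 < t →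
      ∫ x, (u x - H.transition t (fun y => u y) x) * u x ∂m = ψ 0 - ψ t := by
    intro t ht
    have h1 : ∫ x, (u x - H.transition t (fun y => u y) x) * u x ∂m =
        ∫ x, (er x * er x - (H.semigroup t e (x : OnePoint M)).toReal * er x) ∂m := by
      refine integral_congr_ae ?_
      filter_upwards [hue, H.transition_ae_eq hp hN he he0 he1 hue ht] with x hx1 hx2
      rw [hx2, hx1]; ring
    rw [h1, integral_sub hint0 (hint t), hψ0]
    simp only [hψ]
    rw [toReal_lintegral_map_mul he he he1 he1, toReal_lintegral_map_mul he (hQm t) he1 (hQ1 t)]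
    simp only [her, mul_comm]
  have hlim : Tendsto (fun t : ℝ≥0 =>
      (t : ℝ)⁻¹ * ∫ x, (u x - H.transition t (fun y => u y) x) * u x ∂m) (𝓝[>] 0) (𝓝 l) := by
    refine hl.congr' ?_
    filter_upwards [self_mem_nhdsWithin] with t ht
    rw [hform t ht]
  have hdom : u ∈ E.domain := (hH.mem_domain_iff u).2 ⟨l, hlim⟩
  have hEl : E.form ⟨u, hdom⟩ ⟨u, hdom⟩ = l :=
    tendsto_nhds_unique (hH.form_eq ⟨u, hdom⟩ ⟨u, hdom⟩) hlim
  have hnorm : ‖u‖ ^ 2 = ψ 0 := by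
    rw [← real_inner_self_eq_norm_sq, L2.inner_def, hψ0, toReal_lintegral_map_mul he he he1 he1]
    refine integral_congr_ae ?_
    filter_upwards [hue] with x hx
    rw [hx]; simp [her, sq]
  have hbound : l + ψ 0 ≤ K := by
    have h1 : Tendsto (fun t : ℝ≥0 => (t : ℝ)⁻¹ * (ψ 0 - ψ t) + (1 - (t : ℝ)) * (ψ 0 - K * t))
        (𝓝[>] 0) (𝓝 (l + ψ 0)) := by
      refine hl.add ?_
      have : Continuous fun t : ℝ≥0 => (1 - (t : ℝ)) * (ψ 0 - K * t) := by fun_prop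
      have h2 := this.tendsto 0
      simp only [NNReal.coe_zero, sub_zero, mul_zero, one_mul] at h2
      exact h2.mono_left nhdsWithin_le_nhds
    refine le_of_tendsto h1 ?_
    filter_upwards [Ioc_mem_nhdsGT (lt_min ht₀ one_pos)] with t ht
    have ht0 : (0 : ℝ) < t := ht.1
    have htt : t ≤ t₀ := ht.2.trans (min_le_left _ _)
    have ht1 : (t : ℝ) ≤ 1 := by exact_mod_cast ht.2.trans (min_le_right _ _)
    have h3 := hK t ht.1 htt
    have h4 := hK' t ht.1 htt
    rw [← hψ0] at h3
    have h5 : Real.exp (-(t : ℝ)) ≤ 1 - t + t ^ 2 := by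
      have h6 := Real.add_one_le_exp (t : ℝ)
      rw [Real.exp_neg]
      calc (Real.exp t)⁻¹ ≤ (t + 1 : ℝ)⁻¹ := by gcongr
        _ ≤ 1 - t + t ^ 2 := by
            rw [inv_le_iff_one_le_mul₀ (by positivity)]
            nlinarith [pow_pos ht0 3]
    have h7 : ψ 0 - (1 - t + t ^ 2) * ψ t ≤ K * t := by
      have := mul_le_mul_of_nonneg_right h5 (hψnn t)
      simp only [hψ] at this h3 ⊢
      linarith
    have h8 : (t : ℝ) * ((t : ℝ)⁻¹ * (ψ 0 - ψ t) + (1 - (t : ℝ)) * (ψ 0 - K * t)) ≤ t * K := by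
      rw [mul_add, mul_inv_cancel_left₀ ht0.ne']
      have : (1 - (t : ℝ)) * (ψ 0 - K * t) ≤ (1 - (t : ℝ)) * ψ t := by
        gcongr
        linarith
      nlinarith
    exact le_of_mul_le_mul_left h8 ht0
  refine (iInf₂_le (⟨u, hdom⟩ : E.domain) ?_).trans (ENNReal.ofReal_le_ofReal ?_)
  · filter_upwards [hue] with x hx hxG
    change 1 ≤ u x
    rw [hx]
    have := ENNReal.toReal_mono ((he1 x).trans_lt ENNReal.one_lt_top).ne (hG x hxG)
    simpa using this
  · change E.form ⟨u, hdom⟩ ⟨u, hdom⟩ + ‖u‖ ^ 2 ≤ K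
    rw [hEl, hnorm]; exact hbound

end Capacity

end HuntProcess

namespace HuntProcess

section EquilibriumPotential

variable {M : Type*} [MetricSpace M] [MeasurableSpace M] [BorelSpace M]
  {Ω : Type*} [MeasurableSpace Ω] {H : HuntProcess M Ω} {m : Measure M} {E : DirichletForm m}
  {N : Set M} {φ : ℝ → ℝ} {c C : ℝ}

theorem measurable_stepPotential (t : ℝ≥0) {D : Set M} (hD : MeasurableSet D) :
    Measurable (H.stepPotential t D) :=
  Measurable.tsum fun _ =>
    (Kernel.measurable_coe _ (H.measurableSet_inSet _ hD)).const_mul _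

/-- The constant in the comparison of hitting potentials with `1`-potentials. -/
noncomputable def potentialConst (φ : ℝ → ℝ) (c : ℝ) : ℝ≥0∞ :=
  ENNReal.ofReal (Real.exp (-(2 * φ 1)) * (φ 1 / 2)) * ENNReal.ofReal (c / 2)

theorem potentialConst_ne_zero (hφ : IsScaleFunction φ) (hc : 0 < c) :
    potentialConst φ c ≠ 0 := by
  have h1 := hφ.pos 1 one_pos
  refine mul_ne_zero ?_ ?_ <;> rw [ENNReal.ofReal_ne_zero_iff] <;> positivity

theorem potentialConst_ne_top : potentialConst φ c ≠ ∞ :=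
  ENNReal.mul_ne_top ENNReal.ofReal_ne_top ENNReal.ofReal_ne_top

theorem BallEstimate.hittingPotential_mul_le (hB : H.BallEstimate N φ c C)
    (hφ : IsScaleFunction φ) (hN : H.IsProperlyExceptional m N) {G D : Set M}
    (hG : MeasurableSet G) (hD : MeasurableSet D) (hGD : ∀ z ∈ G, Metric.ball z 1 ⊆ D)
    {t : ℝ≥0} (ht : 0 < t) (hta : (t : ℝ) ≤ φ 1 / 2) :
    ∀ᵐ z ∂(m.map fun x : M => (x : OnePoint M)),
      H.hittingPotential G z * potentialConst φ c ≤ H.stepPotential t D z := by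
  have hφ1 := hφ.pos 1 one_pos
  rw [ae_map_iff measurable_coe.aemeasurable (measurableSet_le
    ((H.measurable_hittingPotential hG).mul_const _) (measurable_stepPotential t hD))]
  filter_upwards [measure_eq_zero_iff_ae_notMem.1 hN.null] with x hx
  refine H.hittingPotential_mul_le (hN.avoids H hx) hG hD hφ1 (fun z hz hzN v hv hv' => ?_) ht hta
  have hv0 : 0 < v := by rw [← NNReal.coe_pos]; linarith
  refine le_trans (ENNReal.ofReal_le_ofReal ?_) ((hB.lower z hzN v hv0 z 1 one_pos
    (by simp) hv).trans (measure_mono (H.inSet_mono v (hGD z hz))))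
  rw [le_div_iff₀ (by exact_mod_cast hv0)]
  have := hB.c_pos
  nlinarith

theorem BallEstimate.lintegral_hittingPotential_lt_top (hB : H.BallEstimate N φ c C)
    (hφ : IsScaleFunction φ) (hN : H.IsProperlyExceptional m N) (hH : H.IsGeneratedBy E)
    {G : Set M} (hG : MeasurableSet G) (hGm : m (Metric.thickening 1 G) < ∞) :
    ∫⁻ z, H.hittingPotential G z ∂(m.map fun x : M => (x : OnePoint M)) < ∞ := by
  have hφ1 := hφ.pos 1 one_pos
  have hD : MeasurableSet (Metric.thickening 1 G) := Metric.isOpen_thickening.measurableSet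
  have ht : 0 < (φ 1 / 2).toNNReal := by rw [Real.toNNReal_pos]; positivity
  have h := lintegral_mono_ae (hB.hittingPotential_mul_le hφ hN hG hD
    (fun z hz => Metric.ball_subset_thickening hz 1) ht (Real.coe_toNNReal _ (by positivity)).le)
  have h' := h.trans_lt (H.lintegral_stepPotential_lt_top hH ht hD hGm)
  rw [lintegral_mul_const _ (H.measurable_hittingPotential hG)] at h'
  exact ENNReal.lt_top_of_mul_ne_top_left h'.ne (potentialConst_ne_zero hφ hB.c_pos)

theorem BallEstimate.openCapacity_le (hB : H.BallEstimate N φ c C)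
    (hφ : IsScaleFunction φ) (hN : H.IsProperlyExceptional m N) (hH : H.IsGeneratedBy E)
    {p : ℝ≥0 → M → M → ℝ≥0} (hp : H.IsHeatKernel m N p) {G : Set M} (hG : IsOpen G)
    (hI : ∫⁻ z, H.hittingPotential G z ∂(m.map fun x : M => (x : OnePoint M)) < ∞) :
    E.openCapacity G ≤ (potentialConst φ c)⁻¹ *
      ∫⁻ z, H.hittingPotential G z ∂(m.map fun x : M => (x : OnePoint M)) := by
  set μ := m.map fun x : M => (x : OnePoint M) with hμ
  set e := H.hittingPotential G with he
  set I := ∫⁻ z, e z ∂μ with hIdef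
  set B := potentialConst φ c with hBdef
  have hB0 : B ≠ 0 := potentialConst_ne_zero hφ hB.c_pos
  have hBt : B ≠ ∞ := potentialConst_ne_top
  have hφ1 := hφ.pos 1 one_pos
  have hem : Measurable e := H.measurable_hittingPotential hG.measurableSet
  have he1 : ∀ z, e z ≤ 1 := H.hittingPotential_le_one G
  have he0 : e OnePoint.infty = 0 := H.hittingPotential_infty G
  have ht₀ : 0 < (φ 1 / 2).toNNReal := by rw [Real.toNNReal_pos]; positivity
  have hfin : ∀ {f : OnePoint M → ℝ≥0∞}, (∀ z, f z ≤ 1) → ∫⁻ z, e z * f z ∂μ ≠ ∞ := by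
    intro f hf
    refine (lt_of_le_of_lt (lintegral_mono fun z => ?_) hI).ne
    exact (mul_le_mul' le_rfl (hf z)).trans_eq (mul_one _)
  have hmain := H.openCapacity_le_of_energy_bound hH hp hN.null hem he0 he1 hI
    (fun x hx => H.one_le_hittingPotential hG hx) (K := I.toReal / B.toReal) ht₀ ?_
  · refine hmain.trans (le_of_eq ?_)
    rw [← ENNReal.toReal_div, ENNReal.ofReal_toReal (ENNReal.div_ne_top hI.ne hB0),
      ENNReal.div_eq_inv_mul]
  intro t ht htt
  have htt' : (t : ℝ) ≤ φ 1 / 2 := by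
    have : (t : ℝ) ≤ (φ 1 / 2).toNNReal := by exact_mod_cast htt
    rwa [Real.coe_toNNReal _ (by positivity)] at this
  set κ := ENNReal.ofReal (Real.exp (-(t : ℝ))) with hκ
  have hQm : Measurable (H.semigroup t e) := H.measurable_semigroup t hem
  have hwm : Measurable fun z => e z - κ * H.semigroup t e z := hem.sub (hQm.const_mul _)
  have hew : ∀ z, (e z - κ * H.semigroup t e z) + κ * H.semigroup t e z = e z := fun z =>
    tsub_add_cancel_of_le (H.exp_mul_semigroup_hittingPotential_le hG t z)
  have hdef := H.lintegral_mul_defect_le hH MeasurableSet.univ hem hwm he0 hew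
    (hB.hittingPotential_mul_le hφ hN hG.measurableSet MeasurableSet.univ
      (fun z _ => subset_univ _) ht htt')
  have hm1 : Measurable fun z => e z * (e z - κ * H.semigroup t e z) := hem.mul hwm
  have hm2 : Measurable fun z => e z * H.semigroup t e z := hem.mul hQm
  have hsplit : ∫⁻ z, e z * e z ∂μ = ∫⁻ z, e z * (e z - κ * H.semigroup t e z) ∂μ +
      κ * ∫⁻ z, e z * H.semigroup t e z ∂μ := by
    rw [← lintegral_const_mul _ hm2, ← lintegral_add_left hm1]
    refine lintegral_congr fun z => ?_
    conv_lhs => rw [← hew z]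
    rw [hew z]
    nth_rewrite 1 [← hew z]
    ring
  have hf1 : ∫⁻ z, e z * (e z - κ * H.semigroup t e z) ∂μ ≠ ∞ :=
    hfin fun z => tsub_le_self.trans (he1 z)
  have hf2 : κ * ∫⁻ z, e z * H.semigroup t e z ∂μ ≠ ∞ :=
    ENNReal.mul_ne_top ENNReal.ofReal_ne_top (hfin (H.semigroup_le_of_le t he1))
  have h1 := ENNReal.toReal_mono (ENNReal.mul_ne_top ENNReal.ofReal_ne_top hI.ne) hdef
  rw [ENNReal.toReal_mul, ENNReal.toReal_mul, ENNReal.toReal_ofReal t.coe_nonneg] at h1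
  rw [hsplit, ENNReal.toReal_add hf1 hf2, ENNReal.toReal_mul,
    ENNReal.toReal_ofReal (Real.exp_pos _).le, add_sub_cancel_right, div_mul_eq_mul_div,
    le_div_iff₀ (ENNReal.toReal_pos hB0 hBt), mul_comm I.toReal]
  exact h1

end EquilibriumPotential

end HuntProcess

section Choquet

variable {α : Type*} [TopologicalSpace α]

/-- A finite, monotone and strongly subadditive set function on the open sets which is continuous
along increasing sequences. -/
structure IsOpenPrecapacity (c : Set α → ℝ≥0∞) : Prop where
  mono : ∀ U V, U ⊆ V → c U ≤ c V
  ne_top : ∀ U, c U ≠ ∞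
  union_add_inter : ∀ U V, IsOpen U → IsOpen V → c (U ∪ V) + c (U ∩ V) ≤ c U + c V
  iUnion_le : ∀ U : ℕ → Set α, (∀ n, IsOpen (U n)) → Monotone U → c (⋃ n, U n) ≤ ⨆ n, c (U n)

/-- The extension of a set function from the open sets to all sets. -/
noncomputable def outerCapacity (c : Set α → ℝ≥0∞) (A : Set α) : ℝ≥0∞ :=
  ⨅ (G : Set α) (_ : IsOpen G) (_ : A ⊆ G), c G

theorem outerCapacity_le {c : Set α → ℝ≥0∞} {A G : Set α} (hG : IsOpen G) (h : A ⊆ G) :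
    outerCapacity c A ≤ c G :=
  iInf_le_of_le G (iInf₂_le hG h)

theorem exists_isOpen_lt_of_outerCapacity_lt {c : Set α → ℝ≥0∞} {A : Set α} {b : ℝ≥0∞}
    (h : outerCapacity c A < b) : ∃ G, IsOpen G ∧ A ⊆ G ∧ c G < b := by
  simpa only [outerCapacity, iInf_lt_iff, exists_prop] using h

namespace IsOpenPrecapacity

variable {c : Set α → ℝ≥0∞}

theorem outerCapacity_ne_top (hc : IsOpenPrecapacity c) (A : Set α) : outerCapacity c A ≠ ∞ :=
  ((outerCapacity_le isOpen_univ (subset_univ A)).trans_lt (hc.ne_top univ).lt_top).ne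

theorem outerCapacity_iUnion_le (hc : IsOpenPrecapacity c) {A : ℕ → Set α}
    (hA : Monotone A) :
    outerCapacity c (⋃ n, A n) ≤ ⨆ n, outerCapacity c (A n) := by
  refine ENNReal.le_of_forall_pos_le_add fun ε hε _ => ?_
  obtain ⟨δ, hδ, hδε⟩ := ENNReal.exists_pos_sum_of_countable'
    (ENNReal.coe_ne_zero.2 hε.ne') ℕ
  have hU : ∀ n, ∃ G, IsOpen G ∧ A n ⊆ G ∧ c G < outerCapacity c (A n) + δ n := fun n =>
    exists_isOpen_lt_of_outerCapacity_lt
      (ENNReal.lt_add_right (hc.outerCapacity_ne_top _) (hδ n).ne')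
  choose U hUo hAU hUc using hU
  set V : ℕ → Set α := fun n => ⋃ k ∈ Finset.range (n + 1), U k with hV
  have hVo : ∀ n, IsOpen (V n) := fun n => isOpen_biUnion fun k _ => hUo k
  have hVs : ∀ n, V (n + 1) = V n ∪ U (n + 1) := fun n => by
    simp only [hV]
    rw [Finset.range_add_one, Finset.set_biUnion_insert, union_comm]
  have hVm : Monotone V := monotone_nat_of_le_succ fun n => by
    rw [hVs]; exact subset_union_left
  have hAV : ∀ n, A n ⊆ V n := fun n => (hAU n).trans
    (subset_biUnion_of_mem (u := U) (Finset.self_mem_range_succ n))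
  have key : ∀ n, c (V n) ≤ outerCapacity c (A n) + ∑ k ∈ Finset.range (n + 1), δ k := by
    intro n
    induction n with
    | zero => simpa [hV] using (hUc 0).le
    | succ n ih =>
      have h1 := hc.union_add_inter (V n) (U (n + 1)) (hVo n) (hUo (n + 1))
      have h2 : outerCapacity c (A n) ≤ c (V n ∩ U (n + 1)) :=
        outerCapacity_le ((hVo n).inter (hUo _))
          (subset_inter (hAV n) ((hA n.le_succ).trans (hAU _)))
      rw [← hVs] at h1
      refine (ENNReal.add_le_add_iff_right (hc.outerCapacity_ne_top (A n))).1 ?_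
      calc c (V (n + 1)) + outerCapacity c (A n) ≤ c (V n) + c (U (n + 1)) :=
            (add_le_add le_rfl h2).trans h1
        _ ≤ (outerCapacity c (A n) + ∑ k ∈ Finset.range (n + 1), δ k) +
            (outerCapacity c (A (n + 1)) + δ (n + 1)) := add_le_add ih (hUc _).le
        _ = _ := by rw [Finset.sum_range_succ _ (n + 1)]; ring
  calc outerCapacity c (⋃ n, A n) ≤ c (⋃ n, V n) :=
        outerCapacity_le (isOpen_iUnion hVo) (iUnion_mono hAV)
    _ ≤ ⨆ n, c (V n) := hc.iUnion_le V hVo hVm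
    _ ≤ (⨆ n, outerCapacity c (A n)) + ε := by
        refine iSup_le fun n => (key n).trans
          (add_le_add (le_iSup (fun n => outerCapacity c (A n)) n) ?_)
        exact (ENNReal.sum_le_tsum _).trans hδε.le

end IsOpenPrecapacity

theorem exists_forall_lt_le_subset {n : ℕ → ℕ} {O : Set (ℕ → ℕ)} (hO : IsOpen O)
    (h : {σ : ℕ → ℕ | ∀ i, σ i ≤ n i} ⊆ O) : ∃ J, {σ : ℕ → ℕ | ∀ i < J, σ i ≤ n i} ⊆ O := by
  have hK : IsCompact {σ : ℕ → ℕ | ∀ i, σ i ≤ n i} := by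
    have := isCompact_univ_pi fun i => (finite_Iic (n i)).isCompact
    convert this using 1
    ext σ; simp [Pi.le_def]
  have hcyl : ∀ σ ∈ {σ : ℕ → ℕ | ∀ i, σ i ≤ n i}, ∃ J, PiNat.cylinder σ J ⊆ O := by
    intro σ hσ
    obtain ⟨_, ⟨τ, J, rfl⟩, hσ', hsub⟩ :=
      (PiNat.isTopologicalBasis_cylinders fun _ : ℕ => ℕ).mem_nhds_iff.1 (hO.mem_nhds (h hσ))
    refine ⟨J, ?_⟩
    rwa [PiNat.mem_cylinder_iff_eq.1 hσ']
  choose! J hJ using hcyl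
  obtain ⟨s, hs, hsub⟩ := hK.elim_nhds_subcover (fun σ => PiNat.cylinder σ (J σ)) fun σ _ =>
    (PiNat.isOpen_cylinder _ σ (J σ)).mem_nhds (PiNat.self_mem_cylinder σ (J σ))
  refine ⟨s.sup J, fun τ hτ => ?_⟩
  have hmem : (fun i => min (τ i) (n i)) ∈ {σ : ℕ → ℕ | ∀ i, σ i ≤ n i} := fun i =>
    min_le_right _ _
  obtain ⟨σ, hσ, hτσ⟩ := mem_iUnion₂.1 (hsub hmem)
  refine hJ σ (hs σ hσ) fun i hi => ?_
  rw [← hτσ i hi]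
  exact (min_eq_left (hτ i (hi.trans_le (Finset.le_sup hσ)))).symm

/-- Choquet's capacitability theorem for null sets. -/
theorem IsOpenPrecapacity.outerCapacity_eq_zero {c : Set α → ℝ≥0∞} (hc : IsOpenPrecapacity c)
    {A : Set α} (hA : AnalyticSet A) (h : ∀ K ⊆ A, IsCompact K → outerCapacity c K = 0) :
    outerCapacity c A = 0 := by
  rw [AnalyticSet] at hA
  rcases hA with rfl | ⟨f, hf, rfl⟩
  · exact h ∅ subset_rfl isCompact_empty
  by_contra hne
  obtain ⟨a, ha0, ha⟩ := exists_between (pos_iff_ne_zero.2 hne)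
  have hstep : ∀ (i : ℕ) (S : {S : Set (ℕ → ℕ) // a < outerCapacity c (f '' S)}),
      ∃ n : ℕ, a < outerCapacity c (f '' (S.1 ∩ {σ | σ i ≤ n})) := by
    intro i S
    have hmono : Monotone fun n : ℕ => f '' (S.1 ∩ {σ | σ i ≤ n}) := fun n n' hn =>
      image_mono (inter_subset_inter_right _ fun σ hσ => le_trans hσ hn)
    have hun : f '' S.1 = ⋃ n : ℕ, f '' (S.1 ∩ {σ | σ i ≤ n}) := by
      rw [← image_iUnion, ← inter_iUnion]
      congr 1
      refine (inter_eq_left.2 fun σ _ => mem_iUnion.2 ⟨σ i, le_refl (σ i)⟩).symm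
    have h1 := S.2
    rw [hun] at h1
    exact lt_iSup_iff.1 (h1.trans_le (hc.outerCapacity_iUnion_le hmono))
  choose n hn using hstep
  set S : ℕ → {S : Set (ℕ → ℕ) // a < outerCapacity c (f '' S)} := fun i =>
    Nat.rec ⟨univ, by rwa [image_univ]⟩ (fun i S => ⟨_, hn i S⟩) i with hS
  have hSs : ∀ i, (S (i + 1)).1 = (S i).1 ∩ {σ | σ i ≤ n i (S i)} := fun i => rfl
  have hSi : ∀ i, (S i).1 = {σ | ∀ j < i, σ j ≤ n j (S j)} := by
    intro i
    induction i with
    | zero => ext σ; simp [hS]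
    | succ i ih =>
      rw [hSs, ih]
      ext σ
      simp only [mem_inter_iff, Set.mem_ofPred_eq, Nat.lt_succ_iff_lt_or_eq, or_imp, forall_and,
        forall_eq]
  have hKc : IsCompact {σ : ℕ → ℕ | ∀ i, σ i ≤ n i (S i)} := by
    have := isCompact_univ_pi fun i => (finite_Iic (n i (S i))).isCompact
    convert this using 1
    ext σ; simp [Pi.le_def]
  have hK0 := h _ (image_subset_range f _) (hKc.image hf)
  obtain ⟨G, hGo, hKG, hGa⟩ := exists_isOpen_lt_of_outerCapacity_lt (hK0.trans_lt ha0)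
  obtain ⟨J, hJ⟩ := exists_forall_lt_le_subset (hGo.preimage hf) (image_subset_iff.1 hKG)
  rw [← hSi] at hJ
  exact lt_irrefl _ ((S J).2.trans_le
    ((outerCapacity_le hGo (image_subset_iff.2 hJ)).trans hGa.le))

end Choquet

section AnalyticSet

theorem MeasurableSet.analyticSet_of_sigmaCompact {M : Type*} [MetricSpace M] [SigmaCompactSpace M]
    [MeasurableSpace M] [BorelSpace M] {N : Set M} (hN : MeasurableSet N) : AnalyticSet N := by
  have h : N = ⋃ n, ((↑) : compactCovering M n → M) '' ((↑) ⁻¹' N) := by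
    simp only [Subtype.image_preimage_coe, ← iUnion_inter, iUnion_compactCovering, univ_inter]
  rw [h]
  refine AnalyticSet.iUnion fun n => ?_
  have : CompactSpace (compactCovering M n) := isCompact_iff_compactSpace.1
    (isCompact_compactCovering M n)
  have hm : MeasurableSet (((↑) : compactCovering M n → M) ⁻¹' N) := measurable_subtype_coe hN
  exact hm.analyticSet.image_of_continuous continuous_subtype_val

end AnalyticSet

namespace HuntProcess

section DiscountedVisit

variable {M : Type*}

theorem discountedVisit_iUnion_le {ι : Type*} (U : ι → Set M) (w : ℝ≥0 → OnePoint M) :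
    discountedVisit (⋃ i, U i) w ≤ ⨆ i, discountedVisit (U i) w := by
  refine iSup₂_le fun q hq => indicator_apply_le' (fun h => ?_) fun _ => zero_le
  rw [image_iUnion, mem_iUnion] at h
  obtain ⟨i, hi⟩ := h
  refine le_iSup_of_le i (le_iSup₂_of_le q hq ?_)
  rw [indicator_of_mem hi]

theorem discountedVisit_union_le (U V : Set M) (w : ℝ≥0 → OnePoint M) :
    discountedVisit (U ∪ V) w ≤ max (discountedVisit U w) (discountedVisit V w) := by
  refine iSup₂_le fun q hq => indicator_apply_le' (fun h => ?_) fun _ => zero_le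
  rw [image_union] at h
  rcases h with h | h
  · exact le_max_of_le_left (le_iSup₂_of_le q hq (by rw [indicator_of_mem h]))
  · exact le_max_of_le_right (le_iSup₂_of_le q hq (by rw [indicator_of_mem h]))

theorem discountedVisit_union_add_inter_le (U V : Set M) (w : ℝ≥0 → OnePoint M) :
    discountedVisit (U ∪ V) w + discountedVisit (U ∩ V) w ≤
      discountedVisit U w + discountedVisit V w := by
  rw [← max_add_min (discountedVisit U w)]
  exact add_le_add (discountedVisit_union_le U V w) (le_min
    (discountedVisit_mono inter_subset_left w) (discountedVisit_mono inter_subset_right w))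

end DiscountedVisit

section Potential

variable {M : Type*} [TopologicalSpace M] [MeasurableSpace M] [BorelSpace M]
  {Ω : Type*} [MeasurableSpace Ω] (H : HuntProcess M Ω) (μ : Measure (OnePoint M))

theorem measurable_discountedVisit_path {G : Set M} (hG : MeasurableSet G) :
    Measurable fun ω => discountedVisit G (H.path ω) :=
  (measurable_discountedVisit hG).comp H.measurable_path

theorem lintegral_hittingPotential_iUnion_le_tsum {U : ℕ → Set M}
    (hU : ∀ n, MeasurableSet (U n)) :
    ∫⁻ z, H.hittingPotential (⋃ n, U n) z ∂μ ≤ ∑' n, ∫⁻ z, H.hittingPotential (U n) z ∂μ := by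
  rw [← lintegral_tsum fun n => (H.measurable_hittingPotential (hU n)).aemeasurable]
  refine lintegral_mono fun z => ?_
  simp only [hittingPotential]
  rw [← lintegral_tsum fun n => (H.measurable_discountedVisit_path (hU n)).aemeasurable]
  exact lintegral_mono fun ω => (discountedVisit_iUnion_le U _).trans
    (iSup_le fun n => ENNReal.le_tsum n)

/-- The integral of the hitting potential of `G ∩ B` is a precapacity. -/
theorem isOpenPrecapacity_lintegral_hittingPotential {B : Set M} (hB : IsOpen B)
    (hfin : ∫⁻ z, H.hittingPotential B z ∂μ < ∞) :
    IsOpenPrecapacity fun G => ∫⁻ z, H.hittingPotential (G ∩ B) z ∂μ where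
  mono U V h := lintegral_mono (H.hittingPotential_mono (inter_subset_inter_left _ h))
  ne_top U := ((lintegral_mono (H.hittingPotential_mono inter_subset_right)).trans_lt hfin).ne
  union_add_inter U V hU hV := by
    have hm : ∀ {G : Set M}, IsOpen G → MeasurableSet (G ∩ B) := fun hG =>
      (hG.inter hB).measurableSet
    rw [← lintegral_add_left (H.measurable_hittingPotential (hm (hU.union hV))),
      ← lintegral_add_left (H.measurable_hittingPotential (hm hU))]
    refine lintegral_mono fun z => ?_
    simp only [hittingPotential]
    rw [← lintegral_add_left (H.measurable_discountedVisit_path (hm (hU.union hV))),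
      ← lintegral_add_left (H.measurable_discountedVisit_path (hm hU))]
    refine lintegral_mono fun ω => ?_
    rw [union_inter_distrib_right, inter_inter_distrib_right]
    exact discountedVisit_union_add_inter_le _ _ _
  iUnion_le U hU hmono := by
    have hm : ∀ n, MeasurableSet (U n ∩ B) := fun n => ((hU n).inter hB).measurableSet
    have hUB : Monotone fun n => U n ∩ B := fun i j h => inter_subset_inter_left _ (hmono h)
    rw [← lintegral_iSup (fun n => H.measurable_hittingPotential (hm n))
      fun i j h => H.hittingPotential_mono (hUB h)]
    refine lintegral_mono fun z => ?_
    simp only [hittingPotential]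
    rw [← lintegral_iSup (fun n => H.measurable_discountedVisit_path (hm n))
      fun i j h ω => discountedVisit_mono (hUB h) _, iUnion_inter]
    exact lintegral_mono fun ω => discountedVisit_iUnion_le _ _

end Potential

section Compact

variable {M : Type*} [MetricSpace M] [LocallyCompactSpace M] {Ω : Type*} [MeasurableSpace Ω]
  (H : HuntProcess M Ω)

/-- A path which visits every neighbourhood of a compact set at bounded times visits the set, or
one of its left limits does. -/
theorem exists_mem_or_leftLimit_mem {K : Set M} (hK : IsCompact K) {ω : Ω} {T : ℝ≥0}
    (h : ∀ n : ℕ, ∃ q ≤ T, ω ∈ H.inSet q (Metric.thickening (1 / (n + 1 : ℝ)) K)) :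
    ∃ y ∈ K, ∃ t : ℝ≥0, H.X t ω = (y : OnePoint M) ∨
      0 < t ∧ Tendsto (fun s => H.X s ω) (𝓝[<] t) (𝓝 (y : OnePoint M)) := by
  choose q hqT hq using h
  choose y hy hXy using hq
  choose z hzK hz using fun n => Metric.mem_thickening_iff.1 (hy n)
  obtain ⟨t, -, i, hi, hqt⟩ := (isCompact_Icc (a := (0 : ℝ≥0)) (b := T)).tendsto_subseq
    (x := q) fun n => ⟨zero_le, hqT n⟩
  obtain ⟨v, hvK, j, hj, hzv⟩ := hK.tendsto_subseq (x := z ∘ i) fun n => hzK _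
  have hij : Tendsto (i ∘ j) atTop atTop := hi.tendsto_atTop.comp hj.tendsto_atTop
  have hqt' : Tendsto (fun n => q (i (j n))) atTop (𝓝 t) := hqt.comp hj.tendsto_atTop
  have hyv : Tendsto (fun n => y (i (j n))) atTop (𝓝 v) := by
    refine tendsto_of_tendsto_of_dist (f₁ := fun n => z (i (j n))) hzv ?_
    refine squeeze_zero (fun _ => dist_nonneg) (fun n => ?_)
      (tendsto_one_div_add_atTop_nhds_zero_nat.comp hij)
    rw [dist_comm]
    exact (hz _).le
  have hX : Tendsto (fun n => H.X (q (i (j n))) ω) atTop (𝓝 (v : OnePoint M)) := by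
    simp only [hXy]
    exact (OnePoint.continuous_coe.tendsto v).comp hyv
  refine ⟨v, hvK, t, ?_⟩
  by_cases hfreq : ∃ᶠ n in atTop, t ≤ q (i (j n))
  · left
    have hne := Filter.frequently_iff_neBot.1 hfreq
    have hl : Tendsto (fun n => q (i (j n))) (atTop ⊓ 𝓟 {n | t ≤ q (i (j n))}) (𝓝[≥] t) :=
      tendsto_nhdsWithin_iff.2 ⟨hqt'.mono_left inf_le_left,
        eventually_inf_principal.2 (Eventually.of_forall fun _ h => h)⟩
    exact tendsto_nhds_unique ((H.right_continuous ω t).tendsto.comp hl)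
      (hX.mono_left inf_le_left)
  · right
    rw [not_frequently] at hfreq
    have hlt : ∀ᶠ n in atTop, q (i (j n)) < t := hfreq.mono fun n hn => not_le.1 hn
    obtain ⟨n, hn⟩ := hlt.exists
    have ht : 0 < t := pos_of_gt hn
    obtain ⟨y', hy'⟩ := H.left_limits ω t ht
    have h1 := hy'.comp (tendsto_nhdsWithin_iff.2 ⟨hqt', hlt⟩)
    rw [tendsto_nhds_unique h1 hX] at hy'
    exact ⟨ht, hy'⟩

theorem tendsto_discountedVisit_thickening {K B : Set M} (hK : IsCompact K) {ω : Ω}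
    (h : ∀ y ∈ K, ∀ t : ℝ≥0, ¬ (H.X t ω = (y : OnePoint M) ∨
      0 < t ∧ Tendsto (fun s => H.X s ω) (𝓝[<] t) (𝓝 (y : OnePoint M)))) :
    Tendsto (fun n : ℕ => discountedVisit (Metric.thickening (1 / (n + 1 : ℝ)) K ∩ B) (H.path ω))
      atTop (𝓝 0) := by
  refine ENNReal.tendsto_atTop_zero.2 fun ε hε => ?_
  by_contra! hcon
  have hex : Tendsto (fun v : ℝ≥0 => ENNReal.ofReal (Real.exp (-(v : ℝ)))) atTop (𝓝 0) := by
    have h1 : Tendsto (fun v : ℝ≥0 => Real.exp (-(v : ℝ))) atTop (𝓝 0) :=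
      Real.tendsto_exp_neg_atTop_nhds_zero.comp (NNReal.tendsto_coe_atTop.2 tendsto_id)
    simpa using ENNReal.tendsto_ofReal h1
  obtain ⟨T, hT⟩ := eventually_atTop.1 (hex.eventually_lt_const hε)
  suffices hvisit : ∀ n : ℕ, ∃ q ≤ T, ω ∈ H.inSet q (Metric.thickening (1 / (n + 1 : ℝ)) K) by
    obtain ⟨y, hy, t, ht⟩ := H.exists_mem_or_leftLimit_mem hK hvisit
    exact h y hy t ht
  intro n
  obtain ⟨k, hnk, hk⟩ := hcon n
  rw [discountedVisit, lt_iSup_iff] at hk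
  obtain ⟨q, hk⟩ := hk
  rw [lt_iSup_iff] at hk
  obtain ⟨hq, hk⟩ := hk
  by_cases hmem : H.path ω q ∈ (fun x : M => (x : OnePoint M)) ''
      (Metric.thickening (1 / (k + 1 : ℝ)) K ∩ B)
  · rw [indicator_of_mem hmem] at hk
    refine ⟨q, ?_, ?_⟩
    · by_contra! hTq
      exact lt_asymm hk (hT q hTq.le)
    · obtain ⟨y, ⟨hy, -⟩, hXy⟩ := hmem
      exact ⟨y, Metric.thickening_mono (Nat.one_div_le_one_div hnk) K hy, hXy.symm⟩
  · rw [indicator_of_notMem hmem] at hk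
    exact absurd hk not_lt_zero

end Compact

section Capacity

variable {M : Type*} [MetricSpace M] [LocallyCompactSpace M] [MeasurableSpace M] [BorelSpace M]
  {Ω : Type*} [MeasurableSpace Ω] (H : HuntProcess M Ω) {m : Measure M} {N : Set M}

theorem tendsto_hittingPotential_thickening (hN : H.IsProperlyExceptional m N) {K B : Set M}
    (hK : IsCompact K) (hKN : K ⊆ N) (hB : MeasurableSet B) {x : M} (hx : x ∉ N) :
    Tendsto (fun n : ℕ => H.hittingPotential (Metric.thickening (1 / (n + 1 : ℝ)) K ∩ B)
      (x : OnePoint M)) atTop (𝓝 0) := by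
  have hm : ∀ n : ℕ, MeasurableSet (Metric.thickening (1 / (n + 1 : ℝ)) K ∩ B) := fun n =>
    Metric.isOpen_thickening.measurableSet.inter hB
  have hlim := tendsto_lintegral_of_dominated_convergence (μ := H.P (x : OnePoint M))
    (F := fun (n : ℕ) ω =>
      discountedVisit (Metric.thickening (1 / (n + 1 : ℝ)) K ∩ B) (H.path ω))
    (f := fun _ => 0) (fun _ => 1) (fun n => H.measurable_discountedVisit_path (hm n))
    (fun n => ae_of_all _ fun ω => discountedVisit_le_one _ _) (by simp) ?_
  · rwa [lintegral_zero] at hlim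
  filter_upwards [H.start x, hN.invariant x hx] with ω h0 hinv
  refine H.tendsto_discountedVisit_thickening hK fun y hy t => ?_
  rintro (h | ⟨ht, h⟩)
  · rcases eq_or_ne t 0 with rfl | ht
    · rw [h0] at h
      exact hx (OnePoint.coe_injective h ▸ hKN hy)
    · exact (hinv t (pos_iff_ne_zero.2 ht) y (hKN hy)).1 h
  · exact (hinv t ht y (hKN hy)).2 h

theorem outerCapacity_inter_eq_zero [SigmaCompactSpace M] (hN : H.IsProperlyExceptional m N)
    {B : Set M} (hB : IsOpen B)
    (hfin : ∫⁻ z, H.hittingPotential B z ∂(m.map fun x : M => (x : OnePoint M)) < ∞) :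
    outerCapacity (fun G => ∫⁻ z, H.hittingPotential (G ∩ B) z
      ∂(m.map fun x : M => (x : OnePoint M))) N = 0 := by
  refine (H.isOpenPrecapacity_lintegral_hittingPotential _ hB hfin).outerCapacity_eq_zero
    hN.measurableSet.analyticSet_of_sigmaCompact fun K hKN hK => ?_
  set G : ℕ → Set M := fun n => Metric.thickening (1 / (n + 1 : ℝ)) K with hG
  have hm : ∀ n, MeasurableSet (G n ∩ B) := fun n =>
    Metric.isOpen_thickening.measurableSet.inter hB.measurableSet
  have hlim : Tendsto (fun n => ∫⁻ x : M, H.hittingPotential (G n ∩ B) (x : OnePoint M) ∂m) atTop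
      (𝓝 (∫⁻ _, 0 ∂m)) := by
    have hfin' := hfin.ne
    rw [lintegral_map (H.measurable_hittingPotential hB.measurableSet) measurable_coe] at hfin'
    refine tendsto_lintegral_of_dominated_convergence _
      (fun n => (H.measurable_hittingPotential (hm n)).comp measurable_coe)
      (fun n => ae_of_all _ fun x => H.hittingPotential_mono inter_subset_right _) hfin' ?_
    filter_upwards [measure_eq_zero_iff_ae_notMem.1 hN.null] with x hx
    exact H.tendsto_hittingPotential_thickening hN hK hKN hB.measurableSet hx
  rw [lintegral_zero] at hlim
  refine le_antisymm (ge_of_tendsto' hlim fun n => ?_) zero_le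
  rw [← lintegral_map (H.measurable_hittingPotential (hm n)) measurable_coe]
  exact outerCapacity_le Metric.isOpen_thickening
    (Metric.self_subset_thickening Nat.one_div_pos_of_nat K)

/-- A properly exceptional set has zero capacity. -/
theorem BallEstimate.capacity_eq_zero {H : HuntProcess M Ω} [SigmaCompactSpace M]
    {E : DirichletForm m} {φ : ℝ → ℝ} {c C : ℝ} (hB : H.BallEstimate N φ c C)
    (hφ : IsScaleFunction φ) (hN : H.IsProperlyExceptional m N) (hH : H.IsGeneratedBy E)
    {p : ℝ≥0 → M → M → ℝ≥0} (hp : H.IsHeatKernel m N p)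
    (hfin : ∀ (x : M) (r : ℝ), 0 < r → m (Metric.ball x r) < ∞) : E.capacity N = 0 := by
  set μ := m.map fun x : M => (x : OnePoint M) with hμ
  have hsmall : ∀ ε : ℝ≥0∞, ε ≠ 0 → ε ≠ ∞ → ∃ G, IsOpen G ∧ N ⊆ G ∧
      ∫⁻ z, H.hittingPotential G z ∂μ ≤ ε := by
    intro ε hε _
    rcases isEmpty_or_nonempty M with hM | ⟨⟨x₀⟩⟩
    · exact ⟨univ, isOpen_univ, subset_univ _, by simp [hμ, Measure.eq_zero_of_isEmpty m]⟩
    obtain ⟨δ, hδ, hδε⟩ := ENNReal.exists_pos_sum_of_countable' hε ℕ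
    have hex : ∀ k : ℕ, ∃ G, IsOpen G ∧ N ⊆ G ∧
        ∫⁻ z, H.hittingPotential (G ∩ Metric.ball x₀ k) z ∂μ < δ k := by
      intro k
      refine exists_isOpen_lt_of_outerCapacity_lt (c := fun G =>
        ∫⁻ z, H.hittingPotential (G ∩ Metric.ball x₀ k) z ∂μ) ?_
      rw [H.outerCapacity_inter_eq_zero hN Metric.isOpen_ball]
      · exact hδ k
      refine hB.lintegral_hittingPotential_lt_top hφ hN hH Metric.isOpen_ball.measurableSet
        (lt_of_le_of_lt (measure_mono ?_) (hfin x₀ (1 + k) (by positivity)))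
      rcases Nat.eq_zero_or_pos k with rfl | hk
      · simp
      · exact Metric.thickening_ball _ _ _
    choose G hGo hNG hGδ using hex
    refine ⟨⋃ k, G k ∩ Metric.ball x₀ k, isOpen_iUnion fun k => (hGo k).inter Metric.isOpen_ball,
      fun x hx => ?_, ?_⟩
    · obtain ⟨k, hk⟩ := exists_nat_gt (dist x x₀)
      exact mem_iUnion.2 ⟨k, hNG k hx, hk⟩
    · refine (H.lintegral_hittingPotential_iUnion_le_tsum μ fun k =>
        ((hGo k).inter Metric.isOpen_ball).measurableSet).trans ?_
      exact (ENNReal.tsum_le_tsum fun k => (hGδ k).le).trans hδε.le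
  set B := (potentialConst φ c)⁻¹ with hBdef
  have hBt : B ≠ ∞ := ENNReal.inv_ne_top.2 (potentialConst_ne_zero hφ hB.c_pos)
  refine le_antisymm (ge_of_tendsto (x := 𝓝[>] (0 : ℝ≥0∞)) (f := fun ε => B * ε) ?_ ?_) zero_le
  · have := ENNReal.Tendsto.const_mul (a := B) (tendsto_id (α := ℝ≥0∞) (x := 𝓝 0)) (Or.inr hBt)
    rw [mul_zero] at this
    exact this.mono_left nhdsWithin_le_nhds
  · filter_upwards [Ioo_mem_nhdsGT (zero_lt_one (α := ℝ≥0∞))] with ε hε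
    have hεt := (hε.2.trans ENNReal.one_lt_top).ne
    obtain ⟨G, hGo, hNG, hG⟩ := hsmall ε hε.1.ne' hεt
    refine (iInf_le_of_le G (iInf₂_le hGo hNG)).trans ?_
    exact (hB.openCapacity_le hφ hN hH hp hGo (hG.trans_lt hεt.lt_top)).trans
      (mul_le_mul' le_rfl hG)

end Capacity

end HuntProcess

theorem theorem2p6
    {M : Type*} [MetricSpace M] [LocallyCompactSpace M] [TopologicalSpace.SeparableSpace M]
    [MeasurableSpace M] [BorelSpace M]
    (m : Measure M) [m.Regular] [m.IsOpenPosMeasure]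
    (E : DirichletForm m) (hE : E.IsRegular) (hJ : E.IsPureJump)
    {Ω : Type*} [MeasurableSpace Ω] (H : HuntProcess M Ω) (hH : H.IsGeneratedBy E)
    (hV : VolumeGrowth m)
    (N : Set M) (hN : H.IsProperlyExceptional m N)
    (p : ℝ≥0 → M → M → ℝ≥0) (hp : H.IsHeatKernel m N p)
    (φ : ℝ → ℝ) (hφ : IsScaleFunction φ) (hest : HeatKernelEstimate m N φ p)
    (hcrit : CriticalVolume m φ)
    (g : ℝ → ℝ) (hgpos : ∀ t, 0 < t → 0 < g t) (hganti : AntitoneOn g (Ioi 0))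
    (hglim : Tendsto g atTop (𝓝 0))
    (hgint : logTail g 1 < ∞) (hgreg : LogRegular g) :
    E.QuasiEverywhere fun x : M =>
      ∃ T c₁ c₂ : ℝ≥0, 0 < T ∧ 0 < c₁ ∧ 0 < c₂ ∧ ∀ t : ℝ≥0, T ≤ t →
        c₁ * logTail g t ≤ H.crossingProb (fun u => scaleInv φ u * g u) t x ∧
        H.crossingProb (fun u => scaleInv φ u * g u) t x ≤ c₂ * logTail g t := by
  have : SecondCountableTopology M := UniformSpace.secondCountable_of_separable M
  obtain ⟨c, C, hB⟩ := H.exists_ballEstimate hV hN.null hp hφ hest hcrit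
  exact ⟨N, hB.capacity_eq_zero hφ hN hH hp hV.1, fun x hx =>
    hB.crossingProb_bounds hφ hgpos hganti hglim hgint hgreg hx (hN.avoids H hx)⟩
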